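/- Let $L>0$ and let $\Gamma$ be a strictly decreasing curve in the first quadrant with $x$- and $y$-intercepts at $L$: the graph of a continuous strictly decreasing $f$ on $[0,L]$ with $f(0)=L$, $f(L)=0$, and with inverse function $g$ on $[0,L]$. Let $\sigma,\tau>-1/2$, write $x^-=\max(-x,0)$, let $\operatorname{Area}(\Gamma)=\int_0^L f(x)\,dx$, and for $r,s>0$ let $N(r,s)$ be the number of pairs $(j,k)$ of positive integers such that $(j+\sigma,k+\tau)$ lies inside or on the curve $y=rsf(sx/r)$, $0\le x\le rL/s$, that is, $(j+\sigma)s/r\le L$ and $k+\tau\le rsf((j+\sigma)s/r)$. Let $S(r)=\operatorname{argmax}_{s>0}N(r,s)$. Assume that one of the following two pairs of conditions holds. *Concave case.* (i) $f$ is concave on $[0,L]$ and $$\max\Big\{f\Big(\frac{1-\sigma^-}{2-\sigma^-}L\Big),\,g\Big(\frac{1-\tau^-}{2-\tau^-}L\Big)\Big\}<2\Big(\frac12-\sigma^--\tau^-\Big)L .$$ (ii) For some $(\alpha,\beta)\in\Gamma$ with $\alpha,\beta>0$ one has $f\in C^2[0,\alpha]$, $f'<0$ on $(0,\alpha]$,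 $f''<0$ and $f''$ monotonic on $[0,\alpha]$, and $g\in C^2[0,\beta]$, $g'<0$ on $(0,\beta]$, $g''<0$ and $g''$ monotonic on $[0,\beta]$. *Convex case.* (i) $f$ is convex on $[0,L]$, $$\min\Big\{(1-\sigma^-)f\Big(\frac{1-\sigma^-}{2-\sigma^-}L\Big),\,(1-\tau^-)g\Big(\frac{1-\tau^-}{2-\tau^-}L\Big)\Big\}>2(\sigma^-+\tau^-)L ,$$ $$\min\Big\{(1+\sigma)f\Big(\frac{1+\sigma}{2+\sigma}x\Big)-f(x):\frac{1+\sigma}{2+\sigma}L\le x\le L\Big\}>0 ,$$ $$\min\Big\{(1+\tau)g\Big(\frac{1+\tau}{2+\tau}y\Big)-g(y):\frac{1+\tau}{2+\tau}L\le y\le L\Big\}>0 .$$ (ii) For some $(\alpha,\beta)\in\Gamma$ with $\alpha,\beta>0$ one has $f\in C^2[\alpha,L]$, $f'<0$ on $[\alpha,L)$, $f''>0$ and $f''$ monotonic on $[\alpha,L]$, and $g\in C^2[\beta,L]$, $g'<0$ on $[\beta,L)$, $g''>0$ and $g''$ monotonic on $[\beta,L]$. Then, with $$s^*=\sqrt{\frac{\tau+1/2}{\sigma+1/2}},$$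 the stretch factors maximizing $N(r,\cdot)$ approach $s^*$ as $r\to\infty$, with $$S(r)\subset\big[s^*-O(r^{-1/6}),\,s^*+O(r^{-1/6})\big],$$ and the maximum of $N(r,\cdot)$ over $s>0$ (which is attained for every $r>0$) satisfies, as $r\to\infty$, $$\max_{s>0}N(r,s)=r^2\operatorname{Area}(\Gamma)-2rL\sqrt{(\sigma+1/2)(\tau+1/2)}+O(r^{2/3}).$$ In particular, when $\sigma=\tau$, the optimal stretch factors approach $s^*=1$ as $r\to\infty$. -/

import Mathlib

open Set Filter Topology Asymptotics MeasureTheory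

noncomputable section

namespace ShiftedLattice

/-- A strictly decreasing curve in the first quadrant with both intercepts equal to `L > 0`: it is
the graph of the continuous function `f` on `[0, L]`, and `g` is the inverse function of `f` on
`[0, L]`.  Nothing is required of `f` and `g` outside `[0, L]`. -/
structure IsDecreasingCurve (L : ℝ) (f g : ℝ → ℝ) : Prop where
  L_pos : 0 < L
  map_zero : f 0 = L
  map_L : f L = 0
  continuousOn : ContinuousOn f (Icc 0 L)
  strictAntiOn : StrictAntiOn f (Icc 0 L)
  mapsTo_inv : MapsTo g (Icc 0 L) (Icc 0 L)
  invOn : InvOn g f (Icc 0 L) (Icc 0 L)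

/-- The area enclosed by the curve and the coordinate axes. -/
def area (L : ℝ) (f : ℝ → ℝ) : ℝ := ∫ x in (0 : ℝ)..L, f x

/-- The points `(j + σ, k + τ)` of the shifted positive-integer lattice, recorded by their indices
`(j, k)`, that lie inside or on the curve `y = r s f (s x / r)`, `0 ≤ x ≤ r L / s`. -/
def enclosedPoints (L : ℝ) (f : ℝ → ℝ) (σ τ r s : ℝ) : Set (ℕ × ℕ) :=
  {p | 1 ≤ p.1 ∧ 1 ≤ p.2 ∧ ((p.1 : ℝ) + σ) * s / r ≤ L ∧
    (p.2 : ℝ) + τ ≤ r * s * f (((p.1 : ℝ) + σ) * s / r)}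

/-- The shifted-lattice counting function `N(r, s)`. -/
def count (L : ℝ) (f : ℝ → ℝ) (σ τ r s : ℝ) : ℕ := (enclosedPoints L f σ τ r s).ncard

/-- The set `S(r)` of the stretch factors `s > 0` that maximize `s ↦ N(r, s)` on `(0, ∞)`. -/
def optimalStretch (L : ℝ) (f : ℝ → ℝ) (σ τ r : ℝ) : Set ℝ :=
  {s | 0 < s ∧ ∀ t, 0 < t → count L f σ τ r t ≤ count L f σ τ r s}

/-- The minimum of `(1 + σ) f ((1 + σ) / (2 + σ) * x) - f x` over
`(1 + σ) / (2 + σ) * L ≤ x ≤ L` (attained, since `f` is continuous on `[0, L]`). -/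
def mu (L : ℝ) (f : ℝ → ℝ) (σ : ℝ) : ℝ :=
  sInf ((fun x => (1 + σ) * f ((1 + σ) / (2 + σ) * x) - f x) '' Icc ((1 + σ) / (2 + σ) * L) L)

/-- The parameter assumption for concave curves; `σ⁻` is the negative part `max (-σ) 0`. -/
structure ParamConcave (L : ℝ) (f g : ℝ → ℝ) (σ τ : ℝ) : Prop where
  concaveOn : ConcaveOn ℝ (Icc 0 L) f
  max_lt : max (f ((1 - σ⁻) / (2 - σ⁻) * L)) (g ((1 - τ⁻) / (2 - τ⁻) * L))
    < 2 * (1 / 2 - σ⁻ - τ⁻) * L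

/-- The parameter assumption for convex curves. -/
structure ParamConvex (L : ℝ) (f g : ℝ → ℝ) (σ τ : ℝ) : Prop where
  convexOn : ConvexOn ℝ (Icc 0 L) f
  lt_min : 2 * (σ⁻ + τ⁻) * L
    < min ((1 - σ⁻) * f ((1 - σ⁻) / (2 - σ⁻) * L)) ((1 - τ⁻) * g ((1 - τ⁻) / (2 - τ⁻) * L))
  mu_f_pos : 0 < mu L f σ
  mu_g_pos : 0 < mu L g τ

/-- `h ∈ C²[0, a]`, `h' < 0` on `(0, a]`, `h'' < 0` on `[0, a]` and `h''` is monotonic on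
`[0, a]`; the derivatives at the end points are one-sided. -/
structure SmoothConcavePiece (h : ℝ → ℝ) (a : ℝ) : Prop where
  contDiffOn : ContDiffOn ℝ 2 h (Icc 0 a)
  deriv_neg : ∀ x ∈ Ioc 0 a, derivWithin h (Icc 0 a) x < 0
  deriv2_neg : ∀ x ∈ Icc 0 a, iteratedDerivWithin 2 h (Icc 0 a) x < 0
  monotonic : MonotoneOn (iteratedDerivWithin 2 h (Icc 0 a)) (Icc 0 a) ∨
    AntitoneOn (iteratedDerivWithin 2 h (Icc 0 a)) (Icc 0 a)

/-- `h ∈ C²[a, L]`, `h' < 0` on `[a, L)`, `h'' > 0` on `[a, L]` and `h''` is monotonic on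
`[a, L]`; the derivatives at the end points are one-sided. -/
structure SmoothConvexPiece (h : ℝ → ℝ) (a L : ℝ) : Prop where
  contDiffOn : ContDiffOn ℝ 2 h (Icc a L)
  deriv_neg : ∀ x ∈ Ico a L, derivWithin h (Icc a L) x < 0
  deriv2_pos : ∀ x ∈ Icc a L, 0 < iteratedDerivWithin 2 h (Icc a L) x
  monotonic : MonotoneOn (iteratedDerivWithin 2 h (Icc a L)) (Icc a L) ∨
    AntitoneOn (iteratedDerivWithin 2 h (Icc a L)) (Icc a L)

/-- The smoothness condition for concave curves; `(α, β)` is a point of the curve with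
`α, β > 0`. -/
def ConcaveCondition (L : ℝ) (f g : ℝ → ℝ) : Prop :=
  ConcaveOn ℝ (Icc 0 L) f ∧
    ∃ α β : ℝ, α ∈ Icc 0 L ∧ f α = β ∧ 0 < α ∧ 0 < β ∧
      SmoothConcavePiece f α ∧ SmoothConcavePiece g β

/-- The smoothness condition for convex curves; `(α, β)` is a point of the curve with
`α, β > 0`. -/
def ConvexCondition (L : ℝ) (f g : ℝ → ℝ) : Prop :=
  ConvexOn ℝ (Icc 0 L) f ∧
    ∃ α β : ℝ, α ∈ Icc 0 L ∧ f α = β ∧ 0 < α ∧ 0 < β ∧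
      SmoothConvexPiece f α L ∧ SmoothConvexPiece g β L

/-- The limiting stretch factor `s* = √((τ + 1/2) / (σ + 1/2))`. -/
def sStar (σ τ : ℝ) : ℝ := Real.sqrt ((τ + 1 / 2) / (σ + 1 / 2))

end ShiftedLattice

end

/-! The heart of the matter is the two-term asymptotic N(r,s) = r² Area - rL((σ+1/2)s + (τ+1/2)/s) +
O(r^(2/3)), uniform for s in a compact subset of (0,∞) (`UniformAsymptotics`). The bracket is least
exactly at s*, by the arithmetic-geometric mean inequality, and grows quadratically away from it
(`perimeter_eq`). A maximizer s does at least as well as s*, so r(s-s*)² = O(r^(2/3)): this is the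
rate r^(-1/6), and the maximum itself is known up to O(r^(2/3)).

The comparison requires that maximizers stay in a compact set. This comes from the cruder bound
N(r,s) ≤ r² Area - c r max(s,1/s) + 1, valid for all s with N(r,s) > 0
(`UpperBound.exists_count_le`). Column heights form a Riemann sum for the area. Concavity or
convexity makes that sum fall short of the area by a multiple of the mesh s/r, and the parameter
conditions ensure that this gain beats the loss caused by negative shifts. Reflection in the
diagonal exchanges f with g and s with 1/s, so s ≥ 1 suffices.

For the asymptotic, the region is cut at the point (α,β), so that f is used only where it is C² with
f'' ≠ 0, and g likewise. In each piece the count is a sum of ⌊y⌋ = y - 1/2 - ψ(y), with ψ the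
sawtooth. The smooth part is handled by Euler–Maclaurin summation (`abs_sum_sub_integral_le`). For
the sum of ψ, the second differences of the heights have constant sign and size about 1/r, so van
der Corput's second derivative test (`norm_sum_expTwoPi_le`, from the Kusmin–Landau inequality)
bounds the exponential sums. They are transferred to ψ through differences of the periodic second
Bernoulli function, whose Fourier series converges absolutely (`abs_sum_sawtooth_le`). The result is
O(r^(2/3)). The boundary terms of order r at the cut cancel when the two pieces are assembled with
the rectangle below (α,β).

Throughout the second half r = ρ³, so that r^(2/3) = ρ² and only integer powers occur. -/

namespace ShiftedLattice

/-! ### Exponential sums: Kusmin–Landau and van der Corput. -/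

/-- The additive character `x ↦ exp (2 π i x)`. -/
noncomputable def expTwoPi (x : ℝ) : ℂ := Complex.exp ((2 * Real.pi * x : ℝ) * Complex.I)

lemma norm_expTwoPi (x : ℝ) : ‖expTwoPi x‖ = 1 := Complex.norm_exp_ofReal_mul_I _

lemma expTwoPi_add (x y : ℝ) : expTwoPi (x + y) = expTwoPi x * expTwoPi y := by
  unfold expTwoPi
  rw [← Complex.exp_add]
  congr 1
  push_cast
  ring

lemma expTwoPi_neg (x : ℝ) : expTwoPi (-x) = (starRingEnd ℂ) (expTwoPi x) := by
  unfold expTwoPi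
  rw [← Complex.exp_conj, map_mul, Complex.conj_I, Complex.conj_ofReal]
  congr 1
  push_cast
  ring

lemma expTwoPi_re (x : ℝ) : (expTwoPi x).re = Real.cos (2 * Real.pi * x) := by
  unfold expTwoPi
  rw [Complex.exp_ofReal_mul_I_re]

lemma expTwoPi_sub_int (x : ℝ) (m : ℤ) : expTwoPi (x - m) = expTwoPi x := by
  unfold expTwoPi
  rw [Complex.exp_eq_exp_iff_exists_int]
  refine ⟨-m, ?_⟩
  push_cast
  ring

/-- The inverse of `1 - exp (2 π i t)` is `(1 + i cot (π t)) / 2`. -/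
lemma one_sub_expTwoPi_mul {t : ℝ} (h : Real.sin (Real.pi * t) ≠ 0) :
    (1 - expTwoPi t) *
      (1 / 2 + ((Real.cos (Real.pi * t) / Real.sin (Real.pi * t) / 2 : ℝ) : ℂ) * Complex.I) = 1 := by
  have h1 : expTwoPi t = ((2 * Real.cos (Real.pi * t) ^ 2 - 1 : ℝ) : ℂ)
      + ((2 * Real.sin (Real.pi * t) * Real.cos (Real.pi * t) : ℝ) : ℂ) * Complex.I := by
    unfold expTwoPi
    rw [Complex.exp_mul_I, ← Complex.ofReal_cos, ← Complex.ofReal_sin,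
      show 2 * Real.pi * t = 2 * (Real.pi * t) by ring, Real.cos_two_mul, Real.sin_two_mul]
  have h2 := Real.sin_sq_add_cos_sq (Real.pi * t)
  rw [h1]
  set S := Real.sin (Real.pi * t)
  set C := Real.cos (Real.pi * t)
  have h3 : (S : ℂ) ^ 2 + (C : ℂ) ^ 2 = 1 := by exact_mod_cast h2
  have h4 : (S : ℂ) ≠ 0 := by exact_mod_cast h
  push_cast
  field_simp
  linear_combination (-2 * (C : ℂ) * Complex.I) * h3 - 2 * (S : ℂ) * (C : ℂ) ^ 2 * Complex.I_sq

lemma two_mul_le_sin_pi {t d : ℝ} (hd : 0 ≤ d) (h1 : d ≤ t) (h2 : t ≤ 1 - d) :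
    2 * d ≤ Real.sin (Real.pi * t) := by
  have hpi := Real.pi_pos
  rcases le_total t (1 / 2) with h | h
  · have := Real.mul_le_sin (x := Real.pi * t) (by nlinarith) (by nlinarith)
    have e : 2 / Real.pi * (Real.pi * t) = 2 * t := by field_simp
    linarith
  · have := Real.mul_le_sin (x := Real.pi * (1 - t)) (by nlinarith) (by nlinarith)
    have e : 2 / Real.pi * (Real.pi * (1 - t)) = 2 * (1 - t) := by field_simp
    have e2 : Real.sin (Real.pi * (1 - t)) = Real.sin (Real.pi * t) := by
      rw [mul_sub, mul_one, Real.sin_pi_sub]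
    linarith

lemma cot_pi_antitone {t u : ℝ} (ht : 0 < t) (htu : t ≤ u) (hu : u < 1) :
    Real.cos (Real.pi * u) / Real.sin (Real.pi * u)
      ≤ Real.cos (Real.pi * t) / Real.sin (Real.pi * t) := by
  have hpi := Real.pi_pos
  have s1 : 0 < Real.sin (Real.pi * t) :=
    Real.sin_pos_of_pos_of_lt_pi (by positivity) (by nlinarith)
  have s2 : 0 < Real.sin (Real.pi * u) :=
    Real.sin_pos_of_pos_of_lt_pi (by nlinarith) (by nlinarith)
  rw [div_le_div_iff₀ s2 s1]
  have := Real.sin_nonneg_of_nonneg_of_le_pi (x := Real.pi * u - Real.pi * t)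
    (by nlinarith) (by nlinarith)
  rw [Real.sin_sub] at this
  linarith

/-- Kusmin–Landau inequality. -/
theorem norm_sum_expTwoPi_le_inv (φ : ℕ → ℝ) (N : ℕ) (m : ℤ) {d : ℝ} (hd : 0 < d)
    (hlow : ∀ n < N, d ≤ φ (n + 1) - φ n - m) (hup : ∀ n < N, φ (n + 1) - φ n - m ≤ 1 - d)
    (hmono : ∀ n, n + 1 < N → φ (n + 1) - φ n ≤ φ (n + 2) - φ (n + 1)) :
    ‖∑ n ∈ Finset.range N, expTwoPi (φ n)‖ ≤ 1 / d := by
  rcases N with _ | N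
  · simp; positivity
  set t : ℕ → ℝ := fun n => φ (n + 1) - φ n - m with ht
  set k : ℕ → ℝ := fun n => Real.cos (Real.pi * t n) / Real.sin (Real.pi * t n) with hk
  -- This is 1 / (1 - e(t n)), so each term of the sum becomes a weighted difference of consecutive
  -- terms and Abel summation applies.
  set c : ℕ → ℂ := fun n => 1 / 2 + ((k n / 2 : ℝ) : ℂ) * Complex.I with hc
  have hsin : ∀ n < N + 1, 2 * d ≤ Real.sin (Real.pi * t n) := fun n hn =>
    two_mul_le_sin_pi hd.le (hlow n hn) (hup n hn)
  have hu : ∀ n < N + 1, expTwoPi (φ n) = (expTwoPi (φ n) - expTwoPi (φ (n + 1))) * c n := by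
    intro n hn
    have h1 : expTwoPi (φ (n + 1)) = expTwoPi (φ n) * expTwoPi (t n) := by
      rw [ht]
      simp only
      rw [expTwoPi_sub_int, ← expTwoPi_add]
      congr 1
      ring
    have h2 : (1 - expTwoPi (t n)) * c n = 1 :=
      one_sub_expTwoPi_mul (by linarith [hsin n hn])
    rw [h1]
    linear_combination (-expTwoPi (φ n)) * h2
  have habel : ∀ M : ℕ, ∑ n ∈ Finset.range (M + 1), (expTwoPi (φ n) - expTwoPi (φ (n + 1))) * c n
      = expTwoPi (φ 0) * c 0 - expTwoPi (φ (M + 1)) * c M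
        + ∑ n ∈ Finset.range M, expTwoPi (φ (n + 1)) * (c (n + 1) - c n) := by
    intro M
    induction M with
    | zero => simp; ring
    | succ M ih => rw [Finset.sum_range_succ, ih, Finset.sum_range_succ _ M]; ring
  have hkb : ∀ n < N + 1, |k n| ≤ 1 / (2 * d) := by
    intro n hn
    have h := hsin n hn
    rw [hk]
    simp only
    rw [abs_div, abs_of_pos (show 0 < Real.sin (Real.pi * t n) by linarith)]
    exact div_le_div₀ zero_le_one (Real.abs_cos_le_one _) (by positivity) h
  have hcn : ∀ n < N + 1, ‖c n‖ ≤ 1 / (4 * d) := by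
    intro n hn
    have h := hsin n hn
    have hs : 0 < Real.sin (Real.pi * t n) := by linarith
    have h3 := Real.sin_sq_add_cos_sq (Real.pi * t n)
    have : ‖c n‖ ^ 2 = (1 / (2 * Real.sin (Real.pi * t n))) ^ 2 := by
      have e : c n = ⟨1 / 2, k n / 2⟩ := by
        apply Complex.ext <;> simp [hc]
      rw [← Complex.normSq_eq_norm_sq, e, Complex.normSq_mk]
      simp only [hk]
      field_simp
      linarith
    have h4 : ‖c n‖ = 1 / (2 * Real.sin (Real.pi * t n)) := by
      rwa [sq_eq_sq₀ (norm_nonneg _) (by positivity)] at this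
    rw [h4]
    apply one_div_le_one_div_of_le (by positivity)
    linarith
  -- The real part of c is constant and its imaginary part is monotone, so the total variation
  -- telescopes. The variation and the two end terms each contribute at most 1 / (2d).
  have hdiff : ∀ n < N, ‖expTwoPi (φ (n + 1)) * (c (n + 1) - c n)‖ ≤ (k n - k (n + 1)) / 2 := by
    intro n hn
    have e : c (n + 1) - c n = ((-((k n - k (n + 1)) / 2) : ℝ) : ℂ) * Complex.I := by
      simp only [hc]
      push_cast
      ring
    rw [norm_mul, norm_expTwoPi, one_mul, e, norm_mul, Complex.norm_I, mul_one,
      Complex.norm_real, norm_neg, Real.norm_eq_abs, abs_of_nonneg]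
    have := cot_pi_antitone (t := t n) (u := t (n + 1)) (by linarith [hlow n (by omega)])
      (by have := hmono n (by omega); simp only [ht, add_assoc] at *; norm_num at *; linarith)
      (by linarith [hup (n + 1) (by omega)])
    simp only [hk]
    linarith
  rw [Finset.sum_congr rfl fun n hn => hu n (Finset.mem_range.1 hn), habel N]
  have h1 : ‖∑ n ∈ Finset.range N, expTwoPi (φ (n + 1)) * (c (n + 1) - c n)‖
      ≤ (k 0 - k N) / 2 := by
    refine (norm_sum_le_of_le _ fun n hn => hdiff n (Finset.mem_range.1 hn)).trans ?_
    rw [← Finset.sum_div, Finset.sum_range_sub']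
  have h2 := abs_le.1 (hkb 0 (by omega))
  have h3 := abs_le.1 (hkb N (by omega))
  have h4 := hcn 0 (by omega)
  have h5 := hcn N (by omega)
  have h6 : ‖expTwoPi (φ 0) * c 0‖ = ‖c 0‖ := by rw [norm_mul, norm_expTwoPi, one_mul]
  have h7 : ‖expTwoPi (φ (N + 1)) * c N‖ = ‖c N‖ := by rw [norm_mul, norm_expTwoPi, one_mul]
  have e1 : 1 / (4 * d) = 1 / d / 4 := by field_simp
  have e2 : 1 / (2 * d) = 1 / d / 2 := by field_simp
  have h8 := norm_add_le (expTwoPi (φ 0) * c 0 - expTwoPi (φ (N + 1)) * c N)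
    (∑ n ∈ Finset.range N, expTwoPi (φ (n + 1)) * (c (n + 1) - c n))
  have h9 := norm_sub_le (expTwoPi (φ 0) * c 0) (expTwoPi (φ (N + 1)) * c N)
  linarith

/-- A set of naturals of diameter at most `D` has at most `D + 1` elements. -/
lemma card_le_of_diam {S : Finset ℕ} {D : ℝ} (hD : 0 ≤ D)
    (h : ∀ i ∈ S, ∀ j ∈ S, i ≤ j → (j : ℝ) - i ≤ D) : (S.card : ℝ) ≤ D + 1 := by
  rcases S.eq_empty_or_nonempty with rfl | hS
  · simp; linarith
  have hsub : S ⊆ Finset.Icc (S.min' hS) (S.max' hS) := fun x hx =>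
    Finset.mem_Icc.2 ⟨S.min'_le x hx, S.le_max' x hx⟩
  have hle : S.min' hS ≤ S.max' hS := S.min'_le _ (S.max'_mem hS)
  have h1 := Finset.card_le_card hsub
  rw [Nat.card_Icc] at h1
  have h2 := h _ (S.min'_mem hS) _ (S.max'_mem hS) hle
  have h3 : (S.card : ℝ) ≤ ((S.max' hS + 1 - S.min' hS : ℕ) : ℝ) := by exact_mod_cast h1
  rw [Nat.cast_sub (by omega)] at h3
  push_cast at h3
  linarith

/-- A set of naturals that is closed under intermediate values is an interval. -/
lemma exists_eq_Ico {S : Finset ℕ} (h : ∀ i ∈ S, ∀ j ∈ S, ∀ k, i ≤ k → k ≤ j → k ∈ S) :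
    ∃ p q, S = Finset.Ico p q := by
  rcases S.eq_empty_or_nonempty with rfl | hS
  · exact ⟨0, 0, by simp⟩
  refine ⟨S.min' hS, S.max' hS + 1, ?_⟩
  ext k
  rw [Finset.mem_Ico]
  constructor
  · exact fun hk => ⟨S.min'_le k hk, Nat.lt_succ_of_le (S.le_max' k hk)⟩
  · exact fun hk => h _ (S.min'_mem hS) _ (S.max'_mem hS) k hk.1 (Nat.le_of_lt_succ hk.2)

section SecondDifference

variable {φ : ℕ → ℝ} {N : ℕ} {l u : ℝ}

lemma mul_sub_le_increment_sub
    (hl : ∀ n, n + 1 < N → l ≤ (φ (n + 2) - φ (n + 1)) - (φ (n + 1) - φ n)) {i j : ℕ}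
    (hij : i ≤ j) (hj : j < N) :
    l * ((j : ℝ) - i) ≤ (φ (j + 1) - φ j) - (φ (i + 1) - φ i) := by
  induction j, hij using Nat.le_induction with
  | base => simp
  | succ j hij ih =>
    have h1 := ih (by omega)
    have h2 := hl j hj
    push_cast
    rw [show j + 1 + 1 = j + 2 by ring]
    linarith

lemma increment_sub_le_mul_sub
    (hu : ∀ n, n + 1 < N → (φ (n + 2) - φ (n + 1)) - (φ (n + 1) - φ n) ≤ u) {i j : ℕ}
    (hij : i ≤ j) (hj : j < N) :
    (φ (j + 1) - φ j) - (φ (i + 1) - φ i) ≤ u * ((j : ℝ) - i) := by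
  induction j, hij using Nat.le_induction with
  | base => simp
  | succ j hij ih =>
    have h1 := ih (by omega)
    have h2 := hu j hj
    push_cast
    rw [show j + 1 + 1 = j + 2 by ring]
    linarith

/-- The part of the exponential sum on which the increments have integer part `m`. -/
lemma norm_sum_expTwoPi_filter_floor_le (hl0 : 0 < l) (hl1 : l ≤ 1 / 4)
    (hl : ∀ n, n + 1 < N → l ≤ (φ (n + 2) - φ (n + 1)) - (φ (n + 1) - φ n)) (m : ℤ) :
    ‖∑ n ∈ (Finset.range N).filter (fun n => ⌊φ (n + 1) - φ n⌋ = m), expTwoPi (φ n)‖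
      ≤ 4 / Real.sqrt l := by
  -- Balances the Kusmin–Landau bound 1/d, for increments at distance at least d from the integers,
  -- against the d/l + 1 indices on either side with increments closer than d.
  set d := Real.sqrt l with hd
  have hdpos : 0 < d := Real.sqrt_pos.2 hl0
  have hdl : d * d = l := Real.mul_self_sqrt hl0.le
  have hd2 : d ≤ 1 / 2 := by nlinarith
  set A := (Finset.range N).filter (fun n => ⌊φ (n + 1) - φ n⌋ = m) with hA
  set P : ℕ → Prop := fun n => d ≤ φ (n + 1) - φ n - m ∧ φ (n + 1) - φ n - m ≤ 1 - d with hP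
  have hmemA : ∀ n ∈ A, n < N ∧ (m : ℝ) ≤ φ (n + 1) - φ n ∧ φ (n + 1) - φ n < m + 1 := by
    intro n hn
    rw [hA, Finset.mem_filter, Finset.mem_range, Int.floor_eq_iff] at hn
    exact hn
  have hmono : ∀ {i j : ℕ}, i ≤ j → j < N →
      l * ((j : ℝ) - i) ≤ (φ (j + 1) - φ j) - (φ (i + 1) - φ i) := fun hij hj =>
    mul_sub_le_increment_sub hl hij hj
  have hmono' : ∀ {i j : ℕ}, i ≤ j → j < N → φ (i + 1) - φ i ≤ φ (j + 1) - φ j := by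
    intro i j hij hj
    have := hmono hij hj
    have h2 : (0 : ℝ) ≤ (j : ℝ) - i := sub_nonneg.2 (by exact_mod_cast hij)
    nlinarith
  classical
  have hB : ‖∑ n ∈ A.filter P, expTwoPi (φ n)‖ ≤ 1 / d := by
    obtain ⟨p, q, hpq⟩ := exists_eq_Ico (S := A.filter P) (by
      intro i hi j hj k hik hkj
      rw [Finset.mem_filter] at hi hj ⊢
      have h1 := hmemA i hi.1
      have h2 := hmemA j hj.1
      have h3 := hmono' hik (by omega)
      have h4 := hmono' hkj (by omega)
      refine ⟨?_, ?_, ?_⟩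
      · rw [hA, Finset.mem_filter, Finset.mem_range, Int.floor_eq_iff]
        exact ⟨by omega, by linarith, by linarith⟩
      · linarith [hi.2.1]
      · linarith [hj.2.2])
    rw [hpq, Finset.sum_Ico_eq_sum_range]
    have hmem : ∀ n < q - p, p + n ∈ A ∧ P (p + n) := by
      intro n hn
      rw [← Finset.mem_filter, hpq, Finset.mem_Ico]
      omega
    refine norm_sum_expTwoPi_le_inv (fun n => φ (p + n)) (q - p) m hdpos
      (fun n hn => (hmem n hn).2.1) (fun n hn => (hmem n hn).2.2) fun n hn => ?_
    have := hmono' (i := p + n) (j := p + (n + 1)) (by omega) (hmemA _ (hmem (n + 1) hn).1).1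
    exact this
  have hcardl : ((((A.filter fun n => ¬ P n).filter
      fun n => φ (n + 1) - φ n - m < d).card : ℕ) : ℝ) ≤ d / l + 1 := by
    apply card_le_of_diam (by positivity)
    intro i hi j hj hij
    simp only [Finset.mem_filter] at hi hj
    have h1 := hmono hij (hmemA j hj.1.1).1
    have h2 := hmemA i hi.1.1
    rw [le_div_iff₀ hl0]
    linarith
  have hcardr : ((((A.filter fun n => ¬ P n).filter
      fun n => ¬ φ (n + 1) - φ n - m < d).card : ℕ) : ℝ) ≤ d / l + 1 := by
    apply card_le_of_diam (by positivity)
    intro i hi j hj hij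
    simp only [Finset.mem_filter, hP, not_and, not_le, not_lt] at hi hj
    have h1 := hmono hij (hmemA j hj.1.1).1
    have h2 := hmemA j hj.1.1
    have h3 := hi.1.2 hi.2
    rw [le_div_iff₀ hl0]
    linarith
  have hnorm : ∀ T : Finset ℕ, ‖∑ n ∈ T, expTwoPi (φ n)‖ ≤ T.card := by
    intro T
    refine (norm_sum_le_of_le T fun n _ => (norm_expTwoPi (φ n)).le).trans ?_
    simp
  rw [← Finset.sum_filter_add_sum_filter_not A P,
    ← Finset.sum_filter_add_sum_filter_not (A.filter fun n => ¬ P n)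
      (fun n => φ (n + 1) - φ n - m < d)]
  have h1 := hnorm ((A.filter fun n => ¬ P n).filter fun n => φ (n + 1) - φ n - m < d)
  have h2 := hnorm ((A.filter fun n => ¬ P n).filter fun n => ¬ φ (n + 1) - φ n - m < d)
  refine (norm_add_le _ _).trans ?_
  have h3 := norm_add_le
    (∑ n ∈ (A.filter fun n => ¬ P n).filter (fun n => φ (n + 1) - φ n - m < d), expTwoPi (φ n))
    (∑ n ∈ (A.filter fun n => ¬ P n).filter (fun n => ¬ φ (n + 1) - φ n - m < d), expTwoPi (φ n))
  have e1 : d / l = 1 / d := by rw [← hdl]; field_simp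
  have e2 : 4 / d = 4 * (1 / d) := by ring
  -- Absorbs the two extra units: 3/d + 2 ≤ 4/d. This is where l ≤ 1/4 enters.
  have e3 : 2 ≤ 1 / d := by rw [le_div_iff₀ hdpos]; linarith
  rw [e1] at hcardl hcardr
  rw [e2]
  linarith

/-- Van der Corput's second derivative test, in terms of second differences. -/
theorem norm_sum_expTwoPi_le (hl0 : 0 < l) (hlu : l ≤ u)
    (hl : ∀ n, n + 1 < N → l ≤ (φ (n + 2) - φ (n + 1)) - (φ (n + 1) - φ n))
    (hu : ∀ n, n + 1 < N → (φ (n + 2) - φ (n + 1)) - (φ (n + 1) - φ n) ≤ u) :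
    ‖∑ n ∈ Finset.range N, expTwoPi (φ n)‖ ≤ 4 * (u * N + 2) / Real.sqrt l := by
  have hsq : 0 < Real.sqrt l := Real.sqrt_pos.2 hl0
  have hss : Real.sqrt l * Real.sqrt l = l := Real.mul_self_sqrt hl0.le
  rcases Nat.eq_zero_or_pos N with rfl | hN
  · simp; positivity
  rcases le_or_gt l (1 / 4) with hl1 | hl1
  · set I := Finset.Icc ⌊φ 1 - φ 0⌋ ⌊φ (N - 1 + 1) - φ (N - 1)⌋ with hI
    have hmono : ∀ {i j : ℕ}, i ≤ j → j < N → φ (i + 1) - φ i ≤ φ (j + 1) - φ j := by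
      intro i j hij hj
      have := mul_sub_le_increment_sub hl hij hj
      have h2 : (0 : ℝ) ≤ (j : ℝ) - i := sub_nonneg.2 (by exact_mod_cast hij)
      nlinarith
    have hmaps : ∀ n ∈ Finset.range N, ⌊φ (n + 1) - φ n⌋ ∈ I := by
      intro n hn
      rw [Finset.mem_range] at hn
      rw [hI, Finset.mem_Icc]
      exact ⟨Int.floor_mono (hmono (Nat.zero_le n) hn),
        Int.floor_mono (hmono (by omega) (by omega))⟩
    rw [← Finset.sum_fiberwise_of_maps_to hmaps]
    refine (norm_sum_le_of_le I fun m _ =>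
      norm_sum_expTwoPi_filter_floor_le hl0 hl1 hl m).trans ?_
    rw [Finset.sum_const, nsmul_eq_mul]
    -- The increments are monotone and vary by at most u(N - 1), which limits how many integer parts
    -- they can have.
    have hcard : (I.card : ℝ) ≤ u * N + 2 := by
      rw [hI, Int.card_Icc]
      have h1 := Int.floor_le (φ (N - 1 + 1) - φ (N - 1))
      have h2 := Int.lt_floor_add_one (φ 1 - φ 0)
      have h3 := increment_sub_le_mul_sub hu (Nat.zero_le (N - 1)) (by omega)
      have h4 : ⌊φ 1 - φ 0⌋ ≤ ⌊φ (N - 1 + 1) - φ (N - 1)⌋ :=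
        Int.floor_mono (hmono (Nat.zero_le (N - 1)) (by omega))
      have h5 : (((⌊φ (N - 1 + 1) - φ (N - 1)⌋ + 1 - ⌊φ 1 - φ 0⌋).toNat : ℕ) : ℝ)
          = ((⌊φ (N - 1 + 1) - φ (N - 1)⌋ + 1 - ⌊φ 1 - φ 0⌋ : ℤ) : ℝ) := by
        exact_mod_cast Int.toNat_of_nonneg (by omega)
      rw [h5]
      push_cast
      have h6 : ((N - 1 : ℕ) : ℝ) = (N : ℝ) - 1 := by
        rw [Nat.cast_sub hN]; simp
      rw [h6] at h3
      simp only [Nat.cast_zero, sub_zero, zero_add] at h3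
      have : 0 ≤ u := by linarith
      linarith
    calc (I.card : ℝ) * (4 / Real.sqrt l) ≤ (u * N + 2) * (4 / Real.sqrt l) := by gcongr
      _ = _ := by ring
  -- For l > 1/4 the trivial bound N is already enough, since √l ≤ 4l ≤ 4u.
  · have h1 : ‖∑ n ∈ Finset.range N, expTwoPi (φ n)‖ ≤ N := by
      refine (norm_sum_le_of_le _ fun n _ => (norm_expTwoPi (φ n)).le).trans ?_
      simp
    refine h1.trans ?_
    rw [le_div_iff₀ hsq]
    have h2 : Real.sqrt l ≤ 4 * l := by nlinarith
    have h3 : (0 : ℝ) ≤ N := Nat.cast_nonneg N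
    nlinarith

end SecondDifference

end ShiftedLattice

namespace ShiftedLattice

/-! ### From exponential sums to sawtooth sums. -/

/-- The sawtooth function. -/
noncomputable def sawtooth (x : ℝ) : ℝ := Int.fract x - 1 / 2

/-- The periodic second Bernoulli function. -/
noncomputable def periodicBernoulliTwo (x : ℝ) : ℝ := Int.fract x ^ 2 - Int.fract x + 6⁻¹

lemma abs_sawtooth_le (x : ℝ) : |sawtooth x| ≤ 1 / 2 := by
  have h1 := Int.fract_nonneg x
  have h2 := Int.fract_lt_one x
  unfold sawtooth
  rw [abs_le]
  constructor <;> linarith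

/-- The sawtooth has only a conditionally convergent Fourier series. Its primitive, up to a factor
2, has this absolutely convergent one, which can be summed over points term by term. -/
lemma hasSum_cos_periodicBernoulliTwo (x : ℝ) :
    HasSum (fun n : ℕ => 1 / (n : ℝ) ^ 2 * Real.cos (2 * Real.pi * n * x))
      (Real.pi ^ 2 * periodicBernoulliTwo x) := by
  have h := hasSum_one_div_nat_pow_mul_cos one_ne_zero
    (x := Int.fract x) ⟨Int.fract_nonneg x, (Int.fract_lt_one x).le⟩
  have e1 : (Polynomial.map (algebraMap ℚ ℝ) (Polynomial.bernoulli (2 * 1))).eval (Int.fract x)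
      = Int.fract x ^ 2 - Int.fract x + 6⁻¹ := by
    rw [← bernoulliFun_two]
    rfl
  rw [e1] at h
  have e2 : (fun n : ℕ => 1 / (n : ℝ) ^ (2 * 1) * Real.cos (2 * Real.pi * n * Int.fract x))
      = fun n : ℕ => 1 / (n : ℝ) ^ 2 * Real.cos (2 * Real.pi * n * x) := by
    funext n
    have : 2 * Real.pi * n * Int.fract x
        = 2 * Real.pi * n * x - ((n * ⌊x⌋ : ℤ) : ℝ) * (2 * Real.pi) := by
      rw [Int.fract]
      push_cast
      ring
    rw [this, Real.cos_sub_int_mul_two_pi]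
  rw [e2] at h
  convert h using 1
  have e3 : ((2 * 1).factorial : ℝ) = 2 := by norm_num [Nat.factorial]
  rw [e3]
  unfold periodicBernoulliTwo
  ring

/-- The derivative 2ψ grows with slope 2 and jumps only downwards, so on [x, x + d] it exceeds 2ψ(x)
by at most 2(y - x). The companion below is the mirror image, giving one-sided bounds for ψ in both
directions. -/
lemma periodicBernoulliTwo_add_sub_le (x : ℝ) {d : ℝ} (h0 : 0 ≤ d) (h1 : d ≤ 1) :
    periodicBernoulliTwo (x + d) - periodicBernoulliTwo x ≤ 2 * d * sawtooth x + d ^ 2 := by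
  have hu0 := Int.fract_nonneg x
  have hu1 := Int.fract_lt_one x
  have hx := Int.self_sub_floor x
  unfold periodicBernoulliTwo sawtooth
  rcases lt_or_ge (Int.fract x + d) 1 with h | h
  · have : Int.fract (x + d) = Int.fract x + d := by
      rw [Int.fract_eq_iff]
      exact ⟨by linarith, h, ⌊x⌋, by linarith⟩
    rw [this]
    nlinarith
  · have : Int.fract (x + d) = Int.fract x + d - 1 := by
      rw [Int.fract_eq_iff]
      exact ⟨by linarith, by linarith, ⌊x⌋ + 1, by push_cast; linarith⟩
    rw [this]
    nlinarith

lemma le_periodicBernoulliTwo_sub (x : ℝ) {d : ℝ} (h0 : 0 ≤ d) (h1 : d ≤ 1) :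
    2 * d * sawtooth x - d ^ 2 ≤ periodicBernoulliTwo x - periodicBernoulliTwo (x - d) := by
  have hu0 := Int.fract_nonneg x
  have hu1 := Int.fract_lt_one x
  have hx := Int.self_sub_floor x
  unfold periodicBernoulliTwo sawtooth
  rcases le_or_gt d (Int.fract x) with h | h
  · have : Int.fract (x - d) = Int.fract x - d := by
      rw [Int.fract_eq_iff]
      exact ⟨by linarith, by linarith, ⌊x⌋, by linarith⟩
    rw [this]
    nlinarith
  · have : Int.fract (x - d) = Int.fract x - d + 1 := by
      rw [Int.fract_eq_iff]
      exact ⟨by linarith, by linarith, ⌊x⌋ - 1, by push_cast; linarith⟩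
    rw [this]
    nlinarith

/-- The bounded increasing function √(dh) / (1 + √(dh)) has increments of the same shape as the
minimum, with the change of regime near h = 1/d. The sum of the minima is therefore dominated by a
telescoping one. -/
lemma sqrt_div_one_add_sqrt_sub_ge {d : ℝ} (hd : 0 < d) (h : ℕ) :
    min (1 / ((h + 1 : ℝ) * Real.sqrt (h + 1))) (d / Real.sqrt (h + 1))
      ≤ 8 * Real.sqrt d * (Real.sqrt (d * (h + 1)) / (1 + Real.sqrt (d * (h + 1)))
          - Real.sqrt (d * h) / (1 + Real.sqrt (d * h))) := by
  have hh : (0 : ℝ) ≤ h := Nat.cast_nonneg h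
  set p := Real.sqrt (d * (h + 1)) with hp
  set q := Real.sqrt (d * h) with hq
  set z := Real.sqrt d with hz
  set w := Real.sqrt ((h : ℝ) + 1) with hw
  have hz0 : 0 < z := Real.sqrt_pos.2 hd
  have hw0 : 0 < w := Real.sqrt_pos.2 (by linarith)
  have hpz : p = z * w := Real.sqrt_mul hd.le _
  have hp0 : 0 < p := by rw [hpz]; positivity
  have hq0 : 0 ≤ q := Real.sqrt_nonneg _
  have hqp : q ≤ p := Real.sqrt_le_sqrt (by nlinarith)
  have hpp : p * p = d * (h + 1) := Real.mul_self_sqrt (by positivity)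
  have hqq : q * q = d * h := Real.mul_self_sqrt (by positivity)
  have hzz : z * z = d := Real.mul_self_sqrt hd.le
  have hww : w * w = h + 1 := Real.mul_self_sqrt (by positivity)
  have e1 : p / (1 + p) - q / (1 + q) = (p - q) / ((1 + p) * (1 + q)) := by
    field_simp
    ring
  have e2 : d / (2 * p) ≤ p - q := by
    rw [div_le_iff₀ (by positivity)]
    nlinarith
  have e3 : d / (2 * p) / ((1 + p) * (1 + p)) ≤ p / (1 + p) - q / (1 + q) := by
    rw [e1]
    apply div_le_div₀ (by linarith) e2 (by positivity)
    gcongr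
  have e4 : 8 * z * (d / (2 * p) / ((1 + p) * (1 + p))) = 4 * d / (w * ((1 + p) * (1 + p))) := by
    rw [hpz]
    field_simp
    ring
  refine le_trans ?_ (mul_le_mul_of_nonneg_left e3 (by positivity))
  rw [e4]
  rcases le_total p 1 with h1 | h1
  · refine (min_le_right _ _).trans ?_
    rw [div_le_div_iff₀ hw0 (by positivity)]
    have : (1 + p) * (1 + p) ≤ 4 := by nlinarith
    have h3 : 0 < d * w := by positivity
    nlinarith
  · refine (min_le_left _ _).trans ?_
    rw [div_le_div_iff₀ (by positivity) (by positivity)]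
    have : (1 + p) * (1 + p) ≤ 4 * (d * (h + 1)) := by nlinarith
    nlinarith

lemma sum_min_le {d : ℝ} (hd : 0 < d) (H : ℕ) :
    ∑ h ∈ Finset.range H, min (1 / ((h + 1 : ℝ) * Real.sqrt (h + 1))) (d / Real.sqrt (h + 1))
      ≤ 8 * Real.sqrt d := by
  refine (Finset.sum_le_sum fun h _ => sqrt_div_one_add_sqrt_sub_ge hd h).trans ?_
  rw [← Finset.mul_sum]
  have := Finset.sum_range_sub
    (fun h : ℕ => Real.sqrt (d * h) / (1 + Real.sqrt (d * h))) H
  push_cast at this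
  rw [this]
  have h1 : Real.sqrt (d * H) / (1 + Real.sqrt (d * H)) ≤ 1 := by
    rw [div_le_one (by positivity)]
    linarith
  have h2 : 0 ≤ Real.sqrt d := Real.sqrt_nonneg d
  simp only [mul_zero, Real.sqrt_zero, zero_div, sub_zero]
  nlinarith

lemma norm_expTwoPi_sub_one_le (x : ℝ) : ‖expTwoPi x - 1‖ ≤ 2 * Real.pi * |x| := by
  have := Real.norm_exp_I_mul_ofReal_sub_one_le (x := 2 * Real.pi * x)
  unfold expTwoPi
  rw [mul_comm]
  refine this.trans ?_
  rw [Real.norm_eq_abs, abs_mul, abs_of_pos Real.two_pi_pos]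

/-- Shift differences of the second Bernoulli function, from bounds for the exponential sums. -/
lemma abs_sum_periodicBernoulliTwo_sub_le {y : ℕ → ℝ} {N : ℕ} {P Q : ℝ} (hP : 0 ≤ P) (hQ : 0 ≤ Q)
    (hE : ∀ h : ℕ, ‖∑ n ∈ Finset.range N, expTwoPi ((h + 1 : ℝ) * y n)‖
      ≤ P * Real.sqrt (h + 1) + Q / Real.sqrt (h + 1)) {e d : ℝ} (hd : 0 < d) (hed : |e| = d) :
    |∑ n ∈ Finset.range N, (periodicBernoulliTwo (y n + e) - periodicBernoulliTwo (y n))|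
      ≤ 6 * (P * Real.sqrt d + Q * d) := by
  have hpi : 3 < Real.pi := Real.pi_gt_three
  set S := ∑ n ∈ Finset.range N, (periodicBernoulliTwo (y n + e) - periodicBernoulliTwo (y n))
  set a : ℕ → ℝ := fun h => ∑ n ∈ Finset.range N, (1 / (h : ℝ) ^ 2 *
      Real.cos (2 * Real.pi * h * (y n + e)) - 1 / (h : ℝ) ^ 2 *
      Real.cos (2 * Real.pi * h * y n)) with ha
  have hsum : HasSum a (Real.pi ^ 2 * S) := by
    rw [Finset.mul_sum]
    refine hasSum_sum fun n _ => ?_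
    rw [mul_sub]
    exact (hasSum_cos_periodicBernoulliTwo _).sub (hasSum_cos_periodicBernoulliTwo _)
  -- The zero frequency contributes nothing because 1 / 0 = 0.
  have ha0 : a 0 = 0 := by simp [ha]
  have hterm : ∀ h : ℕ, |a (h + 1)| ≤ 2 * Real.pi *
      (P * min (1 / ((h + 1 : ℝ) * Real.sqrt (h + 1))) (d / Real.sqrt (h + 1))
        + Q * d * min (1 / ((h + 1 : ℝ) * Real.sqrt (h + 1))) (1 / Real.sqrt (h + 1))) := by
    intro h
    set k : ℝ := (h : ℝ) + 1 with hk
    have hk1 : 1 ≤ k := by rw [hk]; linarith [(Nat.cast_nonneg h : (0 : ℝ) ≤ h)]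
    set w := Real.sqrt k with hw
    have hw0 : 0 < w := Real.sqrt_pos.2 (by linarith)
    have hww : w * w = k := Real.mul_self_sqrt (by linarith)
    have e1 : a (h + 1) = 1 / k ^ 2 *
        ((expTwoPi (k * e) - 1) * ∑ n ∈ Finset.range N, expTwoPi (k * y n)).re := by
      rw [ha, Finset.mul_sum, Complex.re_sum, Finset.mul_sum]
      refine Finset.sum_congr rfl fun n _ => ?_
      rw [sub_mul, one_mul, ← expTwoPi_add, Complex.sub_re, expTwoPi_re, expTwoPi_re]
      push_cast
      rw [← hk]
      ring_nf
    have e2 : |a (h + 1)| ≤ 1 / k ^ 2 * (‖expTwoPi (k * e) - 1‖ * (P * w + Q / w)) := by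
      rw [e1, abs_mul, abs_of_nonneg (by positivity : 0 ≤ 1 / k ^ 2)]
      gcongr
      refine (Complex.abs_re_le_norm _).trans ?_
      rw [norm_mul]
      gcongr
      exact hE h
    have e3 : ‖expTwoPi (k * e) - 1‖ ≤ 2 * Real.pi := by
      refine (norm_sub_le _ _).trans ?_
      rw [norm_expTwoPi, norm_one]
      linarith
    have e4 : ‖expTwoPi (k * e) - 1‖ ≤ 2 * Real.pi * (k * d) := by
      refine (norm_expTwoPi_sub_one_le _).trans ?_
      rw [abs_mul, hed, abs_of_nonneg (by linarith : 0 ≤ k)]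
    have e5 : 1 / k ^ 2 * (‖expTwoPi (k * e) - 1‖ * w)
        ≤ 2 * Real.pi * min (1 / (k * w)) (d / w) := by
      rw [mul_min_of_nonneg _ _ (by positivity)]
      apply le_min
      · calc _ ≤ 1 / k ^ 2 * (2 * Real.pi * w) := by gcongr
          _ = 2 * Real.pi * (1 / (k * w)) := by
            rw [← hww]; field_simp
      · calc _ ≤ 1 / k ^ 2 * (2 * Real.pi * (k * d) * w) := by gcongr
          _ = 2 * Real.pi * (d / w) := by
            rw [← hww]; field_simp
    -- The minimum is always its first entry. It is kept so that the convergent sum of k^(-3/2) is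
    -- the case d = 1 of `sum_min_le`.
    have e6 : 1 / k ^ 2 * (‖expTwoPi (k * e) - 1‖ / w)
        ≤ 2 * Real.pi * (d * min (1 / (k * w)) (1 / w)) := by
      have : 1 / (k * w) ≤ 1 / w := by
        apply one_div_le_one_div_of_le hw0
        nlinarith
      rw [min_eq_left this]
      calc _ ≤ 1 / k ^ 2 * (2 * Real.pi * (k * d) / w) := by gcongr
        _ = 2 * Real.pi * (d * (1 / (k * w))) := by field_simp
    calc |a (h + 1)| ≤ _ := e2
      _ = P * (1 / k ^ 2 * (‖expTwoPi (k * e) - 1‖ * w))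
          + Q * (1 / k ^ 2 * (‖expTwoPi (k * e) - 1‖ / w)) := by ring
      _ ≤ P * (2 * Real.pi * min (1 / (k * w)) (d / w))
          + Q * (2 * Real.pi * (d * min (1 / (k * w)) (1 / w))) := by gcongr
      _ = _ := by ring
  have hpart : ∀ H : ℕ, |∑ h ∈ Finset.range (H + 1), a h|
      ≤ 2 * Real.pi * (P * (8 * Real.sqrt d) + Q * d * 8) := by
    intro H
    rw [Finset.sum_range_succ', ha0, add_zero]
    refine (Finset.abs_sum_le_sum_abs _ _).trans ((Finset.sum_le_sum fun h _ => hterm h).trans ?_)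
    rw [← Finset.mul_sum, Finset.sum_add_distrib, ← Finset.mul_sum, ← Finset.mul_sum]
    have h1 := sum_min_le hd H
    have h2 := sum_min_le one_pos H
    rw [Real.sqrt_one, mul_one] at h2
    gcongr
  have hlim : |Real.pi ^ 2 * S| ≤ 2 * Real.pi * (P * (8 * Real.sqrt d) + Q * d * 8) :=
    le_of_tendsto ((hsum.tendsto_sum_nat.comp (tendsto_add_atTop_nat 1)).abs)
      (Eventually.of_forall hpart)
  rw [abs_mul, abs_of_pos (by positivity)] at hlim
  have h3 : Real.pi * |S| ≤ 16 * (P * Real.sqrt d + Q * d) := by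
    have : 0 < Real.pi := by linarith
    nlinarith
  have h4 : 0 ≤ P * Real.sqrt d + Q * d := by positivity
  nlinarith [abs_nonneg S]

/-- Sums of the sawtooth function, from bounds for the exponential sums. -/
lemma abs_sum_sawtooth_le_of_norm_sum {y : ℕ → ℝ} {N : ℕ} {P Q : ℝ} (hP : 0 ≤ P) (hQ : 0 ≤ Q)
    (hE : ∀ h : ℕ, ‖∑ n ∈ Finset.range N, expTwoPi ((h + 1 : ℝ) * y n)‖
      ≤ P * Real.sqrt (h + 1) + Q / Real.sqrt (h + 1)) {d : ℝ} (hd : 0 < d) (hd1 : d ≤ 1) :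
    |∑ n ∈ Finset.range N, sawtooth (y n)| ≤ N * d / 2 + 3 * P / Real.sqrt d + 3 * Q := by
  -- The difference with step d bounds the sawtooth sum from below and the one with step -d bounds
  -- it from above. After division by 2d, the curvature error d² leaves Nd/2.
  have h1 := abs_le.1 (abs_sum_periodicBernoulliTwo_sub_le hP hQ hE hd (abs_of_pos hd))
  have h2 := abs_le.1 (abs_sum_periodicBernoulliTwo_sub_le hP hQ hE hd
    ((abs_neg d).trans (abs_of_pos hd)))
  have h3 : ∑ n ∈ Finset.range N, (periodicBernoulliTwo (y n + d) - periodicBernoulliTwo (y n))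
      ≤ 2 * d * ∑ n ∈ Finset.range N, sawtooth (y n) + N * d ^ 2 := by
    refine (Finset.sum_le_sum fun n _ =>
      periodicBernoulliTwo_add_sub_le (y n) hd.le hd1).trans_eq ?_
    rw [Finset.sum_add_distrib, Finset.mul_sum]
    simp
  have h4 : 2 * d * ∑ n ∈ Finset.range N, sawtooth (y n) - N * d ^ 2
      ≤ -∑ n ∈ Finset.range N, (periodicBernoulliTwo (y n + -d) - periodicBernoulliTwo (y n)) := by
    rw [← Finset.sum_neg_distrib]
    refine le_trans (le_of_eq ?_) (Finset.sum_le_sum fun n _ =>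
      (le_periodicBernoulliTwo_sub (y n) hd.le hd1).trans_eq (by rw [neg_sub, ← sub_eq_add_neg (y n) d]))
    rw [Finset.sum_sub_distrib, Finset.mul_sum]
    simp
  set z := Real.sqrt d
  have hz : 0 < z := Real.sqrt_pos.2 hd
  have hzz : z * z = d := Real.mul_self_sqrt hd.le
  have e : 3 * P / z * d = 3 * P * z := by
    rw [← hzz]
    field_simp
  rw [abs_le]
  constructor
  · have : -(N * d / 2 + 3 * P / z + 3 * Q) * (2 * d)
        ≤ (∑ n ∈ Finset.range N, sawtooth (y n)) * (2 * d) := by nlinarith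
    exact le_of_mul_le_mul_right this (by positivity)
  · have : (∑ n ∈ Finset.range N, sawtooth (y n)) * (2 * d)
        ≤ (N * d / 2 + 3 * P / z + 3 * Q) * (2 * d) := by nlinarith
    exact le_of_mul_le_mul_right this (by positivity)

/-- Multiplication by h + 1 scales the second differences, so van der Corput's test applies at every
frequency. The last term is split off because the test looks at one point beyond the sum; it is
absorbed through 1 ≤ zw + 1/(zw), with z = √l and w = √(h + 1). -/
lemma norm_sum_expTwoPi_mul_le {y : ℕ → ℝ} {N : ℕ} {l C : ℝ} (hl : 0 < l) (hC : 1 ≤ C)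
    (hlow : ∀ n, n + 2 < N → l ≤ (y (n + 2) - y (n + 1)) - (y (n + 1) - y n))
    (hup : ∀ n, n + 2 < N → (y (n + 2) - y (n + 1)) - (y (n + 1) - y n) ≤ C * l) (h : ℕ) :
    ‖∑ n ∈ Finset.range N, expTwoPi ((h + 1 : ℝ) * y n)‖
      ≤ 5 * C * N * Real.sqrt l * Real.sqrt (h + 1) + 9 / Real.sqrt l / Real.sqrt (h + 1) := by
  rcases N with _ | N
  · simp; positivity
  set k : ℝ := (h : ℝ) + 1 with hk
  have hk0 : 0 < k := by positivity
  have h1 := norm_sum_expTwoPi_le (φ := fun n => k * y n) (N := N) (l := k * l) (u := C * (k * l))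
    (by positivity) (le_mul_of_one_le_left (by positivity) hC)
    (fun n hn => by have := mul_le_mul_of_nonneg_left (hlow n (by omega)) hk0.le; linarith)
    (fun n hn => by have := mul_le_mul_of_nonneg_left (hup n (by omega)) hk0.le; linarith)
  rw [Finset.sum_range_succ]
  refine (norm_add_le _ _).trans ?_
  rw [norm_expTwoPi]
  refine (add_le_add_left h1 1).trans ?_
  rw [Real.sqrt_mul hk0.le]
  set w := Real.sqrt k
  set z := Real.sqrt l
  have hw : 0 < w := Real.sqrt_pos.2 hk0
  have hz : 0 < z := Real.sqrt_pos.2 hl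
  have hww : w * w = k := Real.mul_self_sqrt hk0.le
  have hzz : z * z = l := Real.mul_self_sqrt hl.le
  have hN : (0 : ℝ) ≤ N := Nat.cast_nonneg N
  have e1 : 4 * (C * (k * l) * N + 2) / (w * z) = 4 * C * N * z * w + 8 / z / w := by
    rw [← hww, ← hzz]
    field_simp
    ring
  have e2 : 1 ≤ z * w + 1 / z / w := by
    rcases le_total 1 (z * w) with h | h
    · have : 0 ≤ 1 / z / w := by positivity
      linarith
    · have : 1 ≤ 1 / z / w := by
        rw [div_div, le_div_iff₀ (by positivity)]
        linarith
      have : 0 ≤ z * w := by positivity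
      linarith
  have e3 : z * w ≤ C * (z * w) := le_mul_of_one_le_left (by positivity) hC
  have e4 : 0 ≤ C * N * (z * w) := by positivity
  have e5 : 9 / z / w = 8 / z / w + 1 / z / w := by ring
  rw [e1, e5]
  push_cast
  nlinarith

/-- Van der Corput's estimate for sums of the sawtooth function along a sequence with second
differences of constant sign and constant order of magnitude. -/
theorem abs_sum_sawtooth_le {y : ℕ → ℝ} {N : ℕ} {l C : ℝ} (hl : 0 < l) (hC : 1 ≤ C)
    (hy : (∀ n, n + 2 < N → l ≤ (y (n + 2) - y (n + 1)) - (y (n + 1) - y n) ∧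
        (y (n + 2) - y (n + 1)) - (y (n + 1) - y n) ≤ C * l) ∨
      (∀ n, n + 2 < N → l ≤ -((y (n + 2) - y (n + 1)) - (y (n + 1) - y n)) ∧
        -((y (n + 2) - y (n + 1)) - (y (n + 1) - y n)) ≤ C * l)) {d : ℝ} (hd : 0 < d)
    (hd1 : d ≤ 1) :
    |∑ n ∈ Finset.range N, sawtooth (y n)|
      ≤ N * d / 2 + 15 * C * N * Real.sqrt l / Real.sqrt d + 27 / Real.sqrt l := by
  have key : ∀ h : ℕ, ‖∑ n ∈ Finset.range N, expTwoPi ((h + 1 : ℝ) * y n)‖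
      ≤ 5 * C * N * Real.sqrt l * Real.sqrt (h + 1) + 9 / Real.sqrt l / Real.sqrt (h + 1) := by
    intro h
    rcases hy with hy | hy
    · exact norm_sum_expTwoPi_mul_le hl hC (fun n hn => (hy n hn).1) (fun n hn => (hy n hn).2) h
    · have h1 := norm_sum_expTwoPi_mul_le (y := fun n => -y n) hl hC
        (fun n hn => by linarith [(hy n hn).1]) (fun n hn => by linarith [(hy n hn).2]) h
      have e : ∑ n ∈ Finset.range N, expTwoPi ((h + 1 : ℝ) * -y n)
          = (starRingEnd ℂ) (∑ n ∈ Finset.range N, expTwoPi ((h + 1 : ℝ) * y n)) := by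
        rw [map_sum]
        refine Finset.sum_congr rfl fun n _ => ?_
        rw [← expTwoPi_neg, mul_neg]
      rwa [e, RCLike.norm_conj] at h1
  refine (abs_sum_sawtooth_le_of_norm_sum (by positivity) (by positivity) key hd hd1).trans_eq ?_
  ring

end ShiftedLattice

namespace ShiftedLattice

/-! ### Curved arcs and Euler–Maclaurin summation. -/

/-- A convex Lipschitz function whose second differences with step `t` lie between `c t ^ 2` and
`C t ^ 2`. -/
structure Curved (f : ℝ → ℝ) (a b c C K : ℝ) : Prop where
  c_pos : 0 < c
  c_le : c ≤ C
  K_nonneg : 0 ≤ K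
  convexOn : ConvexOn ℝ (Icc a b) f
  lipschitz : ∀ x ∈ Icc a b, ∀ y ∈ Icc a b, |f x - f y| ≤ K * |x - y|
  le_second_diff : ∀ x t, 0 ≤ t → a ≤ x → x + 2 * t ≤ b →
    c * t ^ 2 ≤ f (x + 2 * t) - 2 * f (x + t) + f x
  second_diff_le : ∀ x t, 0 ≤ t → a ≤ x → x + 2 * t ≤ b →
    f (x + 2 * t) - 2 * f (x + t) + f x ≤ C * t ^ 2

lemma convexOn_second_diff_nonneg {s : Set ℝ} {u : ℝ → ℝ} (hu : ConvexOn ℝ s u) {x t : ℝ}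
    (h1 : x ∈ s) (h2 : x + 2 * t ∈ s) : 0 ≤ u (x + 2 * t) - 2 * u (x + t) + u x := by
  have := hu.2 h1 h2 (by norm_num : (0 : ℝ) ≤ 1 / 2) (by norm_num : (0 : ℝ) ≤ 1 / 2) (by norm_num)
  simp only [smul_eq_mul] at this
  rw [show 1 / 2 * x + 1 / 2 * (x + 2 * t) = x + t by ring] at this
  linarith

/-- By compactness f'' has a positive minimum c and a maximum C. Then f - c x²/2 and C x²/2 - f are
convex, hence have nonnegative second differences. -/
lemma exists_curved {f : ℝ → ℝ} {a b : ℝ} (hab : a < b) (hf : ContDiffOn ℝ 2 f (Icc a b))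
    (hpos : ∀ x ∈ Icc a b, 0 < iteratedDerivWithin 2 f (Icc a b) x) :
    ∃ c C K, Curved f a b c C K := by
  have hud : UniqueDiffOn ℝ (Icc a b) := uniqueDiffOn_Icc hab
  have hne : (Icc a b).Nonempty := nonempty_Icc.2 hab.le
  set q := iteratedDerivWithin 2 f (Icc a b) with hq
  have hqc : ContinuousOn q (Icc a b) :=
    hf.continuousOn_iteratedDerivWithin (m := 2) le_rfl hud
  obtain ⟨x0, hx0, hmin⟩ := isCompact_Icc.exists_isMinOn hne hqc
  obtain ⟨x1, hx1, hmax⟩ := isCompact_Icc.exists_isMaxOn hne hqc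
  have hd1 : DifferentiableOn ℝ f (Icc a b) := hf.differentiableOn (by norm_num)
  have hg1 : iteratedDerivWithin 1 f (Icc a b) = derivWithin f (Icc a b) := by
    funext x
    rw [iteratedDerivWithin_one]
  have hd2 : DifferentiableOn ℝ (derivWithin f (Icc a b)) (Icc a b) := by
    rw [← hg1]
    exact hf.differentiableOn_iteratedDerivWithin (m := 1) (by norm_num) hud
  have hq2 : ∀ x, q x = derivWithin (derivWithin f (Icc a b)) (Icc a b) x := by
    intro x
    rw [hq, ← hg1]
    rw [iteratedDerivWithin_succ]
  obtain ⟨K, hK⟩ := isCompact_Icc.exists_bound_of_continuousOn hd2.continuousOn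
  have hK0 : 0 ≤ K := (norm_nonneg _).trans (hK a ⟨le_rfl, hab.le⟩)
  have hder1 : ∀ x ∈ interior (Icc a b), HasDerivWithinAt f (derivWithin f (Icc a b) x)
      (interior (Icc a b)) x := fun x hx =>
    ((hd1 x (interior_subset hx)).hasDerivWithinAt).mono interior_subset
  have hder2 : ∀ x ∈ interior (Icc a b), HasDerivWithinAt (derivWithin f (Icc a b)) (q x)
      (interior (Icc a b)) x := fun x hx => by
    rw [hq2]
    exact ((hd2 x (interior_subset hx)).hasDerivWithinAt).mono interior_subset
  have hpow1 : ∀ (e : ℝ) (x : ℝ) (s : Set ℝ),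
      HasDerivWithinAt (fun y : ℝ => e / 2 * y ^ 2) (e * x) s x := fun e x s => by
    have := ((hasDerivAt_pow 2 x).const_mul (e / 2)).hasDerivWithinAt (s := s)
    exact this.congr_deriv (by norm_num; ring)
  have hpow2 : ∀ (e : ℝ) (x : ℝ) (s : Set ℝ),
      HasDerivWithinAt (fun y : ℝ => e * y) e s x := fun e x s => by
    have := ((hasDerivAt_id x).const_mul e).hasDerivWithinAt (s := s)
    simpa using this
  have hlow : ConvexOn ℝ (Icc a b) fun x => f x - q x0 / 2 * x ^ 2 := by
    refine convexOn_of_hasDerivWithinAt2_nonneg (convex_Icc a b)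
      (f' := fun x => derivWithin f (Icc a b) x - q x0 * x) (f'' := fun x => q x - q x0)
      (hd1.continuousOn.sub (by fun_prop)) (fun x hx => (hder1 x hx).sub (hpow1 _ _ _))
      (fun x hx => (hder2 x hx).sub (hpow2 _ _ _)) fun x hx => ?_
    have := hmin (interior_subset hx)
    simp only [Set.mem_ofPred_eq] at this
    linarith
  have hup : ConvexOn ℝ (Icc a b) fun x => q x1 / 2 * x ^ 2 - f x := by
    refine convexOn_of_hasDerivWithinAt2_nonneg (convex_Icc a b)
      (f' := fun x => q x1 * x - derivWithin f (Icc a b) x) (f'' := fun x => q x1 - q x)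
      (ContinuousOn.sub (by fun_prop) hd1.continuousOn) (fun x hx => (hpow1 _ _ _).sub (hder1 x hx))
      (fun x hx => (hpow2 _ _ _).sub (hder2 x hx)) fun x hx => ?_
    have := hmax (interior_subset hx)
    simp only [Set.mem_ofPred_eq] at this
    linarith
  refine ⟨q x0, q x1, K, hpos x0 hx0, hmin hx1, hK0, ?_, ?_, ?_, ?_⟩
  · exact convexOn_of_hasDerivWithinAt2_nonneg (convex_Icc a b) hd1.continuousOn hder1 hder2
      fun x hx => (hpos x (interior_subset hx)).le
  · intro x hx y hy
    exact (convex_Icc a b).norm_image_sub_le_of_norm_derivWithin_le hd1 hK hy hx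
  · intro x t ht hx hxt
    have := convexOn_second_diff_nonneg hlow (x := x) (t := t) ⟨hx, by linarith⟩
      ⟨by linarith, hxt⟩
    nlinarith
  · intro x t ht hx hxt
    have := convexOn_second_diff_nonneg hup (x := x) (t := t) ⟨hx, by linarith⟩
      ⟨by linarith, hxt⟩
    nlinarith

lemma integral_affine (u v A B : ℝ) :
    ∫ x in u..v, (A + B * (x - u)) = (v - u) * A + B * (v - u) ^ 2 / 2 := by
  have : ∫ x in u..v, B * (x - u) = B * ((v - u) ^ 2 / 2) := by
    rw [intervalIntegral.integral_const_mul,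
      intervalIntegral.integral_comp_sub_right (fun x => x) u, integral_id]
    ring
  rw [intervalIntegral.integral_add (by simp) (Continuous.intervalIntegrable (by fun_prop) _ _),
    this, intervalIntegral.integral_const, smul_eq_mul]
  ring

lemma affine_le_integral {H : ℝ → ℝ} {u v A B : ℝ} (huv : u ≤ v)
    (hH : IntervalIntegrable H volume u v) (h : ∀ x ∈ Icc u v, A + B * (x - u) ≤ H x) :
    (v - u) * A + B * (v - u) ^ 2 / 2 ≤ ∫ x in u..v, H x := by
  rw [← integral_affine]
  exact intervalIntegral.integral_mono_on huv
    (Continuous.intervalIntegrable (by fun_prop) _ _) hH h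

lemma integral_le_affine {H : ℝ → ℝ} {u v A B : ℝ} (huv : u ≤ v)
    (hH : IntervalIntegrable H volume u v) (h : ∀ x ∈ Icc u v, H x ≤ A + B * (x - u)) :
    ∫ x in u..v, H x ≤ (v - u) * A + B * (v - u) ^ 2 / 2 := by
  rw [← integral_affine]
  exact intervalIntegral.integral_mono_on huv hH
    (Continuous.intervalIntegrable (by fun_prop) _ _) h

/-- A chord of a convex function lies above it. -/
lemma le_chord {s : Set ℝ} {H : ℝ → ℝ} (hH : ConvexOn ℝ s H) {u v x : ℝ} (hu : u ∈ s)
    (hv : v ∈ s) (huv : u < v) (hux : u ≤ x) (hxv : x ≤ v) :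
    H x ≤ H u + (H v - H u) / (v - u) * (x - u) := by
  have hne : v - u ≠ 0 := by linarith
  have h := hH.2 hu hv (div_nonneg (by linarith) (by linarith) : 0 ≤ (v - x) / (v - u))
    (div_nonneg (by linarith) (by linarith) : 0 ≤ (x - u) / (v - u))
    (by field_simp; ring)
  simp only [smul_eq_mul] at h
  have e : (v - x) / (v - u) * u + (x - u) / (v - u) * v = x := by field_simp; ring
  rw [e] at h
  refine h.trans_eq ?_
  field_simp
  ring

/-- The extension of a chord beyond its left end point lies below a convex function. -/
lemma chord_le_left {s : Set ℝ} {H : ℝ → ℝ} (hH : ConvexOn ℝ s H) {x u v : ℝ}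
    (hx : x ∈ s) (hv : v ∈ s) (hxu : x ≤ u) (huv : u < v) :
    H u + (H v - H u) / (v - u) * (x - u) ≤ H x := by
  rcases hxu.eq_or_lt with rfl | hxu
  · simp
  have h := hH.slope_mono_adjacent hx hv hxu huv
  rw [div_le_iff₀ (by linarith)] at h
  linarith

/-- The extension of a chord beyond its right end point lies below a convex function. -/
lemma chord_le_right {s : Set ℝ} {H : ℝ → ℝ} (hH : ConvexOn ℝ s H) {u v x : ℝ}
    (hu : u ∈ s) (hx : x ∈ s) (huv : u < v) (hvx : v ≤ x) :
    H v + (H v - H u) / (v - u) * (x - v) ≤ H x := by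
  rcases hvx.eq_or_lt with rfl | hvx
  · simp
  have h := hH.slope_mono_adjacent hu hx huv hvx
  rw [le_div_iff₀ (by linarith)] at h
  linarith

lemma abs_integral_sub_le {H : ℝ → ℝ} {u v z K : ℝ} (huv : u ≤ v)
    (hH : IntervalIntegrable H volume u v) (h : ∀ x ∈ Icc u v, |H x - z| ≤ K) :
    |(∫ x in u..v, H x) - (v - u) * z| ≤ (v - u) * K := by
  have h1 := affine_le_integral (A := z - K) (B := 0) huv hH fun x hx => by
    linarith [(abs_le.1 (h x hx)).1]
  have h2 := integral_le_affine (A := z + K) (B := 0) huv hH fun x hx => by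
    linarith [(abs_le.1 (h x hx)).2]
  rw [abs_le]
  constructor <;> linarith

/-- The trapezoidal rule with unit step for a convex Lipschitz function. -/
lemma trapezoid_bounds {H : ℝ → ℝ} {m K : ℝ} (hK : 0 ≤ K) (J : ℕ)
    (hc : ConvexOn ℝ (Icc m (m + J)) H)
    (hL : ∀ x ∈ Icc m (m + J), ∀ y ∈ Icc m (m + J), |H x - H y| ≤ K * |x - y|) :
    ∑ i ∈ Finset.range J, (H (m + i) + H (m + (i + 1))) / 2 - 2 * K ≤ ∫ x in m..(m + J), H x ∧
      ∫ x in m..(m + J), H x ≤ ∑ i ∈ Finset.range J, (H (m + i) + H (m + (i + 1))) / 2 := by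
  have hcont : ContinuousOn H (Icc m (m + J)) := by
    have : LipschitzOnWith ⟨K, hK⟩ H (Icc m (m + J)) := by
      refine LipschitzOnWith.of_dist_le_mul fun x hx y hy => ?_
      exact hL x hx y hy
    exact this.continuousOn
  have hint : ∀ i : ℕ, i < J → IntervalIntegrable H volume (m + i) (m + (i + 1)) := by
    intro i hi
    have h1 : (i : ℝ) + 1 ≤ J := by exact_mod_cast hi
    have h2 : (0 : ℝ) ≤ i := Nat.cast_nonneg i
    apply ContinuousOn.intervalIntegrable_of_Icc (by linarith)
    exact hcont.mono (Icc_subset_Icc (by linarith) (by linarith))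
  have hsplit : ∫ x in m..(m + J), H x
      = ∑ i ∈ Finset.range J, ∫ x in (m + i)..(m + (i + 1)), H x := by
    have := intervalIntegral.sum_integral_adjacent_intervals (f := H) (μ := volume)
      (a := fun i : ℕ => m + i) (n := J) (fun i hi => by push_cast; exact hint i hi)
    push_cast at this
    rw [this, add_zero]
  have hmem : ∀ i : ℕ, i ≤ J → m + (i : ℝ) ∈ Icc m (m + J) := by
    intro i hi
    have h1 : (i : ℝ) ≤ J := by exact_mod_cast hi
    have h2 : (0 : ℝ) ≤ i := Nat.cast_nonneg i
    exact ⟨by linarith, by linarith⟩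
  have hmem' : ∀ i : ℕ, i + 1 ≤ J → m + ((i : ℝ) + 1) ∈ Icc m (m + J) := by
    intro i hi
    have := hmem (i + 1) hi
    push_cast at this
    exact this
  rw [hsplit]
  refine ⟨?_, Finset.sum_le_sum fun i hi => ?_⟩
  · rcases J with _ | J
    · simp [hK]
    -- On each cell after the first, H lies above the extended chord of the preceding cell, and the
    -- trapezoid exceeds that line's integral by half a second difference. These telescope to half
    -- the difference of the last and first increments, at most K; the first cell costs another K.
    have claim : ∀ j : ℕ, j + 1 ≤ J + 1 →
        ∑ i ∈ Finset.range (j + 1), (H (m + i) + H (m + (i + 1))) / 2 - K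
          - ((H (m + (j + 1)) - H (m + j)) - (H (m + 1) - H m)) / 2
        ≤ ∑ i ∈ Finset.range (j + 1), ∫ x in (m + i)..(m + (i + 1)), H x := by
      intro j hj
      induction j with
      | zero =>
        have h0 := hmem 0 (by omega)
        have h1 := hmem' 0 (by omega)
        have h2 := abs_integral_sub_le (z := (H (m + (0 : ℕ)) + H (m + ((0 : ℕ) + 1))) / 2)
          (K := K) (by linarith) (hint 0 (by omega)) fun x hx => by
            have hx' : x ∈ Icc m (m + (J + 1 : ℕ)) := ⟨h0.1.trans hx.1, hx.2.trans h1.2⟩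
            have h3 := hL x hx' _ h0
            have h4 := hL x hx' _ h1
            rw [abs_of_nonneg (by linarith [hx.1] : 0 ≤ x - (m + (0 : ℕ)))] at h3
            rw [abs_of_nonpos (by linarith [hx.2] : x - (m + ((0 : ℕ) + 1)) ≤ 0)] at h4
            have h5 := abs_le.1 h3
            have h6 := abs_le.1 h4
            have h7 := hx.1
            have h8 := hx.2
            simp only [Nat.cast_zero, zero_add, add_zero] at h5 h6 ⊢
            rw [abs_le]
            constructor <;> nlinarith
        have h3 := (abs_le.1 h2).1
        simp only [zero_add, Finset.range_one, Finset.sum_singleton, CharP.cast_eq_zero, add_zero]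
          at h3 ⊢
        linarith
      | succ j ih =>
        have ih' := ih (by omega)
        rw [Finset.sum_range_succ _ (j + 1), Finset.sum_range_succ _ (j + 1)]
        have h0 := hmem j (by omega)
        have h1 := hmem' j (by omega)
        have h2 := hmem' (j + 1) hj
        have h3 := affine_le_integral (A := H (m + ((j + 1 : ℕ) : ℝ)))
          (B := H (m + ((j + 1 : ℕ) : ℝ)) - H (m + j)) (by linarith)
          (hint (j + 1) (by omega)) fun x hx => by
            have hx' : x ∈ Icc m (m + (J + 1 : ℕ)) :=
              ⟨(hmem (j + 1) (by omega)).1.trans hx.1, hx.2.trans h2.2⟩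
            have h4 := chord_le_right hc h0 hx' (v := m + ((j + 1 : ℕ) : ℝ))
              (by push_cast; linarith) hx.1
            rwa [show m + ((j + 1 : ℕ) : ℝ) - (m + j) = 1 by push_cast; ring, div_one] at h4
        push_cast at h3 ih' ⊢
        rw [show m + ((j : ℝ) + 1 + 1) - (m + ((j : ℝ) + 1)) = 1 by ring] at h3
        linarith
    have h1 := claim J le_rfl
    have h2 := hL _ (hmem' J le_rfl) _ (hmem J (by omega))
    have h3 := hL _ (hmem' 0 (by omega)) _ (hmem 0 (by omega))
    simp only [CharP.cast_eq_zero, add_zero, zero_add, add_sub_cancel_left, abs_one, mul_one] at h3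
    rw [show m + ((J : ℝ) + 1) - (m + J) = 1 by ring, abs_one, mul_one] at h2
    have h4 := abs_le.1 h2
    have h5 := abs_le.1 h3
    linarith
  · have hi' := Finset.mem_range.1 hi
    have h0 := hmem i hi'.le
    have h1 := hmem' i hi'
    have h2 := integral_le_affine (A := H (m + i)) (B := H (m + (i + 1)) - H (m + i))
      (by linarith) (hint i hi') fun x hx => by
        have h4 := le_chord hc h0 h1 (by linarith) hx.1 hx.2
        rwa [show m + ((i : ℝ) + 1) - (m + i) = 1 by ring, div_one] at h4
    rw [show m + ((i : ℝ) + 1) - (m + i) = 1 by ring] at h2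
    linarith

/-- Euler–Maclaurin summation for convex Lipschitz functions. -/
theorem abs_sum_sub_integral_le {H : ℝ → ℝ} {p q K : ℝ} (hp : 0 ≤ p) (hpq : p ≤ q) (hK : 0 ≤ K)
    (hc : ConvexOn ℝ (Icc p q) H)
    (hL : ∀ x ∈ Icc p q, ∀ y ∈ Icc p q, |H x - H y| ≤ K * |x - y|) :
    |∑ n ∈ Finset.Ioc ⌊p⌋₊ ⌊q⌋₊, H n
      - ((∫ x in p..q, H x) + H p * sawtooth p - H q * sawtooth q)| ≤ 6 * K := by
  have hq : 0 ≤ q := hp.trans hpq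
  have hcont : ContinuousOn H (Icc p q) := by
    have : LipschitzOnWith ⟨K, hK⟩ H (Icc p q) := by
      refine LipschitzOnWith.of_dist_le_mul fun x hx y hy => ?_
      exact hL x hx y hy
    exact this.continuousOn
  have hint : ∀ u v, p ≤ u → u ≤ v → v ≤ q → IntervalIntegrable H volume u v := fun u v h1 h2 h3 =>
    (hcont.mono (Icc_subset_Icc h1 h3)).intervalIntegrable_of_Icc h2
  have hfp : sawtooth p = p - ⌊p⌋₊ - 1 / 2 := by
    rw [sawtooth, Int.fract, natCast_floor_eq_intCast_floor hp]
  have hfq : sawtooth q = q - ⌊q⌋₊ - 1 / 2 := by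
    rw [sawtooth, Int.fract, natCast_floor_eq_intCast_floor hq]
  have hlip : ∀ x ∈ Icc p q, ∀ y ∈ Icc p q, |x - y| ≤ 1 → |H x - H y| ≤ K := by
    intro x hx y hy hxy
    refine (hL x hx y hy).trans ?_
    nlinarith
  have hp1 := Nat.floor_le hp
  have hp2 := Nat.lt_floor_add_one p
  have hq1 := Nat.floor_le hq
  have hq2 := Nat.lt_floor_add_one q
  have hpm : p ∈ Icc p q := ⟨le_rfl, hpq⟩
  have hqm : q ∈ Icc p q := ⟨hpq, le_rfl⟩
  -- If no integer lies in (p, q], the sawtooth does not jump there: its increment q - p makes the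
  -- boundary terms cancel the integral up to O(K).
  rcases (Nat.floor_mono hpq).eq_or_lt with h | h
  · rw [← h, Finset.Ioc_self, Finset.sum_empty]
    have hq3 : q < ⌊p⌋₊ + 1 := by rw [h]; exact hq2
    have h1 := abs_integral_sub_le (z := H p) (K := K) hpq (hint p q le_rfl hpq le_rfl)
      fun x hx => hlip x hx p hpm (by rw [abs_of_nonneg (by linarith [hx.1])]; linarith [hx.2])
    have h2 := hlip p hpm q hqm (by rw [abs_of_nonpos (by linarith)]; linarith)
    have h3 := abs_sawtooth_le q
    have h4 : sawtooth p = sawtooth q - (q - p) := by rw [hfp, hfq, ← h]; ring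
    have h5 : |(H p - H q) * sawtooth q| ≤ K := by
      rw [abs_mul]
      nlinarith [abs_nonneg (H p - H q), abs_nonneg (sawtooth q)]
    have h6 : (q - p) * K ≤ K := by nlinarith
    have h7 := abs_le.1 h1
    have h8 := abs_le.1 h5
    rw [h4, abs_le]
    constructor <;> nlinarith
  · obtain ⟨J, hJ⟩ : ∃ J, ⌊q⌋₊ = ⌊p⌋₊ + 1 + J := ⟨⌊q⌋₊ - (⌊p⌋₊ + 1), by omega⟩
    set m : ℝ := ⌊p⌋₊ + 1 with hm
    have hqJ : (⌊q⌋₊ : ℝ) = m + J := by rw [hJ]; push_cast; ring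
    have hJ0 : (0 : ℝ) ≤ J := Nat.cast_nonneg J
    rw [hqJ] at hq1 hq2 hfq
    have hsub : Icc m (m + J) ⊆ Icc p q := Icc_subset_Icc hp2.le hq1
    have hmm : m ∈ Icc p q := hsub ⟨le_rfl, by linarith⟩
    have hMm : m + J ∈ Icc p q := hsub ⟨by linarith, le_rfl⟩
    have htr := trapezoid_bounds hK J (hc.subset hsub (convex_Icc _ _))
      fun x hx y hy => hL x (hsub hx) y (hsub hy)
    have hsum : ∑ n ∈ Finset.Ioc ⌊p⌋₊ ⌊q⌋₊, H n
        = ∑ i ∈ Finset.range J, (H (m + i) + H (m + (i + 1))) / 2 + (H m + H (m + J)) / 2 := by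
      rw [← Finset.Ico_add_one_add_one_eq_Ioc, Finset.sum_Ico_eq_sum_range, hJ,
        show ⌊p⌋₊ + 1 + J + 1 - (⌊p⌋₊ + 1) = J + 1 by omega]
      have e : ∀ i : ℕ, H ((⌊p⌋₊ + 1 + i : ℕ) : ℝ) = H (m + i) := fun i => by push_cast; rfl
      simp only [e]
      have e2 : ∀ J : ℕ, ∑ i ∈ Finset.range (J + 1), H (m + i)
          = ∑ i ∈ Finset.range J, (H (m + i) + H (m + (i + 1))) / 2 + (H m + H (m + J)) / 2 := by
        intro J
        induction J with
        | zero => simp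
        | succ J ih =>
          rw [Finset.sum_range_succ, ih, Finset.sum_range_succ _ J]
          push_cast
          ring
      exact e2 J
    have hsplit : ∫ x in p..q, H x
        = (∫ x in p..m, H x) + (∫ x in m..(m + J), H x) + ∫ x in (m + J)..q, H x := by
      rw [intervalIntegral.integral_add_adjacent_intervals
        (hint p m le_rfl hmm.1 hmm.2) (hint m _ hmm.1 (by linarith) hMm.2),
        intervalIntegral.integral_add_adjacent_intervals
        (hint p _ le_rfl hMm.1 hMm.2) (hint _ q hMm.1 hMm.2 le_rfl)]
    have h1 := abs_le.1 (abs_integral_sub_le (z := H p) (K := K) hmm.1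
      (hint p m le_rfl hmm.1 hmm.2)
      fun x hx => hlip x ⟨hx.1, hx.2.trans hmm.2⟩ p hpm
        (by rw [abs_of_nonneg (by linarith [hx.1])]; linarith [hx.2]))
    have h2 := abs_le.1 (abs_integral_sub_le (z := H q) (K := K) hMm.2
      (hint _ q hMm.1 hMm.2 le_rfl)
      fun x hx => hlip x ⟨hMm.1.trans hx.1, hx.2⟩ q hqm
        (by rw [abs_of_nonpos (by linarith [hx.2])]; linarith [hx.1]))
    have h3 := abs_le.1 (hlip m hmm p hpm (by rw [abs_of_nonneg (by linarith)]; linarith))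
    have h4 := abs_le.1 (hlip _ hMm q hqm (by rw [abs_of_nonpos (by linarith)]; linarith))
    have h5 : (m - p) * K ≤ K := by nlinarith
    have h6 : (q - (m + J)) * K ≤ K := by nlinarith
    have e1 : sawtooth p = 1 / 2 - (m - p) := by rw [hfp, hm]; ring
    have e2 : sawtooth q = (q - (m + J)) - 1 / 2 := by rw [hfq]
    rw [hsum, hsplit, e1, e2, abs_le]
    constructor <;> linarith

end ShiftedLattice

namespace ShiftedLattice

/-! ### Column sums under a curved arc. -/

variable {f : ℝ → ℝ} {a b c C K : ℝ}

/-- Euler–Maclaurin for the heights x ↦ r s f((x + σ)s/r). Compression by s/r and stretching by rs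
multiply the Lipschitz constant by s², so the error does not grow with r. -/
lemma Curved.abs_sum_columns_sub_le (hf : Curved f a b c C K) {r s σ p q : ℝ} (hr : 0 < r)
    (hs : 0 < s) (hp : 0 ≤ p) (hpq : p ≤ q) (ha : a ≤ (p + σ) * s / r)
    (hb : (q + σ) * s / r ≤ b) :
    |∑ j ∈ Finset.Ioc ⌊p⌋₊ ⌊q⌋₊, r * s * f ((j + σ) * s / r)
      - (r ^ 2 * (∫ x in ((p + σ) * s / r)..((q + σ) * s / r), f x)
        + r * s * f ((p + σ) * s / r) * sawtooth p
        - r * s * f ((q + σ) * s / r) * sawtooth q)| ≤ 6 * (s ^ 2 * K) := by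
  have hrs : 0 < r * s := by positivity
  have hmem : ∀ x ∈ Icc p q, (x + σ) * s / r ∈ Icc a b := by
    intro x hx
    refine ⟨ha.trans ?_, le_trans ?_ hb⟩
    · have := hx.1
      gcongr
    · have := hx.2
      gcongr
  have hconv : ConvexOn ℝ (Icc p q) fun x => r * s * f ((x + σ) * s / r) := by
    refine ⟨convex_Icc p q, fun x hx y hy u v hu hv huv => ?_⟩
    have := hf.convexOn.2 (hmem x hx) (hmem y hy) hu hv huv
    simp only [smul_eq_mul] at this ⊢
    have e : (u * x + v * y + σ) * s / r = u * ((x + σ) * s / r) + v * ((y + σ) * s / r) := by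
      obtain rfl : v = 1 - u := by linarith
      field_simp
      ring
    rw [e]
    have := mul_le_mul_of_nonneg_left this hrs.le
    linarith
  have hlip : ∀ x ∈ Icc p q, ∀ y ∈ Icc p q,
      |r * s * f ((x + σ) * s / r) - r * s * f ((y + σ) * s / r)| ≤ s ^ 2 * K * |x - y| := by
    intro x hx y hy
    have h := hf.lipschitz _ (hmem x hx) _ (hmem y hy)
    rw [← mul_sub, abs_mul, abs_of_pos hrs]
    have e : (x + σ) * s / r - (y + σ) * s / r = s / r * (x - y) := by field_simp; ring
    rw [e, abs_mul, abs_of_pos (by positivity : 0 < s / r)] at h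
    calc _ ≤ r * s * (K * (s / r * |x - y|)) := by gcongr
      _ = _ := by field_simp
  have h := abs_sum_sub_integral_le hp hpq (mul_nonneg (sq_nonneg s) hf.K_nonneg) hconv hlip
  have e : ∫ x in p..q, r * s * f ((x + σ) * s / r)
      = r ^ 2 * (∫ x in ((p + σ) * s / r)..((q + σ) * s / r), f x) := by
    have h1 := intervalIntegral.integral_comp_mul_add (a := p) (b := q) f
      (show s / r ≠ 0 by positivity) (σ * s / r)
    rw [intervalIntegral.integral_const_mul]
    have e1 : ∀ x : ℝ, (x + σ) * s / r = s / r * x + σ * s / r := fun x => by ring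
    simp only [e1]
    rw [h1, smul_eq_mul]
    field_simp
  rw [e] at h
  exact h

lemma Curved.abs_sum_columns_sub_le' (hf : Curved f a b c C K ∨ Curved (-f) a b c C K)
    {r s σ p q : ℝ} (hr : 0 < r) (hs : 0 < s) (hp : 0 ≤ p) (hpq : p ≤ q)
    (ha : a ≤ (p + σ) * s / r) (hb : (q + σ) * s / r ≤ b) :
    |∑ j ∈ Finset.Ioc ⌊p⌋₊ ⌊q⌋₊, r * s * f ((j + σ) * s / r)
      - (r ^ 2 * (∫ x in ((p + σ) * s / r)..((q + σ) * s / r), f x)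
        + r * s * f ((p + σ) * s / r) * sawtooth p
        - r * s * f ((q + σ) * s / r) * sawtooth q)| ≤ 6 * (s ^ 2 * K) := by
  rcases hf with hf | hf
  · exact hf.abs_sum_columns_sub_le hr hs hp hpq ha hb
  · have h := hf.abs_sum_columns_sub_le hr hs hp hpq ha hb
    simp only [Pi.neg_apply, mul_neg, Finset.sum_neg_distrib, intervalIntegral.integral_neg] at h
    rw [← abs_neg]
    refine le_trans (le_of_eq ?_) h
    congr 1
    ring

/-- Unit steps in j are steps s/r in the argument of f, so the second differences of the heights
have size between l = rs · c(s/r)² = cs³/r and (C/c)l, as the van der Corput estimate needs. -/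
lemma abs_sum_columns_sawtooth_le (hf : Curved f a b c C K ∨ Curved (-f) a b c C K)
    {r s σ τ p q d : ℝ} (hr : 0 < r) (hs : 0 < s) (hp : 0 ≤ p) (hpq : p ≤ q)
    (ha : a ≤ (p + σ) * s / r) (hb : (q + σ) * s / r ≤ b) (hd : 0 < d) (hd1 : d ≤ 1) :
    |∑ j ∈ Finset.Ioc ⌊p⌋₊ ⌊q⌋₊, sawtooth (r * s * f ((j + σ) * s / r) - τ)|
      ≤ (q - p + 1) * d / 2 + 15 * (C / c) * (q - p + 1) * Real.sqrt (c * s ^ 3 / r) / Real.sqrt d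
        + 27 / Real.sqrt (c * s ^ 3 / r) := by
  have hrs : 0 < r * s := by positivity
  have hq : 0 ≤ q := hp.trans hpq
  have hc0 : 0 < c := by rcases hf with h | h <;> exact h.c_pos
  have hcC : c ≤ C := by rcases hf with h | h <;> exact h.c_le
  have hCc : 1 ≤ C / c := by rwa [one_le_div hc0]
  rw [← Finset.Ico_add_one_add_one_eq_Ioc, Finset.sum_Ico_eq_sum_range]
  set N := ⌊q⌋₊ + 1 - (⌊p⌋₊ + 1) with hN
  set m := ⌊p⌋₊ + 1 with hm
  have hNle : (N : ℝ) ≤ q - p + 1 := by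
    have h1 := Nat.floor_le hq
    have h2 := Nat.lt_floor_add_one p
    have h3 := Nat.floor_mono hpq
    rw [hN, Nat.cast_sub (by omega), hm]
    push_cast
    linarith
  have key : ∀ F : ℝ → ℝ, Curved F a b c C K → ∀ n, n + 2 < N →
      c * s ^ 3 / r ≤ (r * s * F (((m + (n + 2) : ℕ) + σ) * s / r) -
        r * s * F (((m + (n + 1) : ℕ) + σ) * s / r)) - (r * s * F (((m + (n + 1) : ℕ) + σ) * s / r)
        - r * s * F (((m + n : ℕ) + σ) * s / r)) ∧
      (r * s * F (((m + (n + 2) : ℕ) + σ) * s / r) -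
        r * s * F (((m + (n + 1) : ℕ) + σ) * s / r)) - (r * s * F (((m + (n + 1) : ℕ) + σ) * s / r)
        - r * s * F (((m + n : ℕ) + σ) * s / r)) ≤ C / c * (c * s ^ 3 / r) := by
    intro F hF n hn
    have h1 : a ≤ ((m + n : ℕ) + σ) * s / r := by
      refine ha.trans ?_
      have h2 := Nat.lt_floor_add_one p
      have : p ≤ ((m + n : ℕ) : ℝ) := by
        rw [hm]
        push_cast
        linarith [(Nat.cast_nonneg n : (0 : ℝ) ≤ n)]
      gcongr
    have e1 : ∀ k : ℕ, ((m + (n + k) : ℕ) + σ) * s / r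
        = ((m + n : ℕ) + σ) * s / r + k * (s / r) := fun k => by push_cast; ring
    have h2 : ((m + n : ℕ) + σ) * s / r + 2 * (s / r) ≤ b := by
      refine le_trans ?_ hb
      have := e1 2
      push_cast at this
      push_cast
      rw [← this]
      have h3 := Nat.floor_le hq
      have h4 : ((m + (n + 2) : ℕ) : ℝ) ≤ ⌊q⌋₊ := by
        exact_mod_cast (by omega : m + (n + 2) ≤ ⌊q⌋₊)
      push_cast at h4
      have : (m : ℝ) + (n + 2) ≤ q := h4.trans h3
      gcongr
    have h3 := mul_le_mul_of_nonneg_left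
      (hF.le_second_diff _ (s / r) (by positivity) h1 h2) hrs.le
    have h4 := mul_le_mul_of_nonneg_left
      (hF.second_diff_le _ (s / r) (by positivity) h1 h2) hrs.le
    have e2 : r * s * (c * (s / r) ^ 2) = c * s ^ 3 / r := by field_simp
    have e3 : r * s * (C * (s / r) ^ 2) = C / c * (c * s ^ 3 / r) := by field_simp
    rw [e2] at h3
    rw [e3] at h4
    rw [e1 2, e1 1]
    push_cast at h3 h4 ⊢
    rw [one_mul]
    constructor <;> linarith
  have h := abs_sum_sawtooth_le (y := fun n => r * s * f (((m + n : ℕ) + σ) * s / r) - τ) (N := N)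
    (l := c * s ^ 3 / r) (C := C / c) (by positivity) hCc (by
      rcases hf with hf | hf
      · left
        intro n hn
        have := key f hf n hn
        constructor <;> linarith [this.1, this.2]
      · right
        intro n hn
        have := key (-f) hf n hn
        simp only [Pi.neg_apply] at this
        constructor <;> linarith [this.1, this.2]) hd hd1
  refine h.trans ?_
  gcongr

/-- The choice d = 1/ρ balances the errors. With n = O(ρ³) columns and l of order ρ⁻³, both nd and
n√(l/d) have order ρ², while 1/√l has order ρ^(3/2) only. -/
lemma columns_sawtooth_bound_le {c C B E ρ s n : ℝ} (hc0 : 0 < c) (hC0 : 0 < C) (hB : 1 ≤ B)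
    (hρ : 1 ≤ ρ) (hsB : B⁻¹ ≤ s) (hsB' : s ≤ B) (hn : 0 ≤ n) (hlen : n ≤ E * ρ ^ 3) :
    n * (1 / ρ) / 2 + 15 * (C / c) * n * Real.sqrt (c * s ^ 3 / ρ ^ 3) / Real.sqrt (1 / ρ)
        + 27 / Real.sqrt (c * s ^ 3 / ρ ^ 3)
      ≤ (E / 2 + 15 * (C / c) * E * (Real.sqrt c * B ^ 2) + 27 * B ^ 2 / Real.sqrt c) * ρ ^ 2 := by
  have hB0 : 0 < B := by linarith
  have hs : 0 < s := lt_of_lt_of_le (by positivity) hsB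
  have hρ0 : 0 < ρ := by linarith
  have hr : 0 < ρ ^ 3 := by positivity
  have hE0 : 0 ≤ E := nonneg_of_mul_nonneg_left (hn.trans hlen) hr
  set w := Real.sqrt c with hw
  have hw0 : 0 < w := Real.sqrt_pos.2 hc0
  have hsqrt : Real.sqrt (c * s ^ 3 / ρ ^ 3) * Real.sqrt (ρ ^ 3) = w * Real.sqrt (s ^ 3) := by
    rw [Real.sqrt_div (by positivity), Real.sqrt_mul hc0.le, div_mul_cancel₀]
    exact (Real.sqrt_pos.2 hr).ne'
  set z := Real.sqrt (c * s ^ 3 / ρ ^ 3) with hz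
  have hz0 : 0 < z := Real.sqrt_pos.2 (by positivity)
  set v := Real.sqrt ρ with hv
  have hv0 : 0 < v := Real.sqrt_pos.2 hρ0
  have hvv : v * v = ρ := Real.mul_self_sqrt hρ0.le
  have hv1 : 1 ≤ v := Real.one_le_sqrt.2 hρ
  have hv3 : Real.sqrt (ρ ^ 3) = ρ * v := by
    rw [show ρ ^ 3 = ρ ^ 2 * ρ by ring, Real.sqrt_mul (by positivity), Real.sqrt_sq hρ0.le]
  have hs3up : Real.sqrt (s ^ 3) ≤ B ^ 2 := by
    rw [Real.sqrt_le_left (by positivity)]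
    calc s ^ 3 ≤ B ^ 3 := by gcongr
      _ ≤ B ^ 4 := pow_le_pow_right₀ hB (by norm_num)
      _ = _ := by ring
  have hs3low : (B ^ 2)⁻¹ ≤ Real.sqrt (s ^ 3) := by
    apply Real.le_sqrt_of_sq_le
    calc ((B ^ 2)⁻¹) ^ 2 = (B⁻¹) ^ 4 := by ring
      _ ≤ (B⁻¹) ^ 3 := pow_le_pow_of_le_one (by positivity) (inv_le_one_of_one_le₀ hB) (by norm_num)
      _ ≤ s ^ 3 := by gcongr
  rw [hv3] at hsqrt
  have h5 : (n) * (1 / ρ) / 2 ≤ E / 2 * ρ ^ 2 := by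
    calc _ ≤ (E * ρ ^ 3) * (1 / ρ) / 2 := by gcongr
      _ = _ := by field_simp
  have hCc : 0 < C / c := div_pos hC0 hc0
  have h6 : 15 * (C / c) * (n) * z / Real.sqrt (1 / ρ)
      ≤ 15 * (C / c) * E * (w * B ^ 2) * ρ ^ 2 := by
    rw [Real.sqrt_div zero_le_one, Real.sqrt_one, ← hv]
    have e : z / (1 / v) = w * Real.sqrt (s ^ 3) / ρ := by
      rw [← hsqrt]
      field_simp
    calc 15 * (C / c) * (n) * z / (1 / v)
        = 15 * (C / c) * (n) * (z / (1 / v)) := by ring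
      _ = 15 * (C / c) * (n) * (w * Real.sqrt (s ^ 3) / ρ) := by rw [e]
      _ ≤ 15 * (C / c) * (E * ρ ^ 3) * (w * B ^ 2 / ρ) := by gcongr
      _ = _ := by field_simp
  have h7 : 27 / z ≤ 27 * B ^ 2 / w * ρ ^ 2 := by
    have e : 27 / z = 27 * (ρ * v) / (w * Real.sqrt (s ^ 3)) := by
      rw [← hsqrt]
      field_simp
    have hvρ : v ≤ ρ := by
      rw [← hvv]
      exact le_mul_of_one_le_left hv0.le hv1
    calc 27 / z = 27 * (ρ * v) / (w * Real.sqrt (s ^ 3)) := e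
      _ ≤ 27 * (ρ * ρ) / (w * (B ^ 2)⁻¹) := by gcongr
      _ = _ := by field_simp
  linarith

/-- Asymptotics for the number of lattice points in a range of columns under a curved arc. -/
theorem exists_abs_sum_floor_sub_le (hf : Curved f a b c C K ∨ Curved (-f) a b c C K) (σ τ : ℝ)
    {B : ℝ} (hB : 1 ≤ B) :
    ∃ D, 0 ≤ D ∧ ∀ ρ s p q : ℝ, 1 ≤ ρ → B⁻¹ ≤ s → s ≤ B → 0 ≤ p → p ≤ q →
      a ≤ (p + σ) * s / ρ ^ 3 → (q + σ) * s / ρ ^ 3 ≤ b →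
      |∑ j ∈ Finset.Ioc ⌊p⌋₊ ⌊q⌋₊, (⌊ρ ^ 3 * s * f ((j + σ) * s / ρ ^ 3) - τ⌋ : ℝ)
        - ((ρ ^ 3) ^ 2 * (∫ x in ((p + σ) * s / ρ ^ 3)..((q + σ) * s / ρ ^ 3), f x)
          - (τ + 1 / 2) * (q - p)
          + ρ ^ 3 * s * f ((p + σ) * s / ρ ^ 3) * sawtooth p
          - ρ ^ 3 * s * f ((q + σ) * s / ρ ^ 3) * sawtooth q)| ≤ D * ρ ^ 2 := by
  have hc0 : 0 < c := by rcases hf with h | h <;> exact h.c_pos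
  have hcC : c ≤ C := by rcases hf with h | h <;> exact h.c_le
  have hK : 0 ≤ K := by rcases hf with h | h <;> exact h.K_nonneg
  have hB0 : 0 < B := by linarith
  set E := B * |b - a| + 1 with hE
  have hE0 : 0 < E := by positivity
  have hC0 : 0 < C := hc0.trans_le hcC
  refine ⟨6 * (B ^ 2 * K) + |τ + 1 / 2| + (E / 2 + 15 * (C / c) * E * (Real.sqrt c * B ^ 2)
    + 27 * B ^ 2 / Real.sqrt c), by positivity, ?_⟩
  intro ρ s p q hρ hsB hsB' hp hpq ha hb
  have hs : 0 < s := lt_of_lt_of_le (by positivity) hsB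
  have hρ0 : 0 < ρ := by linarith
  have hr : 0 < ρ ^ 3 := by positivity
  have hq : 0 ≤ q := hp.trans hpq
  have hρ1 : 1 ≤ ρ ^ 2 := one_le_pow₀ hρ
  have hρ3 : 1 ≤ ρ ^ 3 := one_le_pow₀ hρ
  have h1 := Curved.abs_sum_columns_sub_le' hf hr hs hp hpq ha hb
  have h2 := abs_sum_columns_sawtooth_le hf (τ := τ) (d := 1 / ρ) hr hs hp hpq ha hb
    (by positivity) (by rw [div_le_one hρ0]; exact hρ)
  have hcount : |((Finset.Ioc ⌊p⌋₊ ⌊q⌋₊).card : ℝ) - (q - p)| ≤ 1 := by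
    rw [Nat.card_Ioc, Nat.cast_sub (Nat.floor_mono hpq)]
    have h1 := Nat.floor_le hq
    have h2 := Nat.lt_floor_add_one p
    have h3 := Nat.floor_le hp
    have h4 := Nat.lt_floor_add_one q
    rw [abs_le]
    constructor <;> linarith
  -- Uses ⌊y⌋ = y - 1/2 - ψ(y) in each column, which produces the coefficient τ + 1/2.
  have hsum : ∑ j ∈ Finset.Ioc ⌊p⌋₊ ⌊q⌋₊, (⌊ρ ^ 3 * s * f ((j + σ) * s / ρ ^ 3) - τ⌋ : ℝ)
      = ∑ j ∈ Finset.Ioc ⌊p⌋₊ ⌊q⌋₊, ρ ^ 3 * s * f ((j + σ) * s / ρ ^ 3)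
        - (τ + 1 / 2) * (Finset.Ioc ⌊p⌋₊ ⌊q⌋₊).card
        - ∑ j ∈ Finset.Ioc ⌊p⌋₊ ⌊q⌋₊, sawtooth (ρ ^ 3 * s * f ((j + σ) * s / ρ ^ 3) - τ) := by
    have e : (τ + 1 / 2) * (Finset.Ioc ⌊p⌋₊ ⌊q⌋₊).card
        = ∑ j ∈ Finset.Ioc ⌊p⌋₊ ⌊q⌋₊, (τ + 1 / 2) := by
      rw [Finset.sum_const, nsmul_eq_mul, mul_comm]
    rw [e, ← Finset.sum_sub_distrib, ← Finset.sum_sub_distrib]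
    refine Finset.sum_congr rfl fun j _ => ?_
    rw [sawtooth, Int.fract]
    ring
  have h3 : |(τ + 1 / 2) * ((Finset.Ioc ⌊p⌋₊ ⌊q⌋₊).card - (q - p))| ≤ |τ + 1 / 2| * ρ ^ 2 := by
    rw [abs_mul]
    gcongr
    exact hcount.trans hρ1
  have h4 : 6 * (s ^ 2 * K) ≤ 6 * (B ^ 2 * K) * ρ ^ 2 := by
    calc 6 * (s ^ 2 * K) ≤ 6 * (B ^ 2 * K) * 1 := by rw [mul_one]; gcongr
      _ ≤ _ := by gcongr
  -- The abscissas fill at most [a, b] with spacing s/ρ³ ≥ 1/(Bρ³).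
  have hlen : q - p + 1 ≤ E * ρ ^ 3 := by
    have h5 : (q - p) * s / ρ ^ 3 ≤ |b - a| := by
      refine le_trans ?_ (le_abs_self _)
      have : (q - p) * s / ρ ^ 3 = (q + σ) * s / ρ ^ 3 - (p + σ) * s / ρ ^ 3 := by ring
      linarith
    have h6 : q - p = (q - p) * s / ρ ^ 3 * (ρ ^ 3 * s⁻¹) := by field_simp
    have h7 : s⁻¹ ≤ B := inv_le_of_inv_le₀ hB0 hsB
    have h8 : q - p ≤ |b - a| * (ρ ^ 3 * B) := by
      rw [h6]
      gcongr
    rw [hE]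
    nlinarith
  have h5 := columns_sawtooth_bound_le hc0 hC0 hB hρ hsB hsB' (by linarith)
    hlen
  rw [hsum]
  have h1' := abs_le.1 h1
  have h2' := abs_le.1 h2
  have h3' := abs_le.1 h3
  rw [abs_le]
  constructor <;> linarith

end ShiftedLattice

namespace ShiftedLattice

/-! ### Inverse pairs, reflection, and decompositions of the count. -/

/-- Mutually inverse strictly decreasing functions of `[0, L]` onto itself. -/
structure InversePair (L : ℝ) (f g : ℝ → ℝ) : Prop where
  L_pos : 0 < L
  strictAntiOn : StrictAntiOn f (Icc 0 L)
  mapsTo : MapsTo f (Icc 0 L) (Icc 0 L)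
  mapsTo_inv : MapsTo g (Icc 0 L) (Icc 0 L)
  invOn : InvOn g f (Icc 0 L) (Icc 0 L)

lemma IsDecreasingCurve.inversePair {L : ℝ} {f g : ℝ → ℝ} (h : IsDecreasingCurve L f g) :
    InversePair L f g where
  L_pos := h.L_pos
  strictAntiOn := h.strictAntiOn
  mapsTo := fun x hx => by
    have h0 : (0 : ℝ) ∈ Icc 0 L := ⟨le_rfl, h.L_pos.le⟩
    have h1 : L ∈ Icc 0 L := ⟨h.L_pos.le, le_rfl⟩
    exact ⟨h.map_L ▸ h.strictAntiOn.antitoneOn hx h1 hx.2,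
      h.map_zero ▸ h.strictAntiOn.antitoneOn h0 hx hx.1⟩
  mapsTo_inv := h.mapsTo_inv
  invOn := h.invOn

namespace InversePair

variable {L : ℝ} {f g : ℝ → ℝ} (h : InversePair L f g)
include h

lemma zero_mem : (0 : ℝ) ∈ Icc 0 L := ⟨le_rfl, h.L_pos.le⟩

lemma L_mem : L ∈ Icc 0 L := ⟨h.L_pos.le, le_rfl⟩

lemma symm : InversePair L g f where
  L_pos := h.L_pos
  strictAntiOn := fun x hx y hy hxy => by
    by_contra! hle
    have := h.strictAntiOn.antitoneOn (h.mapsTo_inv hx) (h.mapsTo_inv hy) hle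
    rw [h.invOn.2 hx, h.invOn.2 hy] at this
    linarith
  mapsTo := h.mapsTo_inv
  mapsTo_inv := h.mapsTo
  invOn := h.invOn.symm

lemma map_zero : f 0 = L := by
  have h1 := h.mapsTo_inv h.L_mem
  have := h.strictAntiOn.antitoneOn h.zero_mem h1 h1.1
  rw [h.invOn.2 h.L_mem] at this
  exact le_antisymm (h.mapsTo h.zero_mem).2 this

lemma map_L : f L = 0 := by
  have h1 := h.mapsTo_inv h.zero_mem
  have := h.strictAntiOn.antitoneOn h1 h.L_mem h1.2
  rw [h.invOn.2 h.zero_mem] at this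
  exact le_antisymm this (h.mapsTo h.L_mem).1

lemma antitoneOn : AntitoneOn f (Icc 0 L) := h.strictAntiOn.antitoneOn

/-- The region under the graph of f is the reflection of the region under the graph of g. This turns
rows into columns. -/
lemma le_map_iff {x y : ℝ} (hx : 0 ≤ x) (hy : 0 ≤ y) :
    (x ≤ L ∧ y ≤ f x) ↔ (y ≤ L ∧ x ≤ g y) := by
  constructor
  · rintro ⟨h1, h2⟩
    have h3 := h.mapsTo ⟨hx, h1⟩
    have h4 : y ≤ L := h2.trans h3.2
    have := h.symm.antitoneOn ⟨hy, h4⟩ h3 h2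
    rw [h.invOn.1 ⟨hx, h1⟩] at this
    exact ⟨h4, this⟩
  · rintro ⟨h1, h2⟩
    have h3 := h.mapsTo_inv ⟨hy, h1⟩
    have h4 : x ≤ L := h2.trans h3.2
    have := h.antitoneOn ⟨hx, h4⟩ h3 h2
    rw [h.invOn.2 ⟨hy, h1⟩] at this
    exact ⟨h4, this⟩

lemma intervalIntegrable {u v : ℝ} (hu : 0 ≤ u) (huv : u ≤ v) (hv : v ≤ L) :
    IntervalIntegrable f volume u v := by
  apply AntitoneOn.intervalIntegrable
  rw [uIcc_of_le huv]
  exact h.antitoneOn.mono (Icc_subset_Icc hu hv)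

/-- Equality case of Young's inequality for the inverse function. -/
lemma integral_inverse {a : ℝ} (ha : a ∈ Icc 0 L) :
    ∫ y in (0 : ℝ)..f a, g y = (∫ x in a..L, f x) + a * f a := by
  have hb := h.mapsTo ha
  have hfi := h.intervalIntegrable ha.1 ha.2 le_rfl
  have hgi := h.symm.intervalIntegrable le_rfl hb.1 hb.2
  have h1 := volume_regionBetween_eq_integral (μ := (volume : Measure ℝ)) (f := fun _ => (0 : ℝ))
    (g := f) (s := Ioc a L) (by simp) ((intervalIntegrable_iff_integrableOn_Ioc_of_le ha.2).1 hfi)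
    measurableSet_Ioc fun x hx => (h.mapsTo ⟨ha.1.trans hx.1.le, hx.2⟩).1
  have hga : ∀ y ∈ Ioc 0 (f a), a ≤ g y := fun y hy =>
    ((h.le_map_iff ha.1 hy.1.le).1 ⟨ha.2, hy.2⟩).2
  have h2 := volume_regionBetween_eq_integral (μ := (volume : Measure ℝ)) (f := fun _ => a)
    (g := g) (s := Ioc 0 (f a)) (by simp)
    ((intervalIntegrable_iff_integrableOn_Ioc_of_le hb.1).1 hgi) measurableSet_Ioc hga
  -- The part of the region with x > a is, after reflection, the part between the height a and the
  -- graph of g over (0, f a]. Swapping coordinates preserves area.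
  have hset : (MeasurableEquiv.prodComm : ℝ × ℝ ≃ᵐ ℝ × ℝ) ⁻¹'
      (regionBetween (fun _ => a) g (Ioc 0 (f a))) = regionBetween (fun _ => (0 : ℝ)) f (Ioc a L) := by
    ext ⟨x, y⟩
    simp only [regionBetween, MeasurableEquiv.prodComm, mem_preimage, MeasurableEquiv.coe_mk,
      Equiv.prodComm_apply, Prod.swap_prod_mk, Set.mem_ofPred_eq, mem_Ioc, mem_Ioo]
    constructor
    · rintro ⟨⟨hy0, hyb⟩, hax, hxg⟩
      have hy : y ∈ Icc 0 L := ⟨hy0.le, hyb.trans hb.2⟩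
      have hgy := h.mapsTo_inv hy
      refine ⟨⟨hax, hxg.le.trans hgy.2⟩, hy0, ?_⟩
      have := h.strictAntiOn ⟨ha.1.trans hax.le, hxg.le.trans hgy.2⟩ hgy hxg
      rwa [h.invOn.2 hy] at this
    · rintro ⟨⟨hax, hxL⟩, hy0, hyf⟩
      have hx : x ∈ Icc 0 L := ⟨ha.1.trans hax.le, hxL⟩
      have hfx := h.mapsTo hx
      have hfa := h.strictAntiOn ha hx hax
      refine ⟨⟨hy0, by linarith⟩, hax, ?_⟩
      have := h.symm.strictAntiOn ⟨hy0.le, hyf.le.trans hfx.2⟩ hfx hyf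
      rwa [h.invOn.1 hx] at this
  have h3 : (volume.prod volume : Measure (ℝ × ℝ)) (regionBetween (fun _ => (0 : ℝ)) f (Ioc a L))
      = (volume.prod volume) (regionBetween (fun _ => a) g (Ioc 0 (f a))) := by
    rw [← hset]
    exact (Measure.measurePreserving_swap (μ := (volume : Measure ℝ))
      (ν := (volume : Measure ℝ))).measure_preimage_equiv (f := MeasurableEquiv.prodComm) _
  rw [h1, h2] at h3
  have h4 : 0 ≤ ∫ y in Ioc a L, (f - fun _ : ℝ => (0 : ℝ) : ℝ → ℝ) y :=
    setIntegral_nonneg measurableSet_Ioc fun x hx => by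
      have := (h.mapsTo ⟨ha.1.trans hx.1.le, hx.2⟩).1
      simpa using this
  have h5 : 0 ≤ ∫ y in Ioc 0 (f a), (g - fun _ : ℝ => a : ℝ → ℝ) y :=
    setIntegral_nonneg measurableSet_Ioc fun x hx => by
      simpa using hga x hx
  rw [ENNReal.ofReal_eq_ofReal_iff h4 h5] at h3
  rw [← intervalIntegral.integral_of_le ha.2, ← intervalIntegral.integral_of_le hb.1] at h3
  simp only [Pi.sub_apply, sub_zero] at h3
  rw [intervalIntegral.integral_sub hgi (by simp), intervalIntegral.integral_const,
    smul_eq_mul, sub_zero] at h3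
  rw [h3]
  ring

lemma area_comm : area L g = area L f := by
  have := h.integral_inverse h.zero_mem
  rw [h.map_zero] at this
  simpa [area] using this

end InversePair

lemma ncard_columns (S : Finset ℕ) (τ : ℝ) (Y : ℕ → ℝ) :
    {p : ℕ × ℕ | p.1 ∈ S ∧ 1 ≤ p.2 ∧ (p.2 : ℝ) + τ ≤ Y p.1}.Finite ∧
    {p : ℕ × ℕ | p.1 ∈ S ∧ 1 ≤ p.2 ∧ (p.2 : ℝ) + τ ≤ Y p.1}.ncard = ∑ j ∈ S, ⌊Y j - τ⌋₊ := by
  have hset : {p : ℕ × ℕ | p.1 ∈ S ∧ 1 ≤ p.2 ∧ (p.2 : ℝ) + τ ≤ Y p.1}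
      = ↑((S.sigma fun j => Finset.Icc 1 ⌊Y j - τ⌋₊).map
          (Equiv.sigmaEquivProd ℕ ℕ).toEmbedding) := by
    ext ⟨j, k⟩
    simp only [Set.mem_ofPred_eq, Finset.coe_map, Set.mem_image, Finset.mem_coe, Finset.mem_sigma,
      Finset.mem_Icc, Equiv.coe_toEmbedding, Equiv.sigmaEquivProd_apply, Sigma.exists,
      Prod.mk.injEq]
    constructor
    · rintro ⟨h1, h2, h3⟩
      refine ⟨j, k, ⟨h1, h2, ?_⟩, rfl, rfl⟩
      rw [Nat.le_floor_iff' (by omega)]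
      linarith
    · rintro ⟨j', k', ⟨h1, h2, h3⟩, rfl, rfl⟩
      refine ⟨h1, h2, ?_⟩
      rw [Nat.le_floor_iff' (by omega)] at h3
      linarith
  rw [hset]
  refine ⟨Finset.finite_toSet _, ?_⟩
  rw [Set.ncard_coe_finset, Finset.card_map, Finset.card_sigma]
  simp

section Counting

variable {L : ℝ} {f g : ℝ → ℝ} {σ τ r s : ℝ}

lemma half_le_add {σ : ℝ} (hσ : -(1 / 2) < σ) {j : ℕ} (hj : 1 ≤ j) : (j : ℝ) / 2 ≤ j + σ := by
  have : (1 : ℝ) ≤ j := by exact_mod_cast hj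
  linarith

lemma add_pos_of_one_le {σ : ℝ} (hσ : -(1 / 2) < σ) {j : ℕ} (hj : 1 ≤ j) : 0 < (j : ℝ) + σ := by
  have : (1 : ℝ) ≤ j := by exact_mod_cast hj
  linarith

lemma mem_enclosedPoints_iff (hr : 0 < r) (hs : 0 < s) (p : ℕ × ℕ) :
    p ∈ enclosedPoints L f σ τ r s ↔ 1 ≤ p.1 ∧ 1 ≤ p.2 ∧ ((p.1 : ℝ) + σ) * s / r ≤ L ∧
      ((p.2 : ℝ) + τ) * s⁻¹ / r ≤ f (((p.1 : ℝ) + σ) * s / r) := by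
  unfold enclosedPoints
  rw [Set.mem_ofPred_eq]
  have e : ∀ z : ℝ, (p.2 : ℝ) + τ ≤ r * s * z ↔ ((p.2 : ℝ) + τ) * s⁻¹ / r ≤ z := by
    intro z
    rw [div_le_iff₀ hr, mul_inv_le_iff₀ hs]
    rw [show z * r * s = r * s * z by ring]
  rw [e]

lemma enclosedPoints_swap (h : InversePair L f g) (hσ : -(1 / 2) < σ) (hτ : -(1 / 2) < τ)
    (hr : 0 < r) (hs : 0 < s) (p : ℕ × ℕ) :
    p.swap ∈ enclosedPoints L g τ σ r s⁻¹ ↔ p ∈ enclosedPoints L f σ τ r s := by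
  rw [mem_enclosedPoints_iff hr hs, mem_enclosedPoints_iff hr (inv_pos.2 hs), inv_inv]
  simp only [Prod.fst_swap, Prod.snd_swap]
  constructor
  · rintro ⟨h1, h2, h3⟩
    have hx := add_pos_of_one_le hσ h2
    have hy := add_pos_of_one_le hτ h1
    exact ⟨h2, h1, (h.le_map_iff (by positivity) (by positivity)).2 h3⟩
  · rintro ⟨h1, h2, h3⟩
    have hx := add_pos_of_one_le hσ h1
    have hy := add_pos_of_one_le hτ h2
    exact ⟨h2, h1, (h.le_map_iff (by positivity) (by positivity)).1 h3⟩

lemma ncard_swap_eq {A B : Set (ℕ × ℕ)} (hAB : ∀ p : ℕ × ℕ, p.swap ∈ A ↔ p ∈ B) :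
    A.ncard = B.ncard := by
  have : A = Prod.swap '' B := by
    ext p
    rw [Set.mem_image]
    constructor
    · intro hp
      exact ⟨p.swap, (hAB _).1 (by rwa [Prod.swap_swap]), Prod.swap_swap p⟩
    · rintro ⟨q, hq, rfl⟩
      exact (hAB q).2 hq
  rw [this, Set.ncard_image_of_injective _ Prod.swap_injective]

lemma count_swap (h : InversePair L f g) (hσ : -(1 / 2) < σ) (hτ : -(1 / 2) < τ)
    (hr : 0 < r) (hs : 0 < s) : count L g τ σ r s⁻¹ = count L f σ τ r s :=
  ncard_swap_eq (enclosedPoints_swap h hσ hτ hr hs)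

/-- In the product of the two coordinate bounds s cancels: (j + σ)(k + τ) ≤ r²L². With j + σ ≥ j/2
and k + τ ≥ k/2 the box does not depend on s, so the counts are bounded for fixed r and their
maximum is attained. -/
lemma enclosedPoints_subset (h : InversePair L f g) (hσ : -(1 / 2) < σ) (hτ : -(1 / 2) < τ)
    (hr : 0 < r) (hs : 0 < s) :
    enclosedPoints L f σ τ r s ⊆
      ↑(Finset.Icc 1 ⌊4 * r ^ 2 * L ^ 2⌋₊ ×ˢ Finset.Icc 1 ⌊4 * r ^ 2 * L ^ 2⌋₊) := by
  rintro ⟨j, k⟩ hp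
  rw [mem_enclosedPoints_iff hr hs] at hp
  obtain ⟨hj, hk, h1, h2⟩ := hp
  simp only at hj hk h1 h2
  have hx := half_le_add hσ hj
  have hy := half_le_add hτ hk
  have hx0 := add_pos_of_one_le hσ hj
  have hy0 := add_pos_of_one_le hτ hk
  have h3 := (h.mapsTo (x := ((j : ℝ) + σ) * s / r) ⟨by positivity, h1⟩).2
  have h4 : ((k : ℝ) + τ) * s⁻¹ / r ≤ L := h2.trans h3
  have h5 : (((j : ℝ) + σ) * s / r) * (((k : ℝ) + τ) * s⁻¹ / r) ≤ L * L :=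
    mul_le_mul h1 h4 (by positivity) h.L_pos.le
  have h6 : (((j : ℝ) + σ) * s / r) * (((k : ℝ) + τ) * s⁻¹ / r) * r ^ 2
      = ((j : ℝ) + σ) * ((k : ℝ) + τ) := by field_simp
  have h7 : ((j : ℝ) + σ) * ((k : ℝ) + τ) ≤ L * L * r ^ 2 := by
    rw [← h6]
    gcongr
  have h8 : (j : ℝ) / 2 * ((k : ℝ) / 2) ≤ ((j : ℝ) + σ) * ((k : ℝ) + τ) := by gcongr
  have h9 : ((j * k : ℕ) : ℝ) ≤ 4 * r ^ 2 * L ^ 2 := by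
    push_cast
    nlinarith
  have h10 : j * k ≤ ⌊4 * r ^ 2 * L ^ 2⌋₊ := Nat.le_floor h9
  rw [Finset.mem_coe, Finset.mem_product, Finset.mem_Icc, Finset.mem_Icc]
  exact ⟨⟨hj, (Nat.le_mul_of_pos_right j hk).trans h10⟩,
    ⟨hk, (Nat.le_mul_of_pos_left k hj).trans h10⟩⟩

lemma enclosedPoints_finite (h : InversePair L f g) (hσ : -(1 / 2) < σ) (hτ : -(1 / 2) < τ)
    (hr : 0 < r) (hs : 0 < s) : (enclosedPoints L f σ τ r s).Finite :=
  (Finset.finite_toSet _).subset (enclosedPoints_subset h hσ hτ hr hs)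

lemma exists_isGreatest_count (h : InversePair L f g) (hσ : -(1 / 2) < σ) (hτ : -(1 / 2) < τ)
    (hr : 0 < r) :
    ∃ M, IsGreatest ((fun s => count L f σ τ r s) '' Ioi 0) M := by
  have hbdd : BddAbove ((fun s => count L f σ τ r s) '' Ioi 0) := by
    refine ⟨(Finset.Icc 1 ⌊4 * r ^ 2 * L ^ 2⌋₊ ×ˢ Finset.Icc 1 ⌊4 * r ^ 2 * L ^ 2⌋₊).card, ?_⟩
    rintro _ ⟨s, hs, rfl⟩
    rw [← Set.ncard_coe_finset]
    exact Set.ncard_le_ncard (enclosedPoints_subset h hσ hτ hr hs) (Finset.finite_toSet _)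
  have hne : ((fun s => count L f σ τ r s) '' Ioi 0).Nonempty := ⟨_, 1, mem_Ioi.2 one_pos, rfl⟩
  exact ⟨_, Nat.sSup_mem hne hbdd, fun x hx => le_csSup hbdd hx⟩

/-- Inclusion–exclusion for the columns to the left of, and the rows below, a point of the curve. -/
lemma count_add_mul_eq (h : InversePair L f g) (hσ : -(1 / 2) < σ) (hτ : -(1 / 2) < τ)
    (hr : 0 < r) (hs : 0 < s) {a : ℝ} (ha : a ∈ Icc 0 L) :
    count L f σ τ r s + ⌊a * r / s - σ⌋₊ * ⌊f a * r / s⁻¹ - τ⌋₊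
      = ∑ j ∈ Finset.Ioc 0 ⌊a * r / s - σ⌋₊, ⌊r * s * f ((j + σ) * s / r) - τ⌋₊
        + ∑ k ∈ Finset.Ioc 0 ⌊f a * r / s⁻¹ - τ⌋₊, ⌊r * s⁻¹ * g ((k + τ) * s⁻¹ / r) - σ⌋₊ := by
  have hb := h.mapsTo ha
  have hcol : ∀ {f : ℝ → ℝ} {σ τ s a : ℝ}, 0 < s → a ≤ L →
      {p ∈ enclosedPoints L f σ τ r s | ((p.1 : ℝ) + σ) * s / r ≤ a}.ncard
        = ∑ j ∈ Finset.Ioc 0 ⌊a * r / s - σ⌋₊, ⌊r * s * f ((j + σ) * s / r) - τ⌋₊ := by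
    intro f σ τ s a hs ha
    rw [← (ncard_columns _ τ fun j => r * s * f ((j + σ) * s / r)).2]
    congr 1
    ext ⟨j, k⟩
    simp only [enclosedPoints, Set.mem_ofPred_eq, Finset.mem_Ioc]
    have e : ((j : ℝ) + σ) * s / r ≤ a ↔ (j : ℝ) ≤ a * r / s - σ := by
      rw [le_sub_iff_add_le, le_div_iff₀ hs, div_le_iff₀ hr]
    constructor
    · rintro ⟨⟨h1, h2, h3, h4⟩, h5⟩
      exact ⟨⟨h1, (Nat.le_floor_iff' (by omega)).2 (e.1 h5)⟩, h2, h4⟩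
    · rintro ⟨⟨h1, h2⟩, h3, h4⟩
      have h5 := e.2 ((Nat.le_floor_iff' (by omega)).1 h2)
      exact ⟨⟨h1, h3, h5.trans ha, h4⟩, h5⟩
  set E := enclosedPoints L f σ τ r s with hE
  set E1 := {p ∈ E | ((p.1 : ℝ) + σ) * s / r ≤ a} with hE1
  set E2 := {p ∈ E | ((p.2 : ℝ) + τ) * s⁻¹ / r ≤ f a} with hE2
  have hfin := enclosedPoints_finite h hσ hτ hr hs
  have h1 : E1.ncard = _ := hcol hs ha.2
  have h2 : E2.ncard = _ := (ncard_swap_eq (B := E2)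
    (A := {p ∈ enclosedPoints L g τ σ r s⁻¹ | ((p.1 : ℝ) + τ) * s⁻¹ / r ≤ f a}) (by
      intro p
      simp only [hE2, Set.mem_ofPred_eq, enclosedPoints_swap h hσ hτ hr hs, Prod.fst_swap,
        hE])).symm.trans (hcol (inv_pos.2 hs) hb.2)
  have h3 : E = E1 ∪ E2 := by
    ext p
    simp only [hE1, hE2, Set.mem_union, Set.mem_ofPred_eq]
    constructor
    · intro hp
      rcases le_or_gt (((p.1 : ℝ) + σ) * s / r) a with h4 | h4
      · exact Or.inl ⟨hp, h4⟩
      · refine Or.inr ⟨hp, ?_⟩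
        have h5 := (mem_enclosedPoints_iff hr hs p).1 hp
        exact h5.2.2.2.trans (h.antitoneOn ha ⟨ha.1.trans h4.le, h5.2.2.1⟩ h4.le)
    · rintro (h4 | h4) <;> exact h4.1
  -- By monotonicity of f, the whole rectangle with corner (a, f a) lies under the curve, so the
  -- overlap is a full product.
  have h4 : (E1 ∩ E2).ncard = ⌊a * r / s - σ⌋₊ * ⌊f a * r / s⁻¹ - τ⌋₊ := by
    have : E1 ∩ E2 = ↑(Finset.Icc 1 ⌊a * r / s - σ⌋₊ ×ˢ Finset.Icc 1 ⌊f a * r / s⁻¹ - τ⌋₊) := by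
      ext ⟨j, k⟩
      have e1 : ((j : ℝ) + σ) * s / r ≤ a ↔ (j : ℝ) ≤ a * r / s - σ := by
        rw [le_sub_iff_add_le, le_div_iff₀ hs, div_le_iff₀ hr]
      have e2 : ((k : ℝ) + τ) * s⁻¹ / r ≤ f a ↔ (k : ℝ) ≤ f a * r / s⁻¹ - τ := by
        rw [le_sub_iff_add_le, le_div_iff₀ (inv_pos.2 hs), div_le_iff₀ hr]
      simp only [hE1, hE2, hE, Set.mem_inter_iff, Set.mem_ofPred_eq, mem_enclosedPoints_iff hr hs,
        Finset.mem_coe, Finset.mem_product, Finset.mem_Icc, e1, e2]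
      constructor
      · rintro ⟨⟨⟨h5, h6, -⟩, h7⟩, -, h8⟩
        exact ⟨⟨h5, Nat.le_floor h7⟩, h6, Nat.le_floor h8⟩
      · rintro ⟨⟨h5, h6⟩, h7, h8⟩
        have h9 := (Nat.le_floor_iff' (by omega)).1 h6
        have h10 := (Nat.le_floor_iff' (by omega)).1 h8
        have h11 := e1.2 h9
        have h12 := e2.2 h10
        have h13 := add_pos_of_one_le hσ h5
        rw [← e1, ← e2]
        have h14 := h.antitoneOn ⟨by positivity, h11.trans ha.2⟩ ha h11
        exact ⟨⟨⟨h5, h7, h11.trans ha.2, h12.trans h14⟩, h11⟩,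
          ⟨h5, h7, h11.trans ha.2, h12.trans h14⟩, h12⟩
    rw [this, Set.ncard_coe_finset, Finset.card_product]
    simp
  rw [← h1, ← h2, ← h4, ← Set.ncard_union_add_ncard_inter E1 E2
    (hfin.subset fun p hp => hp.1) (hfin.subset fun p hp => hp.1), ← h3]
  rfl

/-- Decomposition into the columns to the right of a point of the curve, the rows above it, and
the rectangle below it. -/
lemma count_eq_add_add_mul (h : InversePair L f g) (hσ : -(1 / 2) < σ) (hτ : -(1 / 2) < τ)
    (hr : 0 < r) (hs : 0 < s) {a : ℝ} (ha : a ∈ Icc 0 L) (ha' : 0 ≤ a * r / s - σ)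
    (hb' : 0 ≤ f a * r / s⁻¹ - τ) :
    count L f σ τ r s
      = ∑ j ∈ Finset.Ioc ⌊a * r / s - σ⌋₊ ⌊L * r / s - σ⌋₊, ⌊r * s * f ((j + σ) * s / r) - τ⌋₊
        + ∑ k ∈ Finset.Ioc ⌊f a * r / s⁻¹ - τ⌋₊ ⌊L * r / s⁻¹ - τ⌋₊,
            ⌊r * s⁻¹ * g ((k + τ) * s⁻¹ / r) - σ⌋₊
        + ⌊a * r / s - σ⌋₊ * ⌊f a * r / s⁻¹ - τ⌋₊ := by
  have hb := h.mapsTo ha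
  have hcol : ∀ {f : ℝ → ℝ} {σ τ s a : ℝ}, 0 < s → 0 ≤ a * r / s - σ →
      {p ∈ enclosedPoints L f σ τ r s | a < ((p.1 : ℝ) + σ) * s / r}.ncard
        = ∑ j ∈ Finset.Ioc ⌊a * r / s - σ⌋₊ ⌊L * r / s - σ⌋₊,
            ⌊r * s * f ((j + σ) * s / r) - τ⌋₊ := by
    intro f σ τ s a hs ha
    rw [← (ncard_columns _ τ fun j => r * s * f ((j + σ) * s / r)).2]
    congr 1
    ext ⟨j, k⟩
    simp only [enclosedPoints, Set.mem_ofPred_eq, Finset.mem_Ioc]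
    have e : ((j : ℝ) + σ) * s / r ≤ L ↔ (j : ℝ) ≤ L * r / s - σ := by
      rw [le_sub_iff_add_le, le_div_iff₀ hs, div_le_iff₀ hr]
    have e' : a < ((j : ℝ) + σ) * s / r ↔ a * r / s - σ < j := by
      rw [sub_lt_iff_lt_add, div_lt_iff₀ hs, lt_div_iff₀ hr]
    rw [Nat.floor_lt ha]
    constructor
    · rintro ⟨⟨h1, h2, h3, h4⟩, h5⟩
      exact ⟨⟨e'.1 h5, Nat.le_floor (e.1 h3)⟩, h2, h4⟩
    · rintro ⟨⟨h1, h2⟩, h3, h4⟩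
      have h0 : 0 < (j : ℝ) := ha.trans_lt h1
      have h0' : 0 < j := by exact_mod_cast h0
      exact ⟨⟨h0', h3, e.2 ((Nat.le_floor_iff' (by omega)).1 h2), h4⟩, e'.2 h1⟩
  set E := enclosedPoints L f σ τ r s with hE
  set E1 := {p ∈ E | a < ((p.1 : ℝ) + σ) * s / r} with hE1
  set E2 := {p ∈ E | f a < ((p.2 : ℝ) + τ) * s⁻¹ / r} with hE2
  set R : Finset (ℕ × ℕ) :=
    Finset.Icc 1 ⌊a * r / s - σ⌋₊ ×ˢ Finset.Icc 1 ⌊f a * r / s⁻¹ - τ⌋₊ with hR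
  have hfin := enclosedPoints_finite h hσ hτ hr hs
  have h1 : E1.ncard = _ := hcol hs ha'
  have h2 : E2.ncard = _ := (ncard_swap_eq (B := E2)
    (A := {p ∈ enclosedPoints L g τ σ r s⁻¹ | f a < ((p.1 : ℝ) + τ) * s⁻¹ / r}) (by
      intro p
      simp only [hE2, Set.mem_ofPred_eq, enclosedPoints_swap h hσ hτ hr hs, Prod.fst_swap,
        hE])).symm.trans (hcol (inv_pos.2 hs) hb')
  have e1 : ∀ j : ℕ, ((j : ℝ) + σ) * s / r ≤ a ↔ (j : ℝ) ≤ a * r / s - σ := fun j => by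
    rw [le_sub_iff_add_le, le_div_iff₀ hs, div_le_iff₀ hr]
  have e2 : ∀ k : ℕ, ((k : ℝ) + τ) * s⁻¹ / r ≤ f a ↔ (k : ℝ) ≤ f a * r / s⁻¹ - τ := fun k => by
    rw [le_sub_iff_add_le, le_div_iff₀ (inv_pos.2 hs), div_le_iff₀ hr]
  have hRmem : ∀ p : ℕ × ℕ, p ∈ (R : Set (ℕ × ℕ)) ↔ 1 ≤ p.1 ∧ 1 ≤ p.2 ∧
      ((p.1 : ℝ) + σ) * s / r ≤ a ∧ ((p.2 : ℝ) + τ) * s⁻¹ / r ≤ f a := by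
    intro p
    rw [hR, Finset.mem_coe, Finset.mem_product, Finset.mem_Icc, Finset.mem_Icc,
      Nat.le_floor_iff ha', Nat.le_floor_iff hb', e1, e2]
    tauto
  -- No enclosed point has both x > a and y > f a, so the three pieces are disjoint, and the
  -- rectangle is full.
  have h3 : E = (E1 ∪ E2) ∪ R := by
    ext p
    simp only [Set.mem_union, hRmem, hE1, hE2, Set.mem_ofPred_eq, hE]
    constructor
    · intro hp
      have h5 := (mem_enclosedPoints_iff hr hs p).1 hp
      rcases le_or_gt (((p.1 : ℝ) + σ) * s / r) a with h4 | h4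
      · rcases le_or_gt (((p.2 : ℝ) + τ) * s⁻¹ / r) (f a) with h6 | h6
        · exact Or.inr ⟨h5.1, h5.2.1, h4, h6⟩
        · exact Or.inl (Or.inr ⟨hp, h6⟩)
      · exact Or.inl (Or.inl ⟨hp, h4⟩)
    · rintro ((h4 | h4) | ⟨h4, h5, h6, h7⟩)
      · exact h4.1
      · exact h4.1
      · have h13 := add_pos_of_one_le hσ h4
        rw [mem_enclosedPoints_iff hr hs]
        exact ⟨h4, h5, h6.trans ha.2,
          h7.trans (h.antitoneOn ⟨by positivity, h6.trans ha.2⟩ ha h6)⟩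
  have hd1 : Disjoint E1 E2 := by
    rw [Set.disjoint_left]
    rintro p ⟨h4, h5⟩ ⟨-, h6⟩
    have h7 := (mem_enclosedPoints_iff hr hs p).1 h4
    have h8 := h.antitoneOn ha ⟨ha.1.trans h5.le, h7.2.2.1⟩ h5.le
    linarith [h7.2.2.2]
  have hd2 : Disjoint (E1 ∪ E2) (R : Set (ℕ × ℕ)) := by
    rw [Set.disjoint_left]
    intro p hp hpR
    rw [hRmem] at hpR
    rcases hp with hp | hp
    · linarith [hp.2, hpR.2.2.1]
    · linarith [hp.2, hpR.2.2.2]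
  have hf1 : E1.Finite := hfin.subset fun p hp => hp.1
  have hf2 : E2.Finite := hfin.subset fun p hp => hp.1
  have h5 : (R : Set (ℕ × ℕ)).ncard = ⌊a * r / s - σ⌋₊ * ⌊f a * r / s⁻¹ - τ⌋₊ := by
    rw [Set.ncard_coe_finset, hR, Finset.card_product]
    simp
  rw [← h1, ← h2, ← h5, ← Set.ncard_union_eq hd1 hf1 hf2,
    ← Set.ncard_union_eq hd2 (hf1.union hf2) (Finset.finite_toSet _), ← h3]
  rfl

end Counting

end ShiftedLattice

namespace ShiftedLattice

/-! ### Upper bound for the count: concave curves. -/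

variable {L : ℝ} {f g : ℝ → ℝ} {σ τ r s : ℝ}

lemma negPart_nonneg' (σ : ℝ) : 0 ≤ σ⁻ := negPart_nonneg σ

lemma neg_le_negPart (σ : ℝ) : -σ ≤ σ⁻ := by
  rw [negPart_def]
  exact le_sup_left

lemma negPart_lt_half {σ : ℝ} (hσ : -(1 / 2) < σ) : σ⁻ < 1 / 2 := by
  rw [negPart_def]
  exact sup_lt_iff.2 ⟨by linarith, by norm_num⟩

/-- The number of columns that can meet the region. -/
lemma columns_bounds {L r s u : ℝ} (hr : 0 < r) (hs : 0 < s) (hu : 0 ≤ u) (hL : 0 < L) :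
    ((⌊L * r / s + u⌋₊ : ℝ) - u) * s / r ≤ L ∧ L < ((⌊L * r / s + u⌋₊ : ℝ) + 1 - u) * s / r := by
  have h1 := Nat.floor_le (show 0 ≤ L * r / s + u by positivity)
  have h2 := Nat.lt_floor_add_one (L * r / s + u)
  constructor
  · rw [div_le_iff₀ hr, ← le_div_iff₀ hs]
    linarith
  · rw [lt_div_iff₀ hr, ← div_lt_iff₀ hs]
    linarith

/-- Replacing the shifts by -σ⁻ and -τ⁻ moves points down and left, which can only add points.
Dropping the floors then leaves a Riemann sum plus τ⁻ per column. -/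
lemma count_le_sum (h : InversePair L f g) (hσ : -(1 / 2) < σ) (hr : 0 < r) (hs : 0 < s) :
    (count L f σ τ r s : ℝ) ≤ r * s * ∑ j ∈ Finset.Icc 1 ⌊L * r / s + σ⁻⌋₊,
      f ((j - σ⁻) * s / r) + τ⁻ * ⌊L * r / s + σ⁻⌋₊ := by
  have hu := negPart_nonneg' σ
  have hv := negPart_nonneg' τ
  have hu2 := negPart_lt_half hσ
  have hb := (columns_bounds hr hs hu h.L_pos).1
  set n := ⌊L * r / s + σ⁻⌋₊ with hn
  set Y : ℕ → ℝ := fun j => r * s * f ((j - σ⁻) * s / r) with hY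
  have hx : ∀ j : ℕ, 1 ≤ j → 0 ≤ ((j : ℝ) - σ⁻) * s / r := by
    intro j hj
    have : (1 : ℝ) ≤ j := by exact_mod_cast hj
    have : 0 ≤ (j : ℝ) - σ⁻ := by linarith
    positivity
  have hsub : enclosedPoints L f σ τ r s ⊆
      {p : ℕ × ℕ | p.1 ∈ Finset.Icc 1 n ∧ 1 ≤ p.2 ∧ (p.2 : ℝ) + -τ⁻ ≤ Y p.1} := by
    rintro ⟨j, k⟩ ⟨hj, hk, h1, h2⟩
    simp only at hj hk h1 h2
    have h3 : ((j : ℝ) - σ⁻) * s / r ≤ ((j : ℝ) + σ) * s / r := by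
      have := neg_le_negPart σ
      gcongr
      linarith
    have h4 : f (((j : ℝ) + σ) * s / r) ≤ f (((j : ℝ) - σ⁻) * s / r) :=
      h.antitoneOn ⟨hx j hj, h3.trans h1⟩ ⟨(hx j hj).trans h3, h1⟩ h3
    refine ⟨Finset.mem_Icc.2 ⟨hj, ?_⟩, hk, ?_⟩
    · apply Nat.le_floor
      have h5 := h3.trans h1
      rw [div_le_iff₀ hr, ← le_div_iff₀ hs] at h5
      linarith
    · have h5 := neg_le_negPart τ
      have h6 : r * s * f (((j : ℝ) + σ) * s / r) ≤ r * s * f (((j : ℝ) - σ⁻) * s / r) := by gcongr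
      simp only [hY]
      linarith
  have hcol := ncard_columns (Finset.Icc 1 n) (-τ⁻) Y
  have h1 : count L f σ τ r s ≤ ∑ j ∈ Finset.Icc 1 n, ⌊Y j - -τ⁻⌋₊ := by
    rw [← hcol.2]
    exact Set.ncard_le_ncard hsub hcol.1
  have h2 : (count L f σ τ r s : ℝ) ≤ ∑ j ∈ Finset.Icc 1 n, (⌊Y j - -τ⁻⌋₊ : ℝ) := by
    exact_mod_cast h1
  refine h2.trans ?_
  have h3 : ∀ j ∈ Finset.Icc 1 n, (⌊Y j - -τ⁻⌋₊ : ℝ) ≤ Y j + τ⁻ := by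
    intro j hj
    rw [Finset.mem_Icc] at hj
    have h4 : ((j : ℝ) - σ⁻) * s / r ≤ L := by
      refine le_trans ?_ hb
      have : (j : ℝ) ≤ n := by exact_mod_cast hj.2
      gcongr
    have h5 := (h.mapsTo ⟨hx j hj.1, h4⟩).1
    have h6 : 0 ≤ Y j := by simp only [hY]; positivity
    rw [sub_neg_eq_add]
    exact Nat.floor_le (by linarith)
  refine (Finset.sum_le_sum h3).trans_eq ?_
  rw [Finset.sum_add_distrib, Finset.sum_const, Nat.card_Icc, nsmul_eq_mul, Finset.mul_sum,
    Nat.add_sub_cancel, mul_comm (n : ℝ)]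

lemma count_le_of_sum_le (h : InversePair L f g) (hσ : -(1 / 2) < σ) (hr : 0 < r) (hs : 0 < s)
    {A G : ℝ} (hG : s / r * ∑ j ∈ Finset.Icc 1 ⌊L * r / s + σ⁻⌋₊, f ((j - σ⁻) * (s / r))
      ≤ A - s / r * G) :
    (count L f σ τ r s : ℝ) ≤ r ^ 2 * A - G * (r * s) + τ⁻ * ⌊L * r / s + σ⁻⌋₊ := by
  have hle := count_le_sum (τ := τ) h hσ hr hs
  simp only [mul_div_assoc _ s r] at hle
  have h4 := mul_le_mul_of_nonneg_left hG (sq_nonneg r)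
  have e1 : r ^ 2 * (s / r * ∑ j ∈ Finset.Icc 1 ⌊L * r / s + σ⁻⌋₊, f ((j - σ⁻) * (s / r)))
      = r * s * ∑ j ∈ Finset.Icc 1 ⌊L * r / s + σ⁻⌋₊, f ((j - σ⁻) * (s / r)) := by
    field_simp
  have e2 : r ^ 2 * (A - s / r * G) = r ^ 2 * A - G * (r * s) := by
    field_simp
  rw [e1, e2] at h4
  linarith

lemma negPart_mul_floor_le (hL : 0 < L) (hσ : -(1 / 2) < σ) (hτ : -(1 / 2) < τ) (hr : 0 < r)
    (hs : 1 ≤ s) : τ⁻ * ⌊L * r / s + σ⁻⌋₊ ≤ τ⁻ * L * (r * s) + 1 := by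
  have hu := negPart_nonneg' σ
  have hv := negPart_nonneg' τ
  have hu2 := negPart_lt_half hσ
  have hv2 := negPart_lt_half hτ
  have hs0 : 0 < s := by linarith
  have hfl := Nat.floor_le (show 0 ≤ L * r / s + σ⁻ by positivity)
  have h8 : L * r / s ≤ L * (r * s) := by
    rw [div_le_iff₀ hs0]
    calc L * r = L * r * (1 * 1) := by ring
      _ ≤ L * r * (s * s) := by gcongr
      _ = _ := by ring
  have h7 : τ⁻ * σ⁻ ≤ 1 * 1 := by gcongr <;> linarith
  calc τ⁻ * ⌊L * r / s + σ⁻⌋₊ ≤ τ⁻ * (L * (r * s) + σ⁻) := by gcongr; linarith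
    _ ≤ _ := by linarith

lemma exists_point_of_count_pos (h : InversePair L f g) (hσ : -(1 / 2) < σ) (hτ : -(1 / 2) < τ)
    (hr : 0 < r) (hs : 0 < s) (hN : 0 < count L f σ τ r s) : 1 ≤ ⌊L * r / s + σ⁻⌋₊ := by
  obtain ⟨⟨j, k⟩, hj, hk, h1, h2⟩ :=
    (Set.ncard_pos (enclosedPoints_finite h hσ hτ hr hs)).1 hN
  simp only at hj hk h1 h2
  have h3 : (1 : ℝ) ≤ j := by exact_mod_cast hj
  have h4 := neg_le_negPart σ
  apply Nat.le_floor
  rw [div_le_iff₀ hr, ← le_div_iff₀ hs] at h1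
  push_cast
  linarith

lemma ConcaveOn.trapezoid_le_integral {S : Set ℝ} {H : ℝ → ℝ} (hH : ConcaveOn ℝ S H) {u v : ℝ}
    (hu : u ∈ S) (hv : v ∈ S) (huv : u < v) (hint : IntervalIntegrable H volume u v) :
    (v - u) * (H u + H v) / 2 ≤ ∫ x in u..v, H x := by
  have h := affine_le_integral (A := H u) (B := (H v - H u) / (v - u)) huv.le hint fun x hx => by
    have := le_chord (neg_convexOn_iff.2 hH) hu hv huv hx.1 hx.2
    simp only [Pi.neg_apply] at this
    have e : (-H v - -H u) / (v - u) * (x - u) = -((H v - H u) / (v - u) * (x - u)) := by ring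
    linarith
  refine le_trans (le_of_eq ?_) h
  have : v - u ≠ 0 := by linarith
  field_simp
  ring

/-- For concave curves the trapezoidal sums are at most the area. -/
lemma sum_le_area_of_concaveOn (h : InversePair L f g) (hc : ConcaveOn ℝ (Icc 0 L) f) {u d : ℝ}
    (hu : 0 ≤ u) (hu1 : u < 1) (hd : 0 < d) {n : ℕ} (hn : 1 ≤ n) (hnL : (n - u) * d ≤ L) :
    d * ∑ j ∈ Finset.Icc 1 n, f ((j - u) * d)
      ≤ area L f - d / 2 * ((1 - 2 * u) * L - f ((n - u) * d)) := by
  have hx : ∀ j : ℕ, 1 ≤ j → j ≤ n → (j - u) * d ∈ Icc 0 L := by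
    intro j hj hjn
    have h1 : (1 : ℝ) ≤ j := by exact_mod_cast hj
    have h2 : (j : ℝ) ≤ n := by exact_mod_cast hjn
    refine ⟨mul_nonneg (by linarith) hd.le, le_trans ?_ hnL⟩
    gcongr
  have claim : ∀ m : ℕ, 1 ≤ m → m ≤ n → d * ∑ j ∈ Finset.Icc 1 m, f ((j - u) * d)
      - d * (f ((1 - u) * d) + f ((m - u) * d)) / 2
      ≤ ∫ x in ((1 - u) * d)..((m - u) * d), f x := by
    intro m hm
    induction m, hm using Nat.le_induction with
    | base => intro _; simp; linarith
    | succ m hm ih =>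
      intro hmn
      have h1 := hx 1 le_rfl (by omega)
      have h2 := hx m hm (by omega)
      have h3 := hx (m + 1) (by omega) hmn
      have hm' : (1 : ℝ) ≤ m := by exact_mod_cast hm
      have h5 : ((m : ℝ) - u) * d < ((m + 1 : ℕ) - u) * d := by push_cast; nlinarith
      have h6 := ConcaveOn.trapezoid_le_integral hc h2 h3 h5
        (h.intervalIntegrable h2.1 h5.le h3.2)
      have h7 := ih (by omega)
      rw [Finset.sum_Icc_succ_top (by omega)]
      have h1' : (1 - u) * d ∈ Icc 0 L := by simpa using h1
      have h8 : (1 - u) * d ≤ (m - u) * d := by gcongr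
      rw [← intervalIntegral.integral_add_adjacent_intervals
        (h.intervalIntegrable h1'.1 h8 h2.2) (h.intervalIntegrable h2.1 h5.le h3.2)]
      push_cast at h6 ⊢
      have e : ((m : ℝ) + 1 - u) * d - (m - u) * d = d := by ring
      rw [e] at h6
      linarith
  have h1 : (1 - u) * d ∈ Icc 0 L := by simpa using hx 1 le_rfl hn
  have hnn := hx n hn le_rfl
  have h2 := claim n hn le_rfl
  have h10 : 0 < (1 - u) * d := mul_pos (by linarith) hd
  have hn' : (1 : ℝ) ≤ n := by exact_mod_cast hn
  have h8 : (1 - u) * d ≤ (n - u) * d := by gcongr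
  -- Inscribed trapezoids lie below the curve. The first, of width (1 - u)d and left height L,
  -- supplies the gain in L; the area beyond the last column is discarded.
  have h3 := ConcaveOn.trapezoid_le_integral hc h.zero_mem h1 h10
    (h.intervalIntegrable le_rfl h10.le h1.2)
  have h4 : 0 ≤ ∫ x in ((n - u) * d)..L, f x :=
    intervalIntegral.integral_nonneg hnL fun x hx => (h.mapsTo ⟨hnn.1.trans hx.1, hx.2⟩).1
  have h5 : area L f = (∫ x in 0..((1 - u) * d), f x)
      + (∫ x in ((1 - u) * d)..((n - u) * d), f x) + ∫ x in ((n - u) * d)..L, f x := by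
    rw [intervalIntegral.integral_add_adjacent_intervals
      (h.intervalIntegrable le_rfl h1.1 h1.2) (h.intervalIntegrable h1.1 h8 hnn.2),
      intervalIntegral.integral_add_adjacent_intervals
      (h.intervalIntegrable le_rfl hnn.1 hnn.2) (h.intervalIntegrable hnn.1 hnn.2 le_rfl)]
    rfl
  rw [h.map_zero, sub_zero] at h3
  have h6 := (h.mapsTo h1).2
  have h7 : u * f ((1 - u) * d) ≤ u * L := by gcongr
  have h9 : d * (u * f ((1 - u) * d)) ≤ d * (u * L) := by gcongr
  rw [h5]
  linarith

/-- (n - u)/(n + 1 - u) increases with n, so its least value is at n = 1. The last column thus lies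
to the right of the point where the parameter condition evaluates f. -/
lemma first_point_le {u n d : ℝ} (hu1 : u < 1) (hn : 1 ≤ n) (hd : 0 ≤ d)
    (hL : L ≤ (n + 1 - u) * d) : (1 - u) / (2 - u) * L ≤ (n - u) * d := by
  have h2 : (1 - u) * L ≤ (1 - u) * ((n + 1 - u) * d) := by
    have : 0 < 1 - u := by linarith
    gcongr
  have h3 : 0 ≤ (n - 1) * d := mul_nonneg (by linarith) hd
  rw [div_mul_eq_mul_div, div_le_iff₀ (by linarith)]
  linarith

/-- Two-term upper bound for the counting function of a concave curve. -/
theorem exists_count_le_of_concaveOn (h : InversePair L f g) (hσ : -(1 / 2) < σ)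
    (hτ : -(1 / 2) < τ) (hc : ConcaveOn ℝ (Icc 0 L) f)
    (hM : f ((1 - σ⁻) / (2 - σ⁻) * L) < 2 * (1 / 2 - σ⁻ - τ⁻) * L) :
    ∃ c, 0 < c ∧ ∀ r s : ℝ, 0 < r → 1 ≤ s → 0 < count L f σ τ r s →
      (count L f σ τ r s : ℝ) ≤ r ^ 2 * area L f - c * (r * s) + 1 := by
  have hu := negPart_nonneg' σ
  have hv := negPart_nonneg' τ
  have hu2 := negPart_lt_half hσ
  have hv2 := negPart_lt_half hτ
  -- The trapezoidal gain less the loss τ⁻L from the vertical shift; its positivity is the parameter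
  -- condition.
  refine ⟨((1 - 2 * σ⁻ - 2 * τ⁻) * L - f ((1 - σ⁻) / (2 - σ⁻) * L)) / 2, by linarith, ?_⟩
  intro r s hr hs1 hN
  have hs : 0 < s := by linarith
  have hn := exists_point_of_count_pos h hσ hτ hr hs hN
  have hvn := negPart_mul_floor_le h.L_pos hσ hτ hr hs1
  obtain ⟨hb1, hb2⟩ := columns_bounds hr hs hu h.L_pos
  have hd : 0 < s / r := by positivity
  have hrs : 0 < r * s := by positivity
  simp only [mul_div_assoc _ s r] at hb1 hb2
  have h1 := count_le_of_sum_le (τ := τ) h hσ hr hs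
    ((sum_le_area_of_concaveOn h hc hu (by linarith) hd hn hb1).trans_eq
      (by rw [div_mul_eq_mul_div, mul_div_assoc]))
  have hn' : (1 : ℝ) ≤ ⌊L * r / s + σ⁻⌋₊ := by exact_mod_cast hn
  have hk := first_point_le (by linarith) hn' hd.le hb2.le
  have hk0 : 0 ≤ (1 - σ⁻) / (2 - σ⁻) * L :=
    mul_nonneg (div_nonneg (by linarith) (by linarith)) h.L_pos.le
  have h3 := h.antitoneOn ⟨hk0, hk.trans hb1⟩ ⟨hk0.trans hk, hb1⟩ hk
  have h5 := mul_le_mul_of_nonneg_right h3 hrs.le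
  linarith

/-! ### Upper bound for the count: convex curves. -/

/-- The extension by zero of a curve beyond its intercept. -/
noncomputable def extendZero (L : ℝ) (f : ℝ → ℝ) (x : ℝ) : ℝ := f (min x L)

lemma extendZero_eq {x : ℝ} (hx : x ≤ L) : extendZero L f x = f x := by
  rw [extendZero, min_eq_left hx]

section Convex

variable (h : InversePair L f g)
include h

lemma extendZero_eq_zero {x : ℝ} (hx : L ≤ x) : extendZero L f x = 0 := by
  rw [extendZero, min_eq_right hx, h.map_L]

lemma min_mem {x : ℝ} (hx : 0 ≤ x) : min x L ∈ Icc 0 L :=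
  ⟨le_min hx h.L_pos.le, min_le_right _ _⟩

lemma extendZero_nonneg {x : ℝ} (hx : 0 ≤ x) : 0 ≤ extendZero L f x :=
  (h.mapsTo (min_mem h hx)).1

lemma extendZero_antitoneOn : AntitoneOn (extendZero L f) (Ici 0) := fun _ hx _ hy hxy =>
  h.antitoneOn (min_mem h hx) (min_mem h hy) (min_le_min_right L hxy)

/-- Truncation x ↦ min x L is concave, and a decreasing convex function of a concave one is convex.
Secants may thus reach past L. -/
lemma extendZero_convexOn (hc : ConvexOn ℝ (Icc 0 L) f) :
    ConvexOn ℝ (Ici 0) (extendZero L f) := by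
  refine ⟨convex_Ici 0, fun x hx y hy a b ha hb hab => ?_⟩
  simp only [smul_eq_mul]
  have hx' := min_mem h hx
  have hy' := min_mem h hy
  have h1 := hc.2 hx' hy' ha hb hab
  simp only [smul_eq_mul] at h1
  refine le_trans ?_ h1
  have hz : 0 ≤ a * x + b * y := add_nonneg (mul_nonneg ha hx) (mul_nonneg hb hy)
  have hm : a * min x L + b * min y L ≤ min (a * x + b * y) L := by
    apply le_min
    · gcongr
      · exact min_le_left _ _
      · exact min_le_left _ _
    · have h2 := mul_le_mul_of_nonneg_left hx'.2 ha
      have h3 := mul_le_mul_of_nonneg_left hy'.2 hb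
      have : a * L + b * L = L := by rw [← add_mul, hab, one_mul]
      linarith
  have h0 : 0 ≤ a * min x L + b * min y L :=
    add_nonneg (mul_nonneg ha hx'.1) (mul_nonneg hb hy'.1)
  exact h.antitoneOn ⟨h0, hm.trans (min_le_right _ _)⟩ (min_mem h hz) hm

lemma extendZero_intervalIntegrable {u v : ℝ} (hu : 0 ≤ u) (huv : u ≤ v) :
    IntervalIntegrable (extendZero L f) volume u v := by
  apply AntitoneOn.intervalIntegrable
  rw [uIcc_of_le huv]
  exact (extendZero_antitoneOn h).mono fun x hx => hu.trans hx.1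

lemma integral_extendZero_le {u : ℝ} (hu : 0 ≤ u) :
    ∫ x in (0 : ℝ)..u, extendZero L f x ≤ area L f := by
  have h1 : ∫ x in (0 : ℝ)..(max u L), extendZero L f x = area L f := by
    rw [← intervalIntegral.integral_add_adjacent_intervals
      (extendZero_intervalIntegrable h le_rfl h.L_pos.le)
      (extendZero_intervalIntegrable h h.L_pos.le (le_max_right u L))]
    have h2 : ∫ x in L..(max u L), extendZero L f x = 0 := by
      rw [intervalIntegral.integral_congr (g := fun _ => (0 : ℝ))]
      · simp
      · intro x hx
        rw [uIcc_of_le (le_max_right u L)] at hx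
        exact extendZero_eq_zero h hx.1
    have h3 : ∫ x in (0 : ℝ)..L, extendZero L f x = area L f := by
      rw [area]
      apply intervalIntegral.integral_congr
      intro x hx
      rw [uIcc_of_le h.L_pos.le] at hx
      exact extendZero_eq hx.2
    rw [h2, h3, add_zero]
  rw [← h1, ← intervalIntegral.integral_add_adjacent_intervals
    (extendZero_intervalIntegrable h le_rfl hu)
    (extendZero_intervalIntegrable h hu (le_max_left u L))]
  have : 0 ≤ ∫ x in u..(max u L), extendZero L f x :=
    intervalIntegral.integral_nonneg (le_max_left u L) fun x hx =>
      extendZero_nonneg h (hu.trans hx.1)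
  linarith

/-- Rectangles under a convex curve have at most half the area. -/
lemma two_mul_mul_le_area (hc : ConvexOn ℝ (Icc 0 L) f) {x : ℝ} (hx : x ∈ Icc 0 L) :
    2 * x * f x ≤ area L f := by
  have hF := extendZero_convexOn h hc
  have hx0 : 0 ≤ 2 * x := by linarith [hx.1]
  have hi := extendZero_intervalIntegrable h le_rfl hx0
  have h1 := integral_extendZero_le h hx0
  have h2 : ∫ y in (0 : ℝ)..(2 * x), extendZero L f (2 * x - y)
      = ∫ y in (0 : ℝ)..(2 * x), extendZero L f y := by
    rw [intervalIntegral.integral_comp_sub_left (fun y => extendZero L f y) (2 * x)]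
    simp
  have hi2 : IntervalIntegrable (fun y => extendZero L f (2 * x - y)) volume 0 (2 * x) := by
    have := (hi.comp_sub_left (2 * x)).symm
    simpa using this
  -- Convexity about the midpoint x gives F(y) + F(2x - y) ≥ 2F(x), which is integrated over [0,
  -- 2x].
  have h3 := affine_le_integral (A := 2 * f x) (B := 0) hx0 (hi.add hi2) fun y hy => by
    have h4 := convexOn_second_diff_nonneg hF (x := y) (t := x - y) hy.1
      (by have := hy.2; simp only [mem_Ici]; linarith)
    rw [show y + (x - y) = x by ring, show y + 2 * (x - y) = 2 * x - y by ring,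
      extendZero_eq hx.2] at h4
    linarith
  have h5 : ∫ y in (0 : ℝ)..(2 * x), (extendZero L f y + extendZero L f (2 * x - y))
      = 2 * ∫ y in (0 : ℝ)..(2 * x), extendZero L f y := by
    rw [intervalIntegral.integral_add hi hi2, h2]
    ring
  rw [h5] at h3
  linarith

lemma area_pos (hc : ConvexOn ℝ (Icc 0 L) f) : 0 < area L f := by
  have hL := h.L_pos
  have hm : L / 2 ∈ Icc 0 L := ⟨by linarith, by linarith⟩
  have h1 := two_mul_mul_le_area h hc hm
  have h2 := h.strictAntiOn hm h.L_mem (by linarith)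
  rw [h.map_L] at h2
  have : 0 < 2 * (L / 2) * f (L / 2) := by positivity
  linarith

/-- To the left of y the function lies above the line through its points at y and y + d. The second
summand is the triangle gained over the rectangle of height F(y). -/
lemma secant_le_integral (hc : ConvexOn ℝ (Icc 0 L) f) {x y d : ℝ} (hx : 0 ≤ x) (hxy : x ≤ y)
    (hd : 0 < d) :
    (y - x) * extendZero L f y
      + (y - x) ^ 2 * (extendZero L f y - extendZero L f (y + d)) / (2 * d)
      ≤ ∫ z in x..y, extendZero L f z := by
  have hF := extendZero_convexOn h hc
  set F := extendZero L f
  have h1 := affine_le_integral (A := F y + (F (y + d) - F y) / d * (x - y))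
    (B := (F (y + d) - F y) / d) hxy (extendZero_intervalIntegrable h hx hxy) fun z hz => by
      have := chord_le_left hF (x := z) (u := y) (v := y + d) (hx.trans hz.1)
        (by simp only [mem_Ici]; linarith) hz.2 (by linarith)
      rw [add_sub_cancel_left] at this
      linarith
  refine le_trans (le_of_eq ?_) h1
  field_simp
  ring

/-- Comparison of lower sums with the area under a convex curve. -/
lemma sum_le_area_of_convexOn (hc : ConvexOn ℝ (Icc 0 L) f) {u d : ℝ}
    (hu : 0 ≤ u) (hu1 : u < 1) (hd : 0 < d) {n : ℕ} (hn : 1 ≤ n) (hnL : (n - u) * d ≤ L)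
    (hnL' : L < (n + 1 - u) * d) :
    d * ∑ j ∈ Finset.Icc 1 n, f ((j - u) * d)
      ≤ area L f - d * ((1 - u) / 2 * f ((1 - u) * d) - u * L) := by
  have hF := extendZero_convexOn h hc
  set F := extendZero L f with hFdef
  -- The triangles above successive rectangles telescope; at m = n the far value F((n + 1 - u)d)
  -- vanishes.
  have claim : ∀ m : ℕ, 1 ≤ m → d * ∑ j ∈ Finset.Icc 1 m, F ((j - u) * d)
      - d * F ((1 - u) * d) + d * (F ((2 - u) * d) - F ((m + 1 - u) * d)) / 2
      ≤ ∫ x in ((1 - u) * d)..((m - u) * d), F x := by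
    intro m hm
    induction m, hm using Nat.le_induction with
    | base => norm_num
    | succ m hm ih =>
      have hm' : (1 : ℝ) ≤ m := by exact_mod_cast hm
      have h0 : 0 ≤ (1 - u) * d := mul_nonneg (by linarith) hd.le
      have h2 : 0 ≤ ((m : ℝ) - u) * d := mul_nonneg (by linarith) hd.le
      have h8 : (1 - u) * d ≤ (m - u) * d := by gcongr
      have h5 : ((m : ℝ) - u) * d ≤ (m + 1 - u) * d := by nlinarith
      have h6 := secant_le_integral h hc h2 h5 hd
      rw [Finset.sum_Icc_succ_top (by omega)]
      push_cast
      rw [← intervalIntegral.integral_add_adjacent_intervals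
        (extendZero_intervalIntegrable h h0 h8) (extendZero_intervalIntegrable h h2 h5)]
      rw [show ((m : ℝ) + 1 - u) * d - (m - u) * d = d by ring,
        show ((m : ℝ) + 1 - u) * d + d = (m + 1 + 1 - u) * d by ring, ← hFdef] at h6
      have e : d ^ 2 * (F ((m + 1 - u) * d) - F ((m + 1 + 1 - u) * d)) / (2 * d)
          = d * (F ((m + 1 - u) * d) - F ((m + 1 + 1 - u) * d)) / 2 := by
        field_simp
      rw [e] at h6
      linarith
  have hn' : (1 : ℝ) ≤ n := by exact_mod_cast hn
  have h1 : 0 ≤ (1 - u) * d := mul_nonneg (by linarith) hd.le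
  have hnn : 0 ≤ ((n : ℝ) - u) * d := mul_nonneg (by linarith) hd.le
  have h8 : (1 - u) * d ≤ (n - u) * d := by gcongr
  have h2 := claim n hn
  have h3 := secant_le_integral h hc le_rfl h1 hd
  have h4 := integral_extendZero_le h hnn
  rw [← intervalIntegral.integral_add_adjacent_intervals
    (extendZero_intervalIntegrable h le_rfl h1) (extendZero_intervalIntegrable h h1 h8)] at h4
  have h5 : F ((n + 1 - u) * d) = 0 := extendZero_eq_zero h hnL'.le
  have h6 : ∑ j ∈ Finset.Icc 1 n, F ((j - u) * d) = ∑ j ∈ Finset.Icc 1 n, f ((j - u) * d) := by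
    refine Finset.sum_congr rfl fun j hj => extendZero_eq (le_trans ?_ hnL)
    have : (j : ℝ) ≤ n := by exact_mod_cast (Finset.mem_Icc.1 hj).2
    gcongr
  have h7 : F ((1 - u) * d) = f ((1 - u) * d) := extendZero_eq (h8.trans hnL)
  have h9 : (1 - u) * d < (1 - u) * d + d := by linarith
  have h10 := chord_le_left hF (x := 0) (u := (1 - u) * d) (v := (1 - u) * d + d)
    (by simp) (by simp only [mem_Ici]; linarith) h1 h9
  have h11 : F 0 = L := by rw [hFdef, extendZero_eq h.L_pos.le, h.map_zero]
  rw [← hFdef, sub_zero, show (1 - u) * d + d = (2 - u) * d by ring] at h3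
  rw [h11, show (1 - u) * d + d - (1 - u) * d = d by ring,
    show (1 - u) * d + d = (2 - u) * d by ring] at h10
  have e1 : (F ((2 - u) * d) - F ((1 - u) * d)) / d * (0 - (1 - u) * d)
      = (1 - u) * (F ((1 - u) * d) - F ((2 - u) * d)) := by
    field_simp
    ring
  have e2 : ((1 - u) * d) ^ 2 * (F ((1 - u) * d) - F ((2 - u) * d)) / (2 * d)
      = d * ((1 - u) ^ 2 * (F ((1 - u) * d) - F ((2 - u) * d)) / 2) := by
    field_simp
  rw [e1] at h10
  rw [e2] at h3
  rw [h5, h6] at h2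
  rw [← h7]
  have h12 : 0 ≤ F ((2 - u) * d) := extendZero_nonneg h (mul_nonneg (by linarith) hd.le)
  set a1 := F ((1 - u) * d)
  set a2 := F ((2 - u) * d)
  have h13 : a2 ≤ a1 := extendZero_antitoneOn h h1 (mem_Ici.2 (mul_nonneg (by linarith) hd.le))
    (by nlinarith)
  have h14 : (1 - u) / 2 * a1 - u * L ≤ -u * a1 + (1 - u) ^ 2 * (a1 - a2) / 2 + a2 / 2 := by
    have h15 : u * ((1 - u) * (a1 - a2)) ≤ u * (L - a1) :=
      mul_le_mul_of_nonneg_left (by linarith) hu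
    have h16 : 0 ≤ u * (1 - u) * (a1 - a2) :=
      mul_nonneg (mul_nonneg hu (by linarith)) (by linarith)
    have h17 : 0 ≤ u * a2 := mul_nonneg hu h12
    nlinarith
  have h18 := mul_le_mul_of_nonneg_left h14 hd.le
  linarith

/-- Serves the case of a single column, where f may be nearly zero. That column takes at most the
fraction 1/(2(1 - u)) < 1 of the area, and since d ≤ 2L the fixed saving dominates a multiple of d.
-/
lemma mul_map_le_area_of_convexOn (hc : ConvexOn ℝ (Icc 0 L) f) {u d : ℝ}
    (hu1 : u < 1 / 2) (hd : 0 < d) (hb : (1 - u) * d ≤ L) :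
    d * f ((1 - u) * d)
      ≤ area L f - area L f * (1 - 2 * u) / (2 * (1 - u)) / (2 * L) * d := by
  have hA := area_pos h hc
  have hL := h.L_pos
  have hu' : 0 < 1 - u := by linarith
  have h1 : 0 ≤ (1 - u) * d := mul_nonneg hu'.le hd.le
  have h2 := two_mul_mul_le_area h hc ⟨h1, hb⟩
  have h3 : d * f ((1 - u) * d) ≤ area L f / (2 * (1 - u)) := by
    rw [le_div_iff₀ (by linarith)]
    linarith
  have h4 : d / (2 * L) ≤ 1 := by
    rw [div_le_one (by linarith)]
    nlinarith
  have h5 : 0 ≤ area L f * (1 - 2 * u) / (2 * (1 - u)) :=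
    div_nonneg (mul_nonneg hA.le (by linarith)) (by linarith)
  have h6 := mul_le_mul_of_nonneg_left h4 h5
  have e : area L f * (1 - 2 * u) / (2 * (1 - u)) = area L f - area L f / (2 * (1 - u)) := by
    field_simp
    ring
  have e2 : area L f * (1 - 2 * u) / (2 * (1 - u)) / (2 * L) * d
      = area L f * (1 - 2 * u) / (2 * (1 - u)) * (d / (2 * L)) := by ring
  rw [e2]
  linarith

/-- Two-term upper bound for the counting function of a convex curve. -/
theorem exists_count_le_of_convexOn (hσ : -(1 / 2) < σ)
    (hτ : -(1 / 2) < τ) (hc : ConvexOn ℝ (Icc 0 L) f)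
    (hM : 2 * (σ⁻ + τ⁻) * L < (1 - σ⁻) * f ((1 - σ⁻) / (2 - σ⁻) * L)) :
    ∃ c, 0 < c ∧ ∀ r s : ℝ, 0 < r → 1 ≤ s → 0 < count L f σ τ r s →
      (count L f σ τ r s : ℝ) ≤ r ^ 2 * area L f - c * (r * s) + 1 := by
  have hu := negPart_nonneg' σ
  have hv := negPart_nonneg' τ
  have hu2 := negPart_lt_half hσ
  have hv2 := negPart_lt_half hτ
  have hL := h.L_pos
  have hA := area_pos h hc
  set c1 := (1 - σ⁻) / 2 * f ((1 - σ⁻) / (2 - σ⁻) * L) - σ⁻ * L - τ⁻ * L with hc1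
  set c2 := area L f * (1 - 2 * σ⁻) / (2 * (1 - σ⁻)) / (2 * L) with hc2
  have hc1pos : 0 < c1 := by linarith
  have hc2pos : 0 < c2 :=
    div_pos (div_pos (mul_pos hA (by linarith)) (by linarith)) (by linarith)
  refine ⟨min c1 c2, lt_min hc1pos hc2pos, ?_⟩
  intro r s hr hs1 hN
  have hs : 0 < s := by linarith
  have hn := exists_point_of_count_pos h hσ hτ hr hs hN
  obtain ⟨hb1, hb2⟩ := columns_bounds hr hs hu h.L_pos
  have hd : 0 < s / r := by positivity
  have hrs : 0 < r * s := by positivity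
  simp only [mul_div_assoc _ s r] at hb1 hb2
  -- With at least two columns, (2 - σ⁻)s/r ≤ L puts the first abscissa to the left of the point in
  -- the parameter condition, so f there is large enough. One column needs the separate argument.
  rcases hn.eq_or_lt with hn1 | hn2
  · rw [← hn1, Nat.cast_one] at hb1
    have h1 := count_le_of_sum_le (τ := τ) (A := area L f) (G := c2) h hσ hr hs (by
      rw [← hn1, Finset.Icc_self, Finset.sum_singleton, Nat.cast_one, mul_comm (s / r) c2, hc2]
      exact mul_map_le_area_of_convexOn h hc hu2 hd hb1)
    rw [← hn1, Nat.cast_one] at h1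
    have h6 : min c1 c2 * (r * s) ≤ c2 * (r * s) :=
      mul_le_mul_of_nonneg_right (min_le_right _ _) hrs.le
    linarith
  · have hvn := negPart_mul_floor_le h.L_pos hσ hτ hr hs1
    have h1 := count_le_of_sum_le (τ := τ) h hσ hr hs
      (sum_le_area_of_convexOn h hc hu (by linarith) hd hn hb1 hb2)
    have hn' : (2 : ℝ) ≤ ⌊L * r / s + σ⁻⌋₊ := by exact_mod_cast hn2
    have hk : (1 - σ⁻) * (s / r) ≤ (1 - σ⁻) / (2 - σ⁻) * L := by
      have h2 : (2 - σ⁻) * (s / r) ≤ L := by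
        refine le_trans ?_ hb1
        gcongr
      rw [div_mul_eq_mul_div, le_div_iff₀ (by linarith)]
      have := mul_le_mul_of_nonneg_left h2 (show 0 ≤ 1 - σ⁻ by linarith)
      linarith
    have hkL : (1 - σ⁻) / (2 - σ⁻) * L ≤ L :=
      mul_le_of_le_one_left hL.le ((div_le_one (by linarith)).2 (by linarith))
    have hk0 : 0 ≤ (1 - σ⁻) * (s / r) := mul_nonneg (by linarith) hd.le
    have h3 := h.antitoneOn ⟨hk0, hk.trans hkL⟩ ⟨hk0.trans hk, hkL⟩ hk
    have h5 : (1 - σ⁻) / 2 * f ((1 - σ⁻) / (2 - σ⁻) * L)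
        ≤ (1 - σ⁻) / 2 * f ((1 - σ⁻) * (s / r)) :=
      mul_le_mul_of_nonneg_left h3 (by linarith)
    have h5' := mul_le_mul_of_nonneg_right h5 hrs.le
    have h9 : min c1 c2 * (r * s) ≤ c1 * (r * s) :=
      mul_le_mul_of_nonneg_right (min_le_left _ _) hrs.le
    rw [hc1] at h9
    linarith

end Convex

end ShiftedLattice

namespace ShiftedLattice

/-! ### Uniform two-term asymptotics. -/

variable {L : ℝ} {f g : ℝ → ℝ} {σ τ : ℝ} {c C K : ℝ}

lemma SmoothConcavePiece.exists_curved {a : ℝ} (ha : 0 < a) (h : SmoothConcavePiece f a) :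
    ∃ c C K, Curved (-f) 0 a c C K := by
  refine ShiftedLattice.exists_curved ha h.contDiffOn.neg fun x hx => ?_
  rw [iteratedDerivWithin_neg]
  linarith [h.deriv2_neg x hx]

lemma SmoothConvexPiece.exists_curved {a : ℝ} (ha : a < L) (h : SmoothConvexPiece f a L) :
    ∃ c C K, Curved f a L c C K :=
  ShiftedLattice.exists_curved ha h.contDiffOn h.deriv2_pos

lemma natFloor_eq_sub_sawtooth {x : ℝ} (hx : 0 ≤ x) : (⌊x⌋₊ : ℝ) = x - 1 / 2 - sawtooth x := by
  rw [sawtooth, Int.fract, natCast_floor_eq_intCast_floor hx]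
  ring

lemma le_cube {ρ : ℝ} (hρ : 1 ≤ ρ) : ρ ≤ ρ ^ 3 := le_self_pow₀ hρ (by norm_num)

/-- Lattice points in the columns to the left of a point of a concave curve. -/
lemma exists_abs_left_sum_sub_le (h : InversePair L f g) (hσ : -(1 / 2) < σ) {a : ℝ} (ha : 0 < a)
    (haL : a ≤ L) (hfa : 0 < f a) (hf : Curved (-f) 0 a c C K) (τ : ℝ) {B : ℝ} (hB : 1 ≤ B) :
    ∃ D R, 0 ≤ D ∧ 1 ≤ R ∧ ∀ ρ s : ℝ, R ≤ ρ → B⁻¹ ≤ s → s ≤ B →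
      0 ≤ a * ρ ^ 3 / s - σ ∧
      |(∑ j ∈ Finset.Ioc 0 ⌊a * ρ ^ 3 / s - σ⌋₊, ⌊ρ ^ 3 * s * f ((j + σ) * s / ρ ^ 3) - τ⌋₊ : ℕ)
        - ((ρ ^ 3) ^ 2 * (∫ x in (0 : ℝ)..a, f x) - (σ + 1 / 2) * (ρ ^ 3 * s * L)
          - (τ + 1 / 2) * (a * ρ ^ 3 / s)
          - ρ ^ 3 * s * f a * sawtooth (a * ρ ^ 3 / s - σ))| ≤ D * ρ ^ 2 := by
  obtain ⟨D, hD, hcol⟩ := exists_abs_sum_floor_sub_le (Or.inr hf) σ τ hB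
  have hB0 : 0 < B := by linarith
  have hK := hf.K_nonneg
  have hσ' : 0 < 1 / 2 + σ := by linarith
  refine ⟨D + K * (1 / 2 + σ) ^ 2 * B ^ 2 + |(τ + 1 / 2) * (σ + 1 / 2)|,
    -- The second term makes the range of columns reach past 1/2. The third makes every height at
    -- least |τ|, so that truncated and integer floors agree.
    1 + B * (1 / 2 + σ) / a + B * |τ| / f a, by positivity, ?_, ?_⟩
  · have h1 : 0 ≤ B * (1 / 2 + σ) / a := by positivity
    have h2 : 0 ≤ B * |τ| / f a := by positivity
    linarith
  intro ρ s hR hsB hsB'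
  have hs : 0 < s := lt_of_lt_of_le (by positivity) hsB
  have hR1 : 0 ≤ B * (1 / 2 + σ) / a := by positivity
  have hR2 : 0 ≤ B * |τ| / f a := by positivity
  have hρ : 1 ≤ ρ := by linarith
  have hρ0 : 0 < ρ := by linarith
  have hρ3 := le_cube hρ
  have hr : 0 < ρ ^ 3 := by positivity
  have hρ1 : 1 ≤ ρ ^ 2 := one_le_pow₀ hρ
  have hx0 : (1 / 2 + σ) * s ≤ a * ρ ^ 3 := by
    have h1 : B * (1 / 2 + σ) / a ≤ ρ ^ 3 := by linarith
    rw [div_le_iff₀ ha] at h1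
    nlinarith
  have hpq : 1 / 2 ≤ a * ρ ^ 3 / s - σ := by
    rw [le_sub_iff_add_le, le_div_iff₀ hs]
    exact hx0
  have hend : (a * ρ ^ 3 / s - σ + σ) * s / ρ ^ 3 = a := by
    rw [sub_add_cancel]
    field_simp
  have hx1 : (1 / 2 + σ) * s / ρ ^ 3 ≤ a := by
    rw [div_le_iff₀ hr]
    exact hx0
  have hx2 : 0 ≤ (1 / 2 + σ) * s / ρ ^ 3 := by positivity
  -- Starting at p = 1/2 makes the left sawtooth term vanish and keeps j = 1 as first column, with
  -- starting abscissa positive exactly because σ > -1/2. The omitted strip up to that abscissa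
  -- yields the term -(σ + 1/2) r s L.
  have h1 := hcol ρ s (1 / 2) (a * ρ ^ 3 / s - σ) hρ hsB hsB' (by norm_num) hpq hx2 hend.le
  rw [hend] at h1
  have e0 : ⌊(1 / 2 : ℝ)⌋₊ = 0 := by
    rw [Nat.floor_eq_zero]
    norm_num
  have e1 : sawtooth (1 / 2) = 0 := by
    have : Int.fract (1 / 2 : ℝ) = 1 / 2 := Int.fract_eq_self.2 ⟨by norm_num, by norm_num⟩
    rw [sawtooth, this, sub_self]
  rw [e0, e1, mul_zero, add_zero] at h1
  refine ⟨by linarith, ?_⟩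
  have hpos : ∀ j ∈ Finset.Ioc 0 ⌊a * ρ ^ 3 / s - σ⌋₊,
      ((⌊ρ ^ 3 * s * f ((j + σ) * s / ρ ^ 3) - τ⌋₊ : ℕ) : ℝ)
        = (⌊ρ ^ 3 * s * f ((j + σ) * s / ρ ^ 3) - τ⌋ : ℝ) := by
    intro j hj
    rw [Finset.mem_Ioc] at hj
    apply natCast_floor_eq_intCast_floor
    have h2 : (j : ℝ) ≤ a * ρ ^ 3 / s - σ := (Nat.le_floor_iff' (by omega)).1 hj.2
    have h3 : ((j : ℝ) + σ) * s / ρ ^ 3 ≤ a := by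
      rw [div_le_iff₀ hr, ← le_div_iff₀ hs]
      linarith
    have h4 := add_pos_of_one_le hσ hj.1
    have h5 := h.antitoneOn ⟨by positivity, h3.trans haL⟩ ⟨ha.le, haL⟩ h3
    have h6 : B * |τ| / f a ≤ ρ ^ 3 := by linarith
    rw [div_le_iff₀ hfa] at h6
    have h7 : |τ| ≤ ρ ^ 3 * s * f a := by
      calc |τ| = B⁻¹ * (B * |τ|) := by field_simp
        _ ≤ s * (ρ ^ 3 * f a) := by gcongr
        _ = _ := by ring
    have h8 : ρ ^ 3 * s * f a ≤ ρ ^ 3 * s * f ((j + σ) * s / ρ ^ 3) := by gcongr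
    linarith [le_abs_self τ]
  push_cast
  rw [Finset.sum_congr rfl hpos]
  have hi : ∫ x in (0 : ℝ)..a, f x = (∫ x in (0 : ℝ)..((1 / 2 + σ) * s / ρ ^ 3), f x)
      + ∫ x in ((1 / 2 + σ) * s / ρ ^ 3)..a, f x :=
    (intervalIntegral.integral_add_adjacent_intervals
      (h.intervalIntegrable le_rfl hx2 (hx1.trans haL))
      (h.intervalIntegrable hx2 hx1 haL)).symm
  have h2 := abs_integral_sub_le (z := L) (K := K * ((1 / 2 + σ) * s / ρ ^ 3)) hx2
    (h.intervalIntegrable le_rfl hx2 (hx1.trans haL)) fun x hx => by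
      have h3 := hf.lipschitz x ⟨hx.1, hx.2.trans hx1⟩ 0 ⟨le_rfl, ha.le⟩
      simp only [Pi.neg_apply, h.map_zero, sub_zero] at h3
      rw [abs_of_nonneg hx.1] at h3
      rw [← abs_neg, neg_sub, show L - f x = -f x - -L by ring]
      refine h3.trans ?_
      have := hx.2
      gcongr
  rw [sub_zero] at h2
  have h3 := mul_le_mul_of_nonneg_left h2 (sq_nonneg (ρ ^ 3))
  rw [← abs_of_nonneg (sq_nonneg (ρ ^ 3)), ← abs_mul, abs_of_nonneg (sq_nonneg (ρ ^ 3))] at h3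
  have e2 : (ρ ^ 3) ^ 2 * ((∫ x in (0 : ℝ)..((1 / 2 + σ) * s / ρ ^ 3), f x)
      - (1 / 2 + σ) * s / ρ ^ 3 * L)
      = (ρ ^ 3) ^ 2 * (∫ x in (0 : ℝ)..((1 / 2 + σ) * s / ρ ^ 3), f x)
        - (σ + 1 / 2) * (ρ ^ 3 * s * L) := by
    field_simp
    ring
  have e3 : (ρ ^ 3) ^ 2 * ((1 / 2 + σ) * s / ρ ^ 3 * (K * ((1 / 2 + σ) * s / ρ ^ 3)))
      = K * (1 / 2 + σ) ^ 2 * s ^ 2 := by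
    field_simp
  rw [e2, e3] at h3
  have h4 : K * (1 / 2 + σ) ^ 2 * s ^ 2 ≤ K * (1 / 2 + σ) ^ 2 * B ^ 2 * ρ ^ 2 := by
    calc K * (1 / 2 + σ) ^ 2 * s ^ 2 ≤ K * (1 / 2 + σ) ^ 2 * B ^ 2 * 1 := by rw [mul_one]; gcongr
      _ ≤ _ := by gcongr
  have h5 : |(τ + 1 / 2) * (σ + 1 / 2)| ≤ |(τ + 1 / 2) * (σ + 1 / 2)| * ρ ^ 2 :=
    le_mul_of_one_le_right (abs_nonneg _) hρ1
  have h6 := abs_le.1 h1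
  have h7 := abs_le.1 h3
  have h8 := neg_abs_le ((τ + 1 / 2) * (σ + 1 / 2))
  have h9 := le_abs_self ((τ + 1 / 2) * (σ + 1 / 2))
  rw [hi, abs_le]
  constructor <;> linarith

/-- The second difference on x, the midpoint of [x, L], and L, where f vanishes at L and is
nonnegative at the midpoint. It limits how many columns near the intercept are very low. -/
lemma quarter_mul_sq_le (h : InversePair L f g) {a : ℝ} (ha : 0 ≤ a) (hf : Curved f a L c C K)
    {x : ℝ} (hax : a ≤ x) (hxL : x ≤ L) : c * (L - x) ^ 2 / 4 ≤ f x := by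
  have h1 := hf.le_second_diff x ((L - x) / 2) (by linarith) hax (by linarith)
  rw [show x + 2 * ((L - x) / 2) = L by ring, h.map_L] at h1
  have h2 := (h.mapsTo (x := x + (L - x) / 2) ⟨by linarith, by linarith⟩).1
  nlinarith

/-- Replacing integer floors by truncated floors changes a column sum by `O(r ^ (2 / 3))`. -/
lemma abs_sum_natFloor_sub_intFloor_le (h : InversePair L f g) {a : ℝ} (ha : 0 ≤ a)
    (hf : Curved f a L c C K) (τ : ℝ) {B ρ s : ℝ} (hB : 1 ≤ B) (hρ : 1 ≤ ρ) (hsB : B⁻¹ ≤ s)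
    (ha' : 0 ≤ a * ρ ^ 3 / s - σ) :
    |∑ j ∈ Finset.Ioc ⌊a * ρ ^ 3 / s - σ⌋₊ ⌊L * ρ ^ 3 / s - σ⌋₊,
        ((⌊ρ ^ 3 * s * f ((j + σ) * s / ρ ^ 3) - τ⌋₊ : ℕ) : ℝ)
      - ∑ j ∈ Finset.Ioc ⌊a * ρ ^ 3 / s - σ⌋₊ ⌊L * ρ ^ 3 / s - σ⌋₊,
        (⌊ρ ^ 3 * s * f ((j + σ) * s / ρ ^ 3) - τ⌋ : ℝ)|
      ≤ (|τ| + 1) * (Real.sqrt (4 * |τ| * B ^ 3 / c) + 1) * ρ ^ 2 := by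
  have hB0 : 0 < B := by linarith
  have hs : 0 < s := lt_of_lt_of_le (by positivity) hsB
  have hρ0 : 0 < ρ := by linarith
  have hr : 0 < ρ ^ 3 := by positivity
  have hc := hf.c_pos
  have hρ1 : 1 ≤ ρ ^ 2 := one_le_pow₀ hρ
  set M := Real.sqrt (4 * |τ| * B ^ 3 / c) with hM
  have hM0 : 0 ≤ M := Real.sqrt_nonneg _
  have hMM : M ^ 2 = 4 * |τ| * B ^ 3 / c := Real.sq_sqrt (by positivity)
  set S := Finset.Ioc ⌊a * ρ ^ 3 / s - σ⌋₊ ⌊L * ρ ^ 3 / s - σ⌋₊ with hS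
  set Y : ℕ → ℝ := fun j => ρ ^ 3 * s * f ((j + σ) * s / ρ ^ 3) with hY
  have hx : ∀ j ∈ S, a ≤ ((j : ℝ) + σ) * s / ρ ^ 3 ∧ ((j : ℝ) + σ) * s / ρ ^ 3 ≤ L
      ∧ (j : ℝ) ≤ L * ρ ^ 3 / s - σ := by
    intro j hj
    rw [hS, Finset.mem_Ioc, Nat.floor_lt ha'] at hj
    have h1 : (j : ℝ) ≤ L * ρ ^ 3 / s - σ := (Nat.le_floor_iff' (by
      have : (0 : ℝ) < j := by linarith
      have : 0 < j := by exact_mod_cast this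
      omega)).1 hj.2
    refine ⟨?_, ?_, h1⟩
    · rw [le_div_iff₀ hr, ← div_le_iff₀ hs]
      linarith
    · rw [div_le_iff₀ hr, ← le_div_iff₀ hs]
      linarith
  have hY0 : ∀ j ∈ S, 0 ≤ Y j := by
    intro j hj
    obtain ⟨h1, h2, -⟩ := hx j hj
    have := (h.mapsTo ⟨ha.trans h1, h2⟩).1
    simp only [hY]
    positivity
  rw [← Finset.sum_sub_distrib]
  have hterm : ∀ j ∈ S, |((⌊Y j - τ⌋₊ : ℕ) : ℝ) - (⌊Y j - τ⌋ : ℝ)|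
      ≤ if Y j < τ then |τ| + 1 else 0 := by
    intro j hj
    split_ifs with hlt
    · have h1 : ⌊Y j - τ⌋₊ = 0 := Nat.floor_of_nonpos (by linarith)
      have h2 := Int.floor_le (Y j - τ)
      have h3 := Int.sub_one_lt_floor (Y j - τ)
      have h4 := hY0 j hj
      have h5 := le_abs_self τ
      rw [h1, Nat.cast_zero, zero_sub, abs_neg, abs_le]
      constructor <;> linarith
    · rw [natCast_floor_eq_intCast_floor (by linarith), sub_self, abs_zero]
  refine (Finset.abs_sum_le_sum_abs _ _).trans ((Finset.sum_le_sum hterm).trans ?_)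
  rw [← Finset.sum_filter, Finset.sum_const, nsmul_eq_mul]
  -- The two floors differ only in columns of height below τ. Quadratic growth away from L confines
  -- these to within O(ρ^(3/2)) indices of the end, and ρ² is enough.
  have hcard : (((S.filter fun j => Y j < τ).card : ℕ) : ℝ) ≤ M * ρ ^ 2 + 1 := by
    apply card_le_of_diam (by positivity)
    intro i hi j hj hij
    rw [Finset.mem_filter] at hi hj
    obtain ⟨h1, h2, h3⟩ := hx i hi.1
    obtain ⟨-, -, h6⟩ := hx j hj.1
    have h4 := quarter_mul_sq_le h ha hf h1 h2
    have h5 : ρ ^ 3 * s * (c * (L - ((i : ℝ) + σ) * s / ρ ^ 3) ^ 2 / 4) ≤ |τ| := by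
      calc _ ≤ Y i := by simp only [hY]; gcongr
        _ ≤ |τ| := hi.2.le.trans (le_abs_self τ)
    have e : ρ ^ 3 * s * (c * (L - ((i : ℝ) + σ) * s / ρ ^ 3) ^ 2 / 4)
        = (L * ρ ^ 3 / s - σ - i) ^ 2 * (c * s ^ 3 / (4 * ρ ^ 3)) := by
      field_simp
      ring
    rw [e, ← le_div_iff₀ (by positivity)] at h5
    have h7 : |τ| / (c * s ^ 3 / (4 * ρ ^ 3)) ≤ (M * ρ ^ 2) ^ 2 := by
      have h8 : s⁻¹ ≤ B := inv_le_of_inv_le₀ hB0 hsB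
      calc |τ| / (c * s ^ 3 / (4 * ρ ^ 3)) = 4 * |τ| * (s⁻¹) ^ 3 / c * ρ ^ 3 := by field_simp
        _ ≤ 4 * |τ| * B ^ 3 / c * ρ ^ 4 := by
          gcongr
          norm_num
        _ = _ := by rw [← hMM]; ring
    have h9 := abs_le_of_sq_le_sq (h5.trans h7) (by positivity)
    linarith [le_abs_self (L * ρ ^ 3 / s - σ - i)]
  calc _ ≤ (M * ρ ^ 2 + 1) * (|τ| + 1) := by gcongr
    _ ≤ (M * ρ ^ 2 + ρ ^ 2) * (|τ| + 1) := by gcongr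
    _ = _ := by ring

/-- Lattice points in the columns to the right of a point of a convex curve. -/
lemma exists_abs_right_sum_sub_le (h : InversePair L f g) {a : ℝ} (ha : 0 < a)
    (haL : a ≤ L) (hf : Curved f a L c C K) (σ τ : ℝ) {B : ℝ} (hB : 1 ≤ B) :
    ∃ D R, 0 ≤ D ∧ 1 ≤ R ∧ ∀ ρ s : ℝ, R ≤ ρ → B⁻¹ ≤ s → s ≤ B →
      0 ≤ a * ρ ^ 3 / s - σ ∧
      |(∑ j ∈ Finset.Ioc ⌊a * ρ ^ 3 / s - σ⌋₊ ⌊L * ρ ^ 3 / s - σ⌋₊,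
          ⌊ρ ^ 3 * s * f ((j + σ) * s / ρ ^ 3) - τ⌋₊ : ℕ)
        - ((ρ ^ 3) ^ 2 * (∫ x in a..L, f x) - (τ + 1 / 2) * (L * ρ ^ 3 / s - a * ρ ^ 3 / s)
          + ρ ^ 3 * s * f a * sawtooth (a * ρ ^ 3 / s - σ))| ≤ D * ρ ^ 2 := by
  obtain ⟨D, hD, hcol⟩ := exists_abs_sum_floor_sub_le (Or.inl hf) σ τ hB
  have hB0 : 0 < B := by linarith
  refine ⟨D + (|τ| + 1) * (Real.sqrt (4 * |τ| * B ^ 3 / c) + 1), 1 + B * |σ| / a,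
    by positivity, ?_, ?_⟩
  · have h1 : 0 ≤ B * |σ| / a := by positivity
    linarith
  intro ρ s hR hsB hsB'
  have hs : 0 < s := lt_of_lt_of_le (by positivity) hsB
  have hR1 : 0 ≤ B * |σ| / a := by positivity
  have hρ : 1 ≤ ρ := by linarith
  have hρ0 : 0 < ρ := by linarith
  have hρ3 := le_cube hρ
  have hr : 0 < ρ ^ 3 := by positivity
  have hp : 0 ≤ a * ρ ^ 3 / s - σ := by
    rw [sub_nonneg, le_div_iff₀ hs]
    have h1 : B * |σ| / a ≤ ρ ^ 3 := by linarith
    rw [div_le_iff₀ ha] at h1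
    calc σ * s ≤ |σ| * B := mul_le_mul (le_abs_self σ) hsB' hs.le (abs_nonneg σ)
      _ ≤ _ := by linarith
  have hpq : a * ρ ^ 3 / s - σ ≤ L * ρ ^ 3 / s - σ := by gcongr
  have he : ∀ z : ℝ, (z * ρ ^ 3 / s - σ + σ) * s / ρ ^ 3 = z := by
    intro z
    rw [sub_add_cancel]
    field_simp
  -- At the right end f(L) = 0 removes the sawtooth term.
  have h1 := hcol ρ s _ _ hρ hsB hsB' hp hpq (he a).ge (he L).le
  rw [he, he, h.map_L, mul_zero, zero_mul, sub_zero,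
    show L * ρ ^ 3 / s - σ - (a * ρ ^ 3 / s - σ) = L * ρ ^ 3 / s - a * ρ ^ 3 / s by ring] at h1
  have h2 := abs_sum_natFloor_sub_intFloor_le h ha.le hf τ hB hρ hsB hp
  refine ⟨hp, ?_⟩
  push_cast
  have h3 := abs_le.1 h1
  have h4 := abs_le.1 h2
  rw [abs_le]
  constructor <;> linarith

/-- The two-term approximation of the counting function. -/
noncomputable def mainTerm (L A σ τ r s : ℝ) : ℝ :=
  r ^ 2 * A - r * L * ((σ + 1 / 2) * s + (τ + 1 / 2) * s⁻¹)

lemma abs_mul_le_of_sawtooth (σ τ x y : ℝ) :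
    |(σ + 1 / 2 + sawtooth x) * (τ + 1 / 2 + sawtooth y)| ≤ (|σ| + 1) * (|τ| + 1) := by
  have key : ∀ σ x : ℝ, |σ + 1 / 2 + sawtooth x| ≤ |σ| + 1 := by
    intro σ x
    have h1 := abs_le.1 (abs_sawtooth_le x)
    have h2 := neg_abs_le σ
    have h3 := le_abs_self σ
    rw [abs_le]
    constructor <;> linarith
  rw [abs_mul]
  exact mul_le_mul (key σ x) (key τ y) (abs_nonneg _) (by positivity)

/-- Two-term asymptotics of the counting function, uniformly for bounded stretch factors. -/
def UniformAsymptotics (L : ℝ) (f : ℝ → ℝ) (σ τ : ℝ) : Prop :=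
  ∀ B : ℝ, 1 ≤ B → ∃ D R, 0 ≤ D ∧ 1 ≤ R ∧ ∀ ρ s : ℝ, R ≤ ρ → B⁻¹ ≤ s → s ≤ B →
    |(count L f σ τ (ρ ^ 3) s : ℝ) - mainTerm L (area L f) σ τ (ρ ^ 3) s| ≤ D * ρ ^ 2

theorem uniformAsymptotics_of_concave (h : InversePair L f g) (hσ : -(1 / 2) < σ)
    (hτ : -(1 / 2) < τ) (hc : ConcaveCondition L f g) : UniformAsymptotics L f σ τ := by
  intro B hB
  obtain ⟨-, a, b, ha, hab, ha0, hb0, hf, hg⟩ := hc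
  subst hab
  have hb := h.mapsTo ha
  have hga : g (f a) = a := h.invOn.1 ha
  obtain ⟨c, C, K, hf'⟩ := hf.exists_curved ha0
  obtain ⟨c', C', K', hg'⟩ := hg.exists_curved hb0
  obtain ⟨D1, R1, hD1, hR1, H1⟩ := exists_abs_left_sum_sub_le h hσ ha0 ha.2 hb0 hf' τ hB
  obtain ⟨D2, R2, hD2, hR2, H2⟩ := exists_abs_left_sum_sub_le h.symm hτ hb0 hb.2
    (by rw [hga]; exact ha0) hg' σ hB
  refine ⟨D1 + D2 + (|σ| + 1) * (|τ| + 1), max R1 R2, by positivity, le_max_of_le_left hR1, ?_⟩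
  intro ρ s hρ hsB hsB'
  have hB0 : 0 < B := by linarith
  have hs : 0 < s := lt_of_lt_of_le (by positivity) hsB
  have hρ1 : 1 ≤ ρ := hR1.trans ((le_max_left _ _).trans hρ)
  have hρ2 : 1 ≤ ρ ^ 2 := one_le_pow₀ hρ1
  have hr : 0 < ρ ^ 3 := by positivity
  obtain ⟨p1, h1⟩ := H1 ρ s ((le_max_left _ _).trans hρ) hsB hsB'
  obtain ⟨p2, h2⟩ := H2 ρ s⁻¹ ((le_max_right _ _).trans hρ) (inv_anti₀ hs hsB')
    (inv_le_of_inv_le₀ hB0 hsB)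
  have hcount : ((count L f σ τ (ρ ^ 3) s
      + ⌊a * ρ ^ 3 / s - σ⌋₊ * ⌊f a * ρ ^ 3 / s⁻¹ - τ⌋₊ : ℕ) : ℝ) = _ :=
    congrArg _ (count_add_mul_eq h hσ hτ hr hs ha)
  rw [Nat.cast_add, Nat.cast_add, Nat.cast_mul, natFloor_eq_sub_sawtooth p1,
    natFloor_eq_sub_sawtooth p2] at hcount
  have hY := h.integral_inverse ha
  rw [hY, hga] at h2
  have hA : area L f = (∫ x in (0 : ℝ)..a, f x) + ∫ x in a..L, f x :=
    (intervalIntegral.integral_add_adjacent_intervals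
      (h.intervalIntegrable le_rfl ha.1 ha.2) (h.intervalIntegrable ha.1 ha.2 le_rfl)).symm
  have h3 := abs_mul_le_of_sawtooth σ τ (a * ρ ^ 3 / s - σ) (f a * ρ ^ 3 / s⁻¹ - τ)
  set u := sawtooth (a * ρ ^ 3 / s - σ)
  set v := sawtooth (f a * ρ ^ 3 / s⁻¹ - τ)
  have e1 : a * ρ ^ 3 / s = ρ ^ 3 * s⁻¹ * a := by field_simp
  have e2 : f a * ρ ^ 3 / s⁻¹ = ρ ^ 3 * s * f a := by field_simp
  have e3 : (ρ ^ 3) ^ 2 * (a * f a) = (ρ ^ 3 * s⁻¹ * a) * (ρ ^ 3 * s * f a) := by field_simp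
  rw [e1, e2] at hcount
  rw [e1] at h1
  rw [e2, mul_add, e3] at h2
  have h4 : (|σ| + 1) * (|τ| + 1) ≤ (|σ| + 1) * (|τ| + 1) * ρ ^ 2 :=
    le_mul_of_one_le_right (by positivity) hρ2
  have h5 := abs_le.1 h1
  have h6 := abs_le.1 h2
  have h7 := abs_le.1 h3
  rw [mainTerm, hA, abs_le]
  -- The sawtooth terms xv and yu are of order r, too large one by one. They cancel against the
  -- expansion of the product of floors (x - σ - 1/2 - u)(y - τ - 1/2 - v), and xy cancels the
  -- rectangle from Young's identity; only (σ + 1/2 + u)(τ + 1/2 + v) = O(1) is left.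
  generalize ρ ^ 3 * s⁻¹ * a = x at *
  generalize ρ ^ 3 * s * f a = y at *
  constructor <;> linarith

theorem uniformAsymptotics_of_convex (h : InversePair L f g) (hσ : -(1 / 2) < σ)
    (hτ : -(1 / 2) < τ) (hc : ConvexCondition L f g) : UniformAsymptotics L f σ τ := by
  intro B hB
  obtain ⟨-, a, b, ha, hab, ha0, hb0, hf, hg⟩ := hc
  subst hab
  have hb := h.mapsTo ha
  have hga : g (f a) = a := h.invOn.1 ha
  have haL : a < L := by
    refine lt_of_le_of_ne ha.2 fun e => ?_
    rw [e, h.map_L] at hb0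
    exact lt_irrefl _ hb0
  have hbL : f a < L := by
    have := h.strictAntiOn h.zero_mem ha ha0
    rwa [h.map_zero] at this
  obtain ⟨c, C, K, hf'⟩ := hf.exists_curved haL
  obtain ⟨c', C', K', hg'⟩ := hg.exists_curved hbL
  obtain ⟨D1, R1, hD1, hR1, H1⟩ := exists_abs_right_sum_sub_le h ha0 ha.2 hf' σ τ hB
  obtain ⟨D2, R2, hD2, hR2, H2⟩ := exists_abs_right_sum_sub_le h.symm hb0 hb.2 hg' τ σ hB
  refine ⟨D1 + D2 + (|σ| + 1) * (|τ| + 1), max R1 R2, by positivity, le_max_of_le_left hR1, ?_⟩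
  intro ρ s hρ hsB hsB'
  have hB0 : 0 < B := by linarith
  have hs : 0 < s := lt_of_lt_of_le (by positivity) hsB
  have hρ1 : 1 ≤ ρ := hR1.trans ((le_max_left _ _).trans hρ)
  have hρ2 : 1 ≤ ρ ^ 2 := one_le_pow₀ hρ1
  have hr : 0 < ρ ^ 3 := by positivity
  obtain ⟨p1, h1⟩ := H1 ρ s ((le_max_left _ _).trans hρ) hsB hsB'
  obtain ⟨p2, h2⟩ := H2 ρ s⁻¹ ((le_max_right _ _).trans hρ) (inv_anti₀ hs hsB')
    (inv_le_of_inv_le₀ hB0 hsB)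
  have hcount : (count L f σ τ (ρ ^ 3) s : ℝ) = _ :=
    congrArg _ (count_eq_add_add_mul h hσ hτ hr hs ha p1 p2)
  rw [Nat.cast_add, Nat.cast_add, Nat.cast_mul, natFloor_eq_sub_sawtooth p1,
    natFloor_eq_sub_sawtooth p2] at hcount
  have hY := h.symm.integral_inverse hb
  rw [hga] at hY
  have hY' : ∫ y in (f a)..L, g y = (∫ x in (0 : ℝ)..a, f x) - a * f a := by
    rw [hY]
    ring
  rw [hY', hga] at h2
  have hA : area L f = (∫ x in (0 : ℝ)..a, f x) + ∫ x in a..L, f x :=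
    (intervalIntegral.integral_add_adjacent_intervals
      (h.intervalIntegrable le_rfl ha.1 ha.2) (h.intervalIntegrable ha.1 ha.2 le_rfl)).symm
  have h3 := abs_mul_le_of_sawtooth σ τ (a * ρ ^ 3 / s - σ) (f a * ρ ^ 3 / s⁻¹ - τ)
  set u := sawtooth (a * ρ ^ 3 / s - σ)
  set v := sawtooth (f a * ρ ^ 3 / s⁻¹ - τ)
  have e1 : ∀ z, z * ρ ^ 3 / s = ρ ^ 3 * s⁻¹ * z := fun z => by field_simp
  have e2 : ∀ z, z * ρ ^ 3 / s⁻¹ = ρ ^ 3 * s * z := fun z => by field_simp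
  have e3 : (ρ ^ 3) ^ 2 * (a * f a) = (ρ ^ 3 * s⁻¹ * a) * (ρ ^ 3 * s * f a) := by field_simp
  rw [e1 a, e1 L] at h1
  rw [e2 (f a), e2 L, mul_sub, e3] at h2
  rw [e1 a, e1 L, e2 (f a), e2 L] at hcount
  have h4 : (|σ| + 1) * (|τ| + 1) ≤ (|σ| + 1) * (|τ| + 1) * ρ ^ 2 :=
    le_mul_of_one_le_right (by positivity) hρ2
  have h5 := abs_le.1 h1
  have h6 := abs_le.1 h2
  have h7 := abs_le.1 h3
  rw [mainTerm, hA, abs_le]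
  -- The same cancellation as in the concave case, with the signs of the sawtooth terms, the
  -- rectangle and the product of floors all reversed.
  generalize ρ ^ 3 * s⁻¹ * a = x at *
  generalize ρ ^ 3 * s * f a = y at *
  constructor <;> linarith

end ShiftedLattice

namespace ShiftedLattice

/-! ### Localization of the optimal stretch factors. -/

variable {L : ℝ} {f g : ℝ → ℝ} {σ τ : ℝ}

lemma InversePair.convexOn_inverse (h : InversePair L f g) (hc : ConvexOn ℝ (Icc 0 L) f) :
    ConvexOn ℝ (Icc 0 L) g := by
  refine ⟨convex_Icc 0 L, fun x hx y hy a b ha hb hab => ?_⟩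
  have hgx := h.mapsTo_inv hx
  have hgy := h.mapsTo_inv hy
  have hm := (convex_Icc 0 L) hgx hgy ha hb hab
  have h1 := hc.2 hgx hgy ha hb hab
  rw [h.invOn.2 hx, h.invOn.2 hy] at h1
  have h2 := h.symm.antitoneOn (h.mapsTo hm) ((convex_Icc 0 L) hx hy ha hb hab) h1
  rwa [h.invOn.1 hm] at h2

lemma InversePair.concaveOn_inverse (h : InversePair L f g) (hc : ConcaveOn ℝ (Icc 0 L) f) :
    ConcaveOn ℝ (Icc 0 L) g := by
  refine ⟨convex_Icc 0 L, fun x hx y hy a b ha hb hab => ?_⟩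
  have hgx := h.mapsTo_inv hx
  have hgy := h.mapsTo_inv hy
  have hm := (convex_Icc 0 L) hgx hgy ha hb hab
  have h1 := hc.2 hgx hgy ha hb hab
  rw [h.invOn.2 hx, h.invOn.2 hy] at h1
  have h2 := h.symm.antitoneOn ((convex_Icc 0 L) hx hy ha hb hab) (h.mapsTo hm) h1
  rwa [h.invOn.1 hm] at h2

lemma InversePair.area_pos (h : InversePair L f g) : 0 < area L f := by
  have hL := h.L_pos
  have hm : L / 2 ∈ Icc 0 L := ⟨by linarith, by linarith⟩
  have hf := h.strictAntiOn hm h.L_mem (by linarith)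
  rw [h.map_L] at hf
  have h1 := affine_le_integral (A := f (L / 2)) (B := 0) hm.1
    (h.intervalIntegrable le_rfl hm.1 hm.2) fun x hx => by
      have := h.antitoneOn ⟨hx.1, hx.2.trans hm.2⟩ hm hx.2
      linarith
  have h2 : 0 ≤ ∫ x in (L / 2)..L, f x :=
    intervalIntegral.integral_nonneg hm.2 fun x hx => (h.mapsTo ⟨hm.1.trans hx.1, hx.2⟩).1
  have h3 : area L f = (∫ x in (0 : ℝ)..(L / 2), f x) + ∫ x in (L / 2)..L, f x :=
    (intervalIntegral.integral_add_adjacent_intervals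
      (h.intervalIntegrable le_rfl hm.1 hm.2) (h.intervalIntegrable hm.1 hm.2 le_rfl)).symm
  have h4 : 0 < L * f (L / 2) := mul_pos hL hf
  linarith

/-- Two-term upper bound for the counting function at stretch factors `s ≥ 1`. -/
def UpperBound (L : ℝ) (f : ℝ → ℝ) (σ τ : ℝ) : Prop :=
  ∃ c, 0 < c ∧ ∀ r s : ℝ, 0 < r → 1 ≤ s → 0 < count L f σ τ r s →
    (count L f σ τ r s : ℝ) ≤ r ^ 2 * area L f - c * (r * s) + 1

lemma UpperBound.exists_count_le (h : InversePair L f g) (hσ : -(1 / 2) < σ) (hτ : -(1 / 2) < τ)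
    (hf : UpperBound L f σ τ) (hg : UpperBound L g τ σ) :
    ∃ c, 0 < c ∧ ∀ r s : ℝ, 0 < r → 0 < s → 0 < count L f σ τ r s →
      (count L f σ τ r s : ℝ) ≤ r ^ 2 * area L f - c * (r * max s s⁻¹) + 1 := by
  obtain ⟨c1, hc1, H1⟩ := hf
  obtain ⟨c2, hc2, H2⟩ := hg
  refine ⟨min c1 c2, lt_min hc1 hc2, fun r s hr hs hN => ?_⟩
  rcases le_total 1 s with h1 | h1
  · have h2 : s⁻¹ ≤ s := (inv_le_one_of_one_le₀ h1).trans h1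
    rw [max_eq_left h2]
    have h3 := H1 r s hr h1 hN
    have h4 : min c1 c2 * (r * s) ≤ c1 * (r * s) := by
      gcongr
      exact min_le_left _ _
    linarith
  · have h1' : 1 ≤ s⁻¹ := (one_le_inv₀ hs).2 h1
    rw [max_eq_right (h1.trans h1')]
    rw [← count_swap h hσ hτ hr hs] at hN ⊢
    have h3 := H2 r s⁻¹ hr h1' hN
    rw [h.area_comm] at h3
    have h4 : min c1 c2 * (r * s⁻¹) ≤ c2 * (r * s⁻¹) := by
      gcongr
      exact min_le_right _ _
    linarith

lemma sStar_pos (hσ : -(1 / 2) < σ) (hτ : -(1 / 2) < τ) : 0 < sStar σ τ :=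
  Real.sqrt_pos.2 (div_pos (by linarith) (by linarith))

/-- The arithmetic-geometric mean inequality with its defect written out; the square converts a loss
in the count into a distance from s*. -/
lemma perimeter_eq (hσ : -(1 / 2) < σ) (hτ : -(1 / 2) < τ) {s : ℝ} (hs : 0 < s) :
    (σ + 1 / 2) * s + (τ + 1 / 2) * s⁻¹
      = 2 * Real.sqrt ((σ + 1 / 2) * (τ + 1 / 2)) + (σ + 1 / 2) * (s - sStar σ τ) ^ 2 * s⁻¹ := by
  have hσ' : 0 < σ + 1 / 2 := by linarith
  have hτ' : 0 < τ + 1 / 2 := by linarith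
  have h1 : sStar σ τ ^ 2 = (τ + 1 / 2) / (σ + 1 / 2) := Real.sq_sqrt (by positivity)
  have h2 : Real.sqrt ((σ + 1 / 2) * (τ + 1 / 2)) = (σ + 1 / 2) * sStar σ τ := by
    rw [Real.sqrt_eq_iff_mul_self_eq (by positivity)
      (mul_nonneg hσ'.le (sStar_pos hσ hτ).le)]
    rw [show (σ + 1 / 2) * sStar σ τ * ((σ + 1 / 2) * sStar σ τ)
      = (σ + 1 / 2) ^ 2 * sStar σ τ ^ 2 by ring, h1]
    field_simp
  have h3 : τ + 1 / 2 = (σ + 1 / 2) * sStar σ τ ^ 2 := by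
    rw [h1, mul_comm, div_mul_cancel₀ _ hσ'.ne']
  rw [h2, h3]
  field_simp
  ring

lemma mainTerm_eq (hσ : -(1 / 2) < σ) (hτ : -(1 / 2) < τ) {s : ℝ} (hs : 0 < s) (L A r : ℝ) :
    mainTerm L A σ τ r s = r ^ 2 * A - 2 * r * L * Real.sqrt ((σ + 1 / 2) * (τ + 1 / 2))
      - r * L * ((σ + 1 / 2) * (s - sStar σ τ) ^ 2 * s⁻¹) := by
  rw [mainTerm, perimeter_eq hσ hτ hs]
  ring

/-- Lower bound for the counting function at the limiting stretch factor. -/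
lemma UniformAsymptotics.exists_le_count (hσ : -(1 / 2) < σ) (hτ : -(1 / 2) < τ)
    (hN : UniformAsymptotics L f σ τ) :
    ∃ D R, 0 ≤ D ∧ 1 ≤ R ∧ ∀ ρ : ℝ, R ≤ ρ →
      (ρ ^ 3) ^ 2 * area L f - 2 * ρ ^ 3 * L * Real.sqrt ((σ + 1 / 2) * (τ + 1 / 2)) - D * ρ ^ 2
        ≤ count L f σ τ (ρ ^ 3) (sStar σ τ) := by
  have hs := sStar_pos hσ hτ
  have hB : 1 ≤ max 1 (max (sStar σ τ) (sStar σ τ)⁻¹) := le_max_left _ _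
  obtain ⟨D, R, hD, hR, H⟩ := hN _ hB
  refine ⟨D, R, hD, hR, fun ρ hρ => ?_⟩
  have h1 := H ρ (sStar σ τ) hρ
    (inv_le_of_inv_le₀ hs ((le_max_right _ _).trans (le_max_right _ _)))
    ((le_max_left _ _).trans (le_max_right _ _))
  rw [mainTerm_eq hσ hτ hs, sub_self] at h1
  have := (abs_le.1 h1).1
  norm_num at this ⊢
  linarith

/-- Optimal stretch factors and maximal counts, with rates. -/
theorem exists_optimalStretch_bounds (h : InversePair L f g) (hσ : -(1 / 2) < σ)
    (hτ : -(1 / 2) < τ) (hN : UniformAsymptotics L f σ τ) (hf : UpperBound L f σ τ)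
    (hg : UpperBound L g τ σ) :
    ∃ E F R, 0 ≤ E ∧ ∀ ρ : ℝ, R ≤ ρ → ∀ s ∈ optimalStretch L f σ τ (ρ ^ 3),
      |s - sStar σ τ| ≤ E / Real.sqrt ρ ∧
      |(count L f σ τ (ρ ^ 3) s : ℝ) - ((ρ ^ 3) ^ 2 * area L f
        - 2 * ρ ^ 3 * L * Real.sqrt ((σ + 1 / 2) * (τ + 1 / 2)))| ≤ F * ρ ^ 2 := by
  have hA := h.area_pos
  have hL := h.L_pos
  have hσ' : 0 < σ + 1 / 2 := by linarith
  have hsS := sStar_pos hσ hτ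
  obtain ⟨c, hc, hcount⟩ := UpperBound.exists_count_le h hσ hτ hf hg
  obtain ⟨D, R, hD, hR, hlow⟩ := hN.exists_le_count hσ hτ
  set w := Real.sqrt ((σ + 1 / 2) * (τ + 1 / 2))
  have hw : 0 ≤ w := Real.sqrt_nonneg _
  -- The count at s* is at least r² Area - Mr. Against the upper bound this gives c max(s, 1/s) ≤ M
  -- + 1 for a maximizer, hence the compact range [1/B, B].
  set M := 2 * L * w + D with hM
  have hM0 : 0 ≤ M := by positivity
  set B := max 1 ((M + 1) / c) with hB
  have hB1 : 1 ≤ B := le_max_left _ _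
  have hB0 : 0 < B := by linarith
  obtain ⟨D', R', hD', hR', hup⟩ := hN B hB1
  refine ⟨Real.sqrt (B * (D + D') / (L * (σ + 1 / 2))), D + D', max (max R R') ((M + 1) / area L f),
    Real.sqrt_nonneg _, ?_⟩
  intro ρ hρ s hs
  have hρR : R ≤ ρ := (le_max_left _ _).trans ((le_max_left _ _).trans hρ)
  have hρR' : R' ≤ ρ := (le_max_right _ _).trans ((le_max_left _ _).trans hρ)
  have hρA : (M + 1) / area L f ≤ ρ := (le_max_right _ _).trans hρ
  have hρ1 : 1 ≤ ρ := hR.trans hρR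
  have hρ0 : 0 < ρ := by linarith
  have hr : 0 < ρ ^ 3 := by positivity
  have hρ3 := le_cube hρ1
  have hρ23 : ρ ^ 2 ≤ ρ ^ 3 := pow_le_pow_right₀ hρ1 (by norm_num)
  obtain ⟨hs0, hsmax⟩ := hs
  have h1 := hlow ρ hρR
  have h2 : (count L f σ τ (ρ ^ 3) (sStar σ τ) : ℝ) ≤ count L f σ τ (ρ ^ 3) s := by
    exact_mod_cast hsmax _ hsS
  have h3 : (ρ ^ 3) ^ 2 * area L f - M * ρ ^ 3 ≤ count L f σ τ (ρ ^ 3) s := by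
    have : D * ρ ^ 2 ≤ D * ρ ^ 3 := by gcongr
    rw [hM]
    linarith
  -- The upper bound holds only for nonzero counts; for large ρ the quadratic term of the lower
  -- bound secures this.
  have hpos : 0 < count L f σ τ (ρ ^ 3) s := by
    rw [div_le_iff₀ hA] at hρA
    have h4 : M + 1 ≤ ρ ^ 3 * area L f := hρA.trans (by gcongr)
    have h5 : ρ ^ 3 * (M + 1) ≤ ρ ^ 3 * (ρ ^ 3 * area L f) := by gcongr
    have h6 : (0 : ℝ) < count L f σ τ (ρ ^ 3) s := by linarith
    exact_mod_cast h6
  have h4 := hcount _ s hr hs0 hpos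
  have hmax : max s s⁻¹ ≤ B := by
    refine le_trans ?_ (le_max_right _ _)
    rw [le_div_iff₀ hc]
    have h5 : ρ ^ 3 * (max s s⁻¹ * c) ≤ ρ ^ 3 * (M + 1) := by linarith
    exact le_of_mul_le_mul_left h5 hr
  have hsB : s ≤ B := (le_max_left _ _).trans hmax
  have hsB' : B⁻¹ ≤ s := inv_le_of_inv_le₀ hs0 ((le_max_right _ _).trans hmax)
  have h5 := hup ρ s hρR' hsB' hsB
  rw [mainTerm_eq hσ hτ hs0] at h5
  have h6 := abs_le.1 h5
  have hdev : 0 ≤ ρ ^ 3 * L * ((σ + 1 / 2) * (s - sStar σ τ) ^ 2 * s⁻¹) := by positivity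
  constructor
  · have h7 : ρ ^ 3 * L * ((σ + 1 / 2) * (s - sStar σ τ) ^ 2 * s⁻¹) ≤ (D + D') * ρ ^ 2 := by
      linarith
    -- The deviation term ρ³(s - s*)² is O(ρ²), and s ≤ B removes the factor 1/s. Hence |s - s*| is
    -- O(ρ^(-1/2)), that is O(r^(-1/6)).
    have h8 : (s - sStar σ τ) ^ 2 ≤ B * (D + D') / (L * (σ + 1 / 2)) / ρ := by
      have e : (s - sStar σ τ) ^ 2 = s * (ρ ^ 3 * L * ((σ + 1 / 2) * (s - sStar σ τ) ^ 2 * s⁻¹))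
          / (L * (σ + 1 / 2) * ρ ^ 3) := by
        rw [eq_div_iff (by positivity)]
        field_simp
      calc (s - sStar σ τ) ^ 2 = _ := e
        _ ≤ B * ((D + D') * ρ ^ 2) / (L * (σ + 1 / 2) * ρ ^ 3) := by gcongr
        _ = _ := by field_simp
    rw [← Real.sqrt_div (by positivity)]
    exact Real.abs_le_sqrt h8
  · have h7 : 0 ≤ D * ρ ^ 2 := by positivity
    have h8 : 0 ≤ D' * ρ ^ 2 := by positivity
    rw [abs_le]
    constructor <;> linarith

lemma uniformAsymptotics_and_upperBounds (h : InversePair L f g) (hσ : -(1 / 2) < σ)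
    (hτ : -(1 / 2) < τ)
    (hcond : (ParamConcave L f g σ τ ∧ ConcaveCondition L f g) ∨
      (ParamConvex L f g σ τ ∧ ConvexCondition L f g)) :
    UniformAsymptotics L f σ τ ∧ UpperBound L f σ τ ∧ UpperBound L g τ σ := by
  rcases hcond with ⟨hp, hc⟩ | ⟨hp, hc⟩
  · obtain ⟨h1, h2⟩ := max_lt_iff.1 hp.max_lt
    exact ⟨uniformAsymptotics_of_concave h hσ hτ hc,
      exists_count_le_of_concaveOn h hσ hτ hp.concaveOn h1,
      exists_count_le_of_concaveOn h.symm hτ hσ (h.concaveOn_inverse hp.concaveOn)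
        (by linarith)⟩
  · obtain ⟨h1, h2⟩ := lt_min_iff.1 hp.lt_min
    exact ⟨uniformAsymptotics_of_convex h hσ hτ hc,
      exists_count_le_of_convexOn h hσ hτ hp.convexOn h1,
      exists_count_le_of_convexOn h.symm hτ hσ (h.convexOn_inverse hp.convexOn)
        (by linarith)⟩

end ShiftedLattice

theorem theorem2 (L : ℝ) (f g : ℝ → ℝ) (σ τ : ℝ)
    (hcurve : ShiftedLattice.IsDecreasingCurve L f g)
    (hσ : -(1 / 2) < σ) (hτ : -(1 / 2) < τ)
    (hcond :
      (ShiftedLattice.ParamConcave L f g σ τ ∧ ShiftedLattice.ConcaveCondition L f g) ∨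
      (ShiftedLattice.ParamConvex L f g σ τ ∧ ShiftedLattice.ConvexCondition L f g)) :
    (∀ ε : ℝ, 0 < ε → ∀ᶠ r : ℝ in atTop, ∀ s ∈ ShiftedLattice.optimalStretch L f σ τ r,
      |s - ShiftedLattice.sStar σ τ| < ε) ∧
    (∃ C : ℝ, ∀ᶠ r : ℝ in atTop, ShiftedLattice.optimalStretch L f σ τ r ⊆
      Icc (ShiftedLattice.sStar σ τ - C * r ^ (-(1 / 6) : ℝ))
        (ShiftedLattice.sStar σ τ + C * r ^ (-(1 / 6) : ℝ))) ∧
    (∃ maxN : ℝ → ℕ,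
      (∀ r : ℝ, 0 < r →
        IsGreatest ((fun s => ShiftedLattice.count L f σ τ r s) '' Ioi 0) (maxN r)) ∧
      (fun r : ℝ => (maxN r : ℝ) - (r ^ 2 * ShiftedLattice.area L f
          - 2 * r * L * Real.sqrt ((σ + 1 / 2) * (τ + 1 / 2))))
        =O[atTop] fun r : ℝ => r ^ (2 / 3 : ℝ)) ∧
    (σ = τ → ∀ ε : ℝ, 0 < ε → ∀ᶠ r : ℝ in atTop,
      ∀ s ∈ ShiftedLattice.optimalStretch L f σ τ r, |s - 1| < ε) := by
  have h := hcurve.inversePair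
  obtain ⟨hN, hf, hg⟩ := ShiftedLattice.uniformAsymptotics_and_upperBounds h hσ hτ hcond
  obtain ⟨E, F, R, hE, hmain⟩ :=
    ShiftedLattice.exists_optimalStretch_bounds h hσ hτ hN hf hg
  have hev : ∀ᶠ r : ℝ in atTop, 0 < r ∧ R ≤ r ^ (1 / 3 : ℝ) :=
    (eventually_gt_atTop 0).and
      ((tendsto_rpow_atTop (by norm_num : (0 : ℝ) < 1 / 3)).eventually_ge_atTop R)
  have hcube : ∀ r : ℝ, 0 < r → (r ^ (1 / 3 : ℝ)) ^ 3 = r := fun r hr => by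
    rw [← Real.rpow_natCast, ← Real.rpow_mul hr.le]
    norm_num
  have hsquare : ∀ r : ℝ, 0 < r → (r ^ (1 / 3 : ℝ)) ^ 2 = r ^ (2 / 3 : ℝ) := fun r hr => by
    rw [← Real.rpow_natCast, ← Real.rpow_mul hr.le]
    norm_num
  have hsqrt : ∀ r : ℝ, 0 < r → E / Real.sqrt (r ^ (1 / 3 : ℝ)) = E * r ^ (-(1 / 6) : ℝ) :=
    fun r hr => by
      rw [Real.sqrt_eq_rpow, ← Real.rpow_mul hr.le, div_eq_mul_inv, ← Real.rpow_neg hr.le]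
      norm_num
  have hrate : ∀ᶠ r : ℝ in atTop, ∀ s ∈ ShiftedLattice.optimalStretch L f σ τ r,
      |s - ShiftedLattice.sStar σ τ| ≤ E * r ^ (-(1 / 6) : ℝ) := by
    filter_upwards [hev] with r hr s hs
    have := (hmain _ hr.2 s (by rwa [hcube r hr.1])).1
    rwa [hsqrt r hr.1] at this
  have hlim : ∀ ε : ℝ, 0 < ε → ∀ᶠ r : ℝ in atTop,
      ∀ s ∈ ShiftedLattice.optimalStretch L f σ τ r, |s - ShiftedLattice.sStar σ τ| < ε := by
    intro ε hε
    have ht : Tendsto (fun r : ℝ => E * r ^ (-(1 / 6) : ℝ)) atTop (𝓝 0) := by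
      simpa using (tendsto_rpow_neg_atTop (by norm_num : (0 : ℝ) < 1 / 6)).const_mul E
    filter_upwards [hrate, ht.eventually_lt_const hε] with r h1 h2 s hs
    exact (h1 s hs).trans_lt h2
  refine ⟨hlim, ⟨E, ?_⟩, ?_, ?_⟩
  · filter_upwards [hrate] with r hr s hs
    have := abs_le.1 (hr s hs)
    exact ⟨by linarith, by linarith⟩
  · classical
    refine ⟨fun r => if hr : 0 < r then
      (ShiftedLattice.exists_isGreatest_count h hσ hτ hr).choose else 0, fun r hr => ?_, ?_⟩
    · simp only [dif_pos hr]
      exact (ShiftedLattice.exists_isGreatest_count h hσ hτ hr).choose_spec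
    · refine IsBigO.of_bound F ?_
      filter_upwards [hev] with r hr
      simp only [dif_pos hr.1]
      have hspec := (ShiftedLattice.exists_isGreatest_count h hσ hτ hr.1).choose_spec
      obtain ⟨s, hs, hsM⟩ := hspec.1
      rw [← hsM]
      have hopt : s ∈ ShiftedLattice.optimalStretch L f σ τ r := by
        refine ⟨hs, fun t ht => ?_⟩
        have := hspec.2 ⟨t, ht, rfl⟩
        rw [← hsM] at this
        exact this
      have h1 := (hmain _ hr.2 s (by rwa [hcube r hr.1])).2
      rw [hcube r hr.1, hsquare r hr.1] at h1
      rw [Real.norm_eq_abs, Real.norm_eq_abs, abs_of_nonneg (Real.rpow_nonneg hr.1.le _)]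
      exact h1
  · rintro rfl
    have h1 : ShiftedLattice.sStar σ σ = 1 := by
      rw [ShiftedLattice.sStar, div_self (by linarith), Real.sqrt_one]
    rwa [h1] at hlim
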